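/- Let $\Gamma\cong\mathbb Z_m$ ($m\ge 1$) be a finite cyclic group with a faithful character $\epsilon:\Gamma\to\mathbb C^\times$, embedded in $SL_2(\mathbb C)$ by $g\mapsto \mathrm{diag}(\epsilon(g),\epsilon(g)^{-1})$. For $\tau\in\mathbb C\Gamma$ let $B^\tau$ be the $\mathbb C$-algebra generated by $\mathbb C\Gamma$ and two elements $x,y$ with relations $g\,x=\epsilon(g)\,x\,g$, $g\,y=\epsilon(g)^{-1}\,y\,g$ ($g\in\Gamma$) and $xy-yx=\tau$; put $e=\frac1{|\Gamma|}\sum_{g\in\Gamma}g$ and $O^\tau=eB^\tau e$. Assume that $\tau$ is generic: if $\lambda_i=\sum_{g}\tau(g)\,\epsilon(g)^i$ ($i\in\mathbb Z/m$), where $\tau=\sum_g\tau(g)\,g$, then $\sum_i\alpha_i\lambda_i\neq 0$ for every root $\alpha\in\mathbb Z^{m}$ of the affine root system of type $\tilde A_{m-1}$, that is, for every $\alpha\ne 0$ with $\sum_i\alpha_i^2-\sum_i\alpha_i\alpha_{i+1}\le 1$. For a ring $A$ let $K_0(A)$ be the Grothendieck group of finitely generated projective right $A$-modules, and write $K_0(\Gamma)=K_0(\mathbb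 C\Gamma)$. Then $P\mapsto P\otimes_{\mathbb C\Gamma}B^\tau$ and $M\mapsto M\otimes_{B^\tau}B^\tau e$ preserve finitely generated projective modules and induce isomorphisms $K_0(\Gamma)\cong K_0(B^\tau)$ and $K_0(B^\tau)\cong K_0(O^\tau)$. Moreover, every finitely generated projective right $O^\tau$-module $N$ has a finite rank (the maximal number of right $O^\tau$-linearly independent elements, which is the dimension of the module obtained by extending scalars to the quotient division ring of $O^\tau$), this rank extends to a homomorphism $\mathtt{rk}:K_0(O^\tau)\to\mathbb Z$, and under the above identification of $K_0(O^\tau)$ with $K_0(\Gamma)$ the homomorphism $\mathtt{rk}$ coincides with the homomorphism $\dim:K_0(\Gamma)\to\mathbb Z$ that sends the class of a finite-dimensional $\Gamma$-module to its dimension over $\mathbb C$. -/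

import Mathlib

universe u

open scoped TensorProduct

noncomputable section

namespace KleinianQuant

/-! ### The Grothendieck group of a ring

A right `A`-module is a module over the opposite ring `Aᵐᵒᵖ`. -/

/-- A finitely generated projective right `A`-module. -/
structure FGProj (A : Type u) [Ring A] where
  carrier : Type u
  [addCommGroup : AddCommGroup carrier]
  [module : Module Aᵐᵒᵖ carrier]
  [finite : Module.Finite Aᵐᵒᵖ carrier]
  [projective : Module.Projective Aᵐᵒᵖ carrier]

attribute [instance] FGProj.addCommGroup FGProj.module FGProj.finite FGProj.projective

/-- The subgroup of relations `[P] = [Q] + [R]` whenever `P ≅ Q ⊕ R`. (Taking `R = 0` gives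
`[P] = [Q]` for isomorphic `P` and `Q`; exact sequences of projective modules split, so these
are also the relations coming from exact sequences.) -/
def K0Rel (A : Type u) [Ring A] : AddSubgroup (FreeAbelianGroup (FGProj A)) :=
  AddSubgroup.closure
    {z | ∃ P Q R : FGProj A, Nonempty (P.carrier ≃ₗ[Aᵐᵒᵖ] (Q.carrier × R.carrier)) ∧
      z = FreeAbelianGroup.of P - (FreeAbelianGroup.of Q + FreeAbelianGroup.of R)}

/-- The Grothendieck group of finitely generated projective right `A`-modules. -/
abbrev K0 (A : Type u) [Ring A] : Type (u + 1) :=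
  FreeAbelianGroup (FGProj A) ⧸ K0Rel A

/-- The class `[P]` in `K0 A` of a finitely generated projective right `A`-module `P`. -/
def K0.of {A : Type u} [Ring A] (P : Type u) [AddCommGroup P] [Module Aᵐᵒᵖ P]
    [Module.Finite Aᵐᵒᵖ P] [Module.Projective Aᵐᵒᵖ P] : K0 A :=
  QuotientAddGroup.mk (FreeAbelianGroup.of (FGProj.mk P))

/-- `HasClass P ξ`: the right `A`-module `P` is finitely generated and projective, and its class
in `K0 A` is `ξ`. -/
def HasClass {A : Type u} [Ring A] (P : Type u) [AddCommGroup P] [Module Aᵐᵒᵖ P] (ξ : K0 A) :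
    Prop :=
  ∃ (_ : Module.Finite Aᵐᵒᵖ P) (_ : Module.Projective Aᵐᵒᵖ P), ξ = K0.of P

/-! ### Tensor product over a noncommutative ring -/

/-- For a right `A`-module `M` and an `(A, C)`-bimodule `N`, the right `C`-module `M ⊗_A N`: the
quotient of the tensor product of abelian groups (written with the factors in the order `N`, `M`)
by the relations `(m · a) ⊗ n = m ⊗ (a · n)`. -/
abbrev BalancedTensor (A C : Type u) [Ring A] [Ring C] (M N : Type u)
    [AddCommGroup M] [Module Aᵐᵒᵖ M] [AddCommGroup N] [Module A N] [Module Cᵐᵒᵖ N]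
    [SMulCommClass A Cᵐᵒᵖ N] : Type u :=
  (N ⊗[ℤ] M) ⧸ Submodule.span Cᵐᵒᵖ
    {z : N ⊗[ℤ] M | ∃ (m : M) (a : A) (n : N),
      z = n ⊗ₜ[ℤ] (MulOpposite.op a • m) - (a • n) ⊗ₜ[ℤ] m}

/-! ### Dimension and rank -/

/-- The complex dimension of a right module over a complex algebra. -/
def complexDim (A : Type u) [Ring A] [Algebra ℂ A] (P : Type u) [AddCommGroup P]
    [Module Aᵐᵒᵖ P] : ℕ :=
  letI : Module ℂ P := Module.compHom P (algebraMap ℂ Aᵐᵒᵖ)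
  Module.finrank ℂ P

lemma complexDim_add {A : Type u} [Ring A] [Algebra ℂ A] [Module.Finite ℂ A]
    (P Q R : FGProj A) (f : P.carrier ≃ₗ[Aᵐᵒᵖ] (Q.carrier × R.carrier)) :
    complexDim A P.carrier = complexDim A Q.carrier + complexDim A R.carrier := by
  let iP : Module ℂ P.carrier := Module.compHom P.carrier (algebraMap ℂ Aᵐᵒᵖ)
  let iQ : Module ℂ Q.carrier := Module.compHom Q.carrier (algebraMap ℂ Aᵐᵒᵖ)
  let iR : Module ℂ R.carrier := Module.compHom R.carrier (algebraMap ℂ Aᵐᵒᵖ)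
  have : Module.Finite ℂ Aᵐᵒᵖ := Module.Finite.equiv (MulOpposite.opLinearEquiv ℂ (M := A))
  have : IsScalarTower ℂ Aᵐᵒᵖ Q.carrier := IsScalarTower.of_algebraMap_smul fun _ _ => rfl
  have : IsScalarTower ℂ Aᵐᵒᵖ R.carrier := IsScalarTower.of_algebraMap_smul fun _ _ => rfl
  have : Module.Finite ℂ Q.carrier := Module.Finite.trans Aᵐᵒᵖ Q.carrier
  have : Module.Finite ℂ R.carrier := Module.Finite.trans Aᵐᵒᵖ R.carrier
  let g : P.carrier ≃ₗ[ℂ] (Q.carrier × R.carrier) :=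
    { f with map_smul' := fun c p => f.map_smul (algebraMap ℂ Aᵐᵒᵖ c) p }
  change Module.finrank ℂ P.carrier = Module.finrank ℂ Q.carrier + Module.finrank ℂ R.carrier
  rw [g.finrank_eq, Module.finrank_prod]

/-- The homomorphism `dim : K0 A → ℤ`, `[P] ↦ dim_ℂ P`, for a finite-dimensional complex
algebra `A`. -/
def dimHom (A : Type u) [Ring A] [Algebra ℂ A] [Module.Finite ℂ A] : K0 A →+ ℤ :=
  QuotientAddGroup.lift (K0Rel A)
    (FreeAbelianGroup.lift fun P : FGProj A => (complexDim A P.carrier : ℤ)) <| by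
      refine (AddSubgroup.closure_le _).2 ?_
      rintro z ⟨P, Q, R, ⟨f⟩, rfl⟩
      simp [complexDim_add P Q R f]

/-- The right `A`-module `P` has rank `r`: `r` is the maximal number of right `A`-linearly
independent elements of `P`. For a right Ore domain `A` with quotient division ring `D`, it is
the dimension of `P ⊗_A D` over `D`. -/
def HasRank (A : Type u) [Ring A] (P : Type u) [AddCommGroup P] [Module Aᵐᵒᵖ P] (r : ℕ) : Prop :=
  Module.rank Aᵐᵒᵖ P = r

/-! ### The algebras `B^τ` and `O^τ` -/

variable {Γ : Type u} [CommGroup Γ] [Finite Γ]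

/-- The generators of `ℂ⟨x, y⟩ ∗ Γ`. -/
inductive Gen (Γ : Type u) : Type u
  | grp (g : Γ) : Gen Γ
  | x : Gen Γ
  | y : Gen Γ

/-- The defining relations of `B^τ = (ℂ⟨x, y⟩ ∗ Γ) / (x y - y x - τ)`: those of the group `Γ`,
those of the crossed product (`g x = ε(g) x g` and `g y = ε(g)⁻¹ y g`), and `x y - y x = τ`. -/
inductive Rel (ε : Γ →* ℂˣ) (τ : MonoidAlgebra ℂ Γ) :
    FreeAlgebra ℂ (Gen Γ) → FreeAlgebra ℂ (Gen Γ) → Prop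
  | one : Rel ε τ (FreeAlgebra.ι ℂ (Gen.grp 1)) 1
  | mul (g h : Γ) : Rel ε τ (FreeAlgebra.ι ℂ (Gen.grp (g * h)))
      (FreeAlgebra.ι ℂ (Gen.grp g) * FreeAlgebra.ι ℂ (Gen.grp h))
  | grp_x (g : Γ) : Rel ε τ (FreeAlgebra.ι ℂ (Gen.grp g) * FreeAlgebra.ι ℂ Gen.x)
      ((ε g : ℂ) • (FreeAlgebra.ι ℂ Gen.x * FreeAlgebra.ι ℂ (Gen.grp g)))
  | grp_y (g : Γ) : Rel ε τ (FreeAlgebra.ι ℂ (Gen.grp g) * FreeAlgebra.ι ℂ Gen.y)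
      (((ε g)⁻¹ : ℂ) • (FreeAlgebra.ι ℂ Gen.y * FreeAlgebra.ι ℂ (Gen.grp g)))
  | comm : Rel ε τ
      (FreeAlgebra.ι ℂ Gen.x * FreeAlgebra.ι ℂ Gen.y -
        FreeAlgebra.ι ℂ Gen.y * FreeAlgebra.ι ℂ Gen.x)
      (τ.coeff.sum fun g c => c • FreeAlgebra.ι ℂ (Gen.grp g))

/-- The algebra `B^τ`. -/
def B (ε : Γ →* ℂˣ) (τ : MonoidAlgebra ℂ Γ) : Type u := RingQuot (Rel ε τ)

instance (ε : Γ →* ℂˣ) (τ : MonoidAlgebra ℂ Γ) : Ring (B ε τ) :=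
  inferInstanceAs (Ring (RingQuot (Rel ε τ)))

instance (ε : Γ →* ℂˣ) (τ : MonoidAlgebra ℂ Γ) : Algebra ℂ (B ε τ) :=
  inferInstanceAs (Algebra ℂ (RingQuot (Rel ε τ)))

/-- The quotient map onto `B^τ`. -/
def B.mk (ε : Γ →* ℂˣ) (τ : MonoidAlgebra ℂ Γ) : FreeAlgebra ℂ (Gen Γ) →ₐ[ℂ] B ε τ :=
  RingQuot.mkAlgHom ℂ (Rel ε τ)

/-- The map `Γ → B^τ`. -/
def B.grp (ε : Γ →* ℂˣ) (τ : MonoidAlgebra ℂ Γ) : Γ →* B ε τ where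
  toFun g := B.mk ε τ (FreeAlgebra.ι ℂ (Gen.grp g))
  map_one' := (RingQuot.mkAlgHom_rel ℂ (Rel.one (ε := ε) (τ := τ))).trans (map_one (B.mk ε τ))
  map_mul' g h :=
    (RingQuot.mkAlgHom_rel ℂ (Rel.mul (ε := ε) (τ := τ) g h)).trans (map_mul (B.mk ε τ) _ _)

/-- The algebra homomorphism `ℂΓ → B^τ`. -/
def B.ofGroupAlgebra (ε : Γ →* ℂˣ) (τ : MonoidAlgebra ℂ Γ) : MonoidAlgebra ℂ Γ →ₐ[ℂ] B ε τ :=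
  MonoidAlgebra.lift ℂ (B ε τ) Γ (B.grp ε τ)

/-- The left `ℂΓ`-module structure on `B^τ`. -/
instance (ε : Γ →* ℂˣ) (τ : MonoidAlgebra ℂ Γ) : Module (MonoidAlgebra ℂ Γ) (B ε τ) :=
  Module.compHom (B ε τ) (B.ofGroupAlgebra ε τ).toRingHom

instance (ε : Γ →* ℂˣ) (τ : MonoidAlgebra ℂ Γ) :
    SMulCommClass (MonoidAlgebra ℂ Γ) (B ε τ)ᵐᵒᵖ (B ε τ) where
  smul_comm a c b := (mul_assoc (B.ofGroupAlgebra ε τ a) b c.unop).symm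

/-- The symmetrizing idempotent `e = (1 / |Γ|) ∑_g g` of `B^τ`. -/
def symIdem (ε : Γ →* ℂˣ) (τ : MonoidAlgebra ℂ Γ) : B ε τ :=
  ((Nat.card Γ : ℂ)⁻¹) • ∑ᶠ g : Γ, B.grp ε τ g

lemma symIdem_isIdempotent (ε : Γ →* ℂˣ) (τ : MonoidAlgebra ℂ Γ) : IsIdempotentElem (symIdem ε τ) := by
  classical
  let _ := Fintype.ofFinite Γ
  have h : ∀ g : Γ, B.grp ε τ g * ∑ h : Γ, B.grp ε τ h = ∑ h : Γ, B.grp ε τ h := by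
    intro g
    rw [Finset.mul_sum]
    simp_rw [← map_mul]
    exact Fintype.sum_equiv (Equiv.mulLeft g) _ _ fun _ => rfl
  have hc : (Nat.card Γ : ℂ) ≠ 0 := Nat.cast_ne_zero.2 Nat.card_pos.ne'
  unfold IsIdempotentElem symIdem
  rw [finsum_eq_sum_of_fintype, smul_mul_smul_comm, Finset.sum_mul]
  simp_rw [h]
  rw [Finset.sum_const, Finset.card_univ, ← Nat.card_eq_fintype_card, ← Nat.cast_smul_eq_nsmul ℂ,
    smul_smul, mul_assoc, inv_mul_cancel₀ hc, mul_one]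

/-- The algebra `O^τ = e B^τ e`, with unit `e`. -/
abbrev O (ε : Γ →* ℂˣ) (τ : MonoidAlgebra ℂ Γ) : Type u := (symIdem_isIdempotent ε τ).Corner

/-- The left ideal `B^τ e`. -/
abbrev Be (ε : Γ →* ℂˣ) (τ : MonoidAlgebra ℂ Γ) : Submodule (B ε τ) (B ε τ) :=
  Submodule.span (B ε τ) {symIdem ε τ}

lemma mul_mem_Be (ε : Γ →* ℂˣ) (τ : MonoidAlgebra ℂ Γ) (b : B ε τ) (o : O ε τ) :
    b * o.1 ∈ Be ε τ :=
  Submodule.mem_span_singleton.2 ⟨b * o.1, by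
    rw [smul_eq_mul, mul_assoc, ((Subsemigroup.mem_corner_iff (symIdem_isIdempotent ε τ)).1 o.2).2]⟩

lemma Be_mul_symIdem (ε : Γ →* ℂˣ) (τ : MonoidAlgebra ℂ Γ) (b : Be ε τ) :
    b.1 * symIdem ε τ = b.1 := by
  obtain ⟨a, ha⟩ := Submodule.mem_span_singleton.1 b.2
  rw [← ha, smul_eq_mul, mul_assoc, (symIdem_isIdempotent ε τ).eq]

/-- The right `O^τ`-module structure on `B^τ e`, by multiplication in `B^τ`. -/
instance (ε : Γ →* ℂˣ) (τ : MonoidAlgebra ℂ Γ) : Module (O ε τ)ᵐᵒᵖ (Be ε τ) where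
  smul o b := ⟨b.1 * o.unop.1, mul_mem_Be ε τ b.1 o.unop⟩
  one_smul b := Subtype.ext (Be_mul_symIdem ε τ b)
  mul_smul o p b := Subtype.ext (mul_assoc b.1 p.unop.1 o.unop.1).symm
  smul_zero o := Subtype.ext (zero_mul o.unop.1)
  smul_add o b c := Subtype.ext (add_mul b.1 c.1 o.unop.1)
  add_smul o p b := Subtype.ext (mul_add b.1 o.unop.1 p.unop.1)
  zero_smul b := Subtype.ext (mul_zero b.1)

instance (ε : Γ →* ℂˣ) (τ : MonoidAlgebra ℂ Γ) :
    SMulCommClass (B ε τ) (O ε τ)ᵐᵒᵖ (Be ε τ) where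
  smul_comm a o b := Subtype.ext (mul_assoc a b.1 o.unop.1).symm

/-! ### Generic parameters -/

/-- The roots of the affine root system of type `Ã_{m-1}`, whose Dynkin diagram is the cycle on
`ℤ/m` (one vertex with a loop if `m = 1`, two vertices with a double edge if `m = 2`): the nonzero
integral vectors at which the Tits form `q(α) = ∑ α_i² - ∑ α_i α_{i+1}` is at most `1`. The real
roots are those with `q(α) = 1`, the imaginary ones (nonzero multiples of `(1, …, 1)`) those with
`q(α) = 0`. -/
def IsRoot {m : ℕ} [NeZero m] (α : ZMod m → ℤ) : Prop :=
  α ≠ 0 ∧ ∑ i, α i ^ 2 - ∑ i, α i * α (i + 1) ≤ 1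

/-- The trace of `τ` on the irreducible module with character `ε ^ i`. -/
def traceOn (ε : Γ →* ℂˣ) (τ : MonoidAlgebra ℂ Γ) (i : ZMod (Nat.card Γ)) : ℂ :=
  τ.coeff.sum fun g c => c * ((ε g : ℂ) ^ i.val)

/-- `τ ∈ ℂΓ`, regarded as a linear form on the span of the simple roots through its traces on the
irreducible `Γ`-modules, lies on no root hyperplane. -/
def IsGeneric (ε : Γ →* ℂˣ) (τ : MonoidAlgebra ℂ Γ) : Prop :=
  ∀ α : ZMod (Nat.card Γ) → ℤ, IsRoot α → ∑ i, (α i : ℂ) * traceOn ε τ i ≠ 0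

end KleinianQuant

end

universe v

open scoped TensorProduct

noncomputable section

namespace KleinianQuant

/-! Let `e_i` be the primitive idempotents of `ℂΓ`, so that `e = e_0`. Sending `y` to `t x⁻¹`
represents `B^τ` on the skew Laurent ring over `ℂ[t]^m` whose automorphism `σ` is a cyclic shift
combined with translations by the `λ_i`. Comparing `t`-degrees in this model shows that the `e_j
y^k` form a basis of `B^τ` as a right `ℂ[x]`-module (`basis`), so the filtration by `y`-degree
behaves as for a twisted polynomial ring.

Surjectivity of the first map follows a filtered-ring argument in the style of Quillen. For a right
submodule `M` of a free module, the leading coefficients of its truncations stabilize. Two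
consecutive truncations, with homogeneous `ℂ[x]`-bases, then give a resolution of length one by sums
of the `e_i B` (`exists_resolution`). If `M` is projective the resolution splits, so the classes
`[e_i B]` generate `K_0(B^τ)` (`K0_eq_closure`).

Genericity gives `B e_0 B = B` (`exists_sum_eq_one`): a proper ideal would yield a common zero of
certain polynomials in `yx`, and following that zero around the cycle in both directions makes the
sum of the `λ_s` over an interval vanish. Hence `B^τ e` is finitely generated and projective over
`O^τ`. Surjectivity of the second map holds because an idempotent matrix over `O^τ` is also one over
`B^τ` (`K0.tensor_Be_surjective`).

For injectivity it is enough to treat the composite, since the first map is onto. An element `∑ n_i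
[e_i]` of `K_0(Γ)` is sent to `∑ n_i [e_i B e]`, and two invariants detect it. Products across a
common idempotent have no zero divisors, so `O^τ` is a domain and each `e_i B e` has rank one; the
rank is therefore `∑ n_i`, which is also the dimension (`rank_tensor_tensor`). The constant term of
the Laurent normal form, modulo the elements `σ(td) - td`, is a trace on `B^τ`; its
Hattori–Stallings extension to `K_0` gives `∑ n_i trace(e_i)`, and this vanishes only if `n` is a
multiple of `λ` (`exists_eq_mul_lam`). As `∑ λ_i ≠ 0`, the condition `∑ n_i = 0` then forces `n = 0`
(`tensor_tensor_injective`). -/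

instance projective_pi {R ι : Type*} [Ring R] [Finite ι] (X : ι → Type*)
    [∀ i, AddCommGroup (X i)] [∀ i, Module R (X i)] [∀ i, Module.Projective R (X i)] :
    Module.Projective R (∀ i, X i) := by
  classical
  have := Fintype.ofFinite ι
  exact Module.Projective.of_equiv (DFinsupp.linearEquivFunOnFintype (R := R) (M := X))

/-! ### Generalities on `K0` -/

section K0

variable {A : Type u} [Ring A]

section

variable {P Q R : Type u} [AddCommGroup P] [Module Aᵐᵒᵖ P] [Module.Finite Aᵐᵒᵖ P]
  [Module.Projective Aᵐᵒᵖ P] [AddCommGroup Q] [Module Aᵐᵒᵖ Q] [Module.Finite Aᵐᵒᵖ Q]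
  [Module.Projective Aᵐᵒᵖ Q] [AddCommGroup R] [Module Aᵐᵒᵖ R] [Module.Finite Aᵐᵒᵖ R]
  [Module.Projective Aᵐᵒᵖ R]

lemma K0.of_eq_add (f : P ≃ₗ[Aᵐᵒᵖ] (Q × R)) : (K0.of P : K0 A) = K0.of Q + K0.of R := by
  refine (QuotientAddGroup.eq_iff_sub_mem).2 ?_
  exact AddSubgroup.subset_closure ⟨FGProj.mk P, FGProj.mk Q, FGProj.mk R, ⟨f⟩, rfl⟩

lemma K0.of_punit : (K0.of PUnit : K0 A) = 0 := by
  have e : PUnit.{u + 1} ≃ₗ[Aᵐᵒᵖ] (PUnit.{u + 1} × PUnit.{u + 1}) :=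
    { toFun := fun _ => 0
      invFun := fun _ => 0
      map_add' := fun _ _ => rfl
      map_smul' := fun _ _ => rfl
      left_inv := fun _ => rfl
      right_inv := fun _ => rfl }
  simpa using K0.of_eq_add e

lemma K0.of_subsingleton [Subsingleton P] : (K0.of P : K0 A) = 0 := by
  have e : P ≃ₗ[Aᵐᵒᵖ] (P × P) :=
    { toFun := fun _ => 0
      invFun := fun _ => 0
      map_add' := fun _ _ => Subsingleton.elim _ _
      map_smul' := fun _ _ => Subsingleton.elim _ _
      left_inv := fun _ => Subsingleton.elim _ _
      right_inv := fun _ => Subsingleton.elim _ _ }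
  simpa using K0.of_eq_add e

lemma K0.of_congr (f : P ≃ₗ[Aᵐᵒᵖ] Q) : (K0.of P : K0 A) = K0.of Q := by
  have e : Q ≃ₗ[Aᵐᵒᵖ] (Q × PUnit.{u + 1}) :=
    { toFun := fun q => (q, 0)
      invFun := fun q => q.1
      map_add' := fun _ _ => rfl
      map_smul' := fun _ _ => rfl
      left_inv := fun _ => rfl
      right_inv := fun _ => rfl }
  simpa [K0.of_punit] using K0.of_eq_add (f.trans e)

end

lemma K0.of_pi {n : ℕ} (X : Fin n → Type u) [∀ i, AddCommGroup (X i)] [∀ i, Module Aᵐᵒᵖ (X i)]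
    [∀ i, Module.Finite Aᵐᵒᵖ (X i)] [∀ i, Module.Projective Aᵐᵒᵖ (X i)] :
    (K0.of (∀ i, X i) : K0 A) = ∑ i, K0.of (X i) := by
  induction n with
  | zero => simpa using K0.of_subsingleton
  | succ n ih =>
    have e := Fin.consLinearEquiv Aᵐᵒᵖ X
    rw [Fin.sum_univ_succ, ← ih, K0.of_eq_add e.symm]

lemma K0.hom_ext {G : Type*} [AddCommGroup G] {f g : K0 A →+ G}
    (h : ∀ P : FGProj A, f (K0.of P.carrier) = g (K0.of P.carrier)) : f = g :=
  QuotientAddGroup.addMonoidHom_ext _ (FreeAbelianGroup.lift_ext _ _ h)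

/-- An additive invariant of finitely generated projective modules, as a homomorphism on `K0`. -/
def K0.lift {G : Type*} [AddCommGroup G] (F : FGProj A → G)
    (hF : ∀ P Q R : FGProj A, Nonempty (P.carrier ≃ₗ[Aᵐᵒᵖ] (Q.carrier × R.carrier)) →
      F P = F Q + F R) : K0 A →+ G :=
  QuotientAddGroup.lift (K0Rel A) (FreeAbelianGroup.lift F) <| by
    refine (AddSubgroup.closure_le _).2 ?_
    rintro z ⟨P, Q, R, h, rfl⟩
    simp [hF P Q R h]

lemma K0.lift_of {G : Type*} [AddCommGroup G] (F : FGProj A → G)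
    (hF : ∀ P Q R : FGProj A, Nonempty (P.carrier ≃ₗ[Aᵐᵒᵖ] (Q.carrier × R.carrier)) →
      F P = F Q + F R) (P : Type u) [AddCommGroup P] [Module Aᵐᵒᵖ P]
    [Module.Finite Aᵐᵒᵖ P] [Module.Projective Aᵐᵒᵖ P] :
    K0.lift F hF (K0.of P) = F (FGProj.mk P) :=
  FreeAbelianGroup.lift_apply_of _ _

lemma K0.mem_of_forall (S : AddSubgroup (K0 A)) (h : ∀ P : FGProj A, K0.of P.carrier ∈ S)
    (ξ : K0 A) : ξ ∈ S := by
  have : QuotientAddGroup.mk' S = 0 := K0.hom_ext fun P => by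
    simpa using (QuotientAddGroup.eq_zero_iff _).2 (h P)
  exact (QuotientAddGroup.eq_zero_iff ξ).1 (DFunLike.congr_fun this ξ)

end K0

/-! ### Dual bases and Hattori–Stallings traces -/

section DualBasis

variable {A : Type u} [Ring A] {P Q : Type*} [AddCommGroup P] [Module Aᵐᵒᵖ P]
  [AddCommGroup Q] [Module Aᵐᵒᵖ Q]

/-- A finite dual basis of a right module. -/
def IsDualBasis {ι : Type*} [Fintype ι] (p : ι → P) (f : ι → P →ₗ[Aᵐᵒᵖ] A) : Prop :=
  ∀ m, ∑ i, MulOpposite.op (f i m) • p i = m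

variable (A P) in
-- `P` is a retract of a free module: the `p i` are the images of the standard basis, the `f i` the
-- coordinates of the section.
lemma exists_isDualBasis [Module.Finite Aᵐᵒᵖ P] [Module.Projective Aᵐᵒᵖ P] :
    ∃ (n : ℕ) (p : Fin n → P) (f : Fin n → P →ₗ[Aᵐᵒᵖ] A), IsDualBasis p f := by
  obtain ⟨n, f, g, -, -, h⟩ := Module.Finite.exists_comp_eq_id_of_projective Aᵐᵒᵖ P
  let o : Aᵐᵒᵖ →ₗ[Aᵐᵒᵖ] A :=
    { toFun := MulOpposite.unop, map_add' := fun _ _ => rfl, map_smul' := fun _ _ => rfl }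
  refine ⟨n, fun i => f (Pi.single i 1), fun i => o ∘ₗ LinearMap.proj i ∘ₗ g, fun m => ?_⟩
  have := LinearMap.congr_fun h m
  simp only [LinearMap.comp_apply, LinearMap.id_apply] at this
  conv_rhs => rw [← this, ← Finset.univ_sum_single (g m), map_sum]
  refine Finset.sum_congr rfl fun i _ => ?_
  rw [← map_smul]
  congr 1
  ext j
  by_cases hj : j = i
  · subst hj; simp [o]
  · simp [o, hj]

lemma IsDualBasis.finite {ι : Type*} [Fintype ι] {p : ι → P} {f : ι → P →ₗ[Aᵐᵒᵖ] A}
    (h : IsDualBasis p f) : Module.Finite Aᵐᵒᵖ P := by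
  classical
  refine ⟨⟨Finset.univ.image p, ?_⟩⟩
  refine eq_top_iff.2 fun m _ => ?_
  rw [← h m]
  exact Submodule.sum_mem _ fun i _ => Submodule.smul_mem _ _ (Submodule.subset_span (by simp))

lemma IsDualBasis.projective {ι : Type*} [Fintype ι] {p : ι → P} {f : ι → P →ₗ[Aᵐᵒᵖ] A}
    (h : IsDualBasis p f) : Module.Projective Aᵐᵒᵖ P := by
  let o : A →ₗ[Aᵐᵒᵖ] Aᵐᵒᵖ :=
    { toFun := MulOpposite.op, map_add' := fun _ _ => rfl, map_smul' := fun _ _ => rfl }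
  refine Module.Projective.of_split (M := ι → Aᵐᵒᵖ) (LinearMap.pi fun i => o ∘ₗ f i)
    (Fintype.linearCombination Aᵐᵒᵖ p) ?_
  ext m
  simpa [Fintype.linearCombination_apply, o] using h m

variable {T : Type*} [AddCommGroup T]

/-- Expanding each basis in the other turns both sides into the sum of `t (f i (q k) * g k (p i))`,
up to the order of the factors, which `t` ignores. -/
lemma IsDualBasis.trace_eq {t : A →+ T} (ht : ∀ a b, t (a * b) = t (b * a))
    {ι κ : Type*} [Fintype ι] [Fintype κ] {p : ι → P} {f : ι → P →ₗ[Aᵐᵒᵖ] A}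
    (h : IsDualBasis p f) {q : κ → P} {g : κ → P →ₗ[Aᵐᵒᵖ] A} (h' : IsDualBasis q g) :
    ∑ i, t (f i (p i)) = ∑ k, t (g k (q k)) := by
  have h1 : ∀ i, t (f i (p i)) = ∑ k, t (f i (q k) * g k (p i)) := fun i => by
    conv_lhs => rw [← h' (p i), map_sum, map_sum]
    simp
  have h2 : ∀ k, t (g k (q k)) = ∑ i, t (f i (q k) * g k (p i)) := fun k => by
    conv_lhs => rw [← h (q k), map_sum, map_sum]
    simp [ht (g k _)]
  simp_rw [h1, h2]
  exact Finset.sum_comm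

/-- The Hattori–Stallings trace of (the identity of) a finitely generated projective module, with
respect to a trace `t` on the ring. -/
def hsRank (t : A →+ T) (P : FGProj A) : T :=
  let h := exists_isDualBasis A P.carrier
  ∑ i, t (h.choose_spec.choose_spec.choose i (h.choose_spec.choose i))

lemma hsRank_eq {t : A →+ T} (ht : ∀ a b, t (a * b) = t (b * a)) (P : FGProj A)
    {ι : Type*} [Fintype ι] {p : ι → P.carrier} {f : ι → P.carrier →ₗ[Aᵐᵒᵖ] A}
    (h : IsDualBasis p f) : hsRank t P = ∑ i, t (f i (p i)) :=
  IsDualBasis.trace_eq ht (exists_isDualBasis A P.carrier).choose_spec.choose_spec.choose_spec h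

/-- The Hattori–Stallings trace on `K0`. -/
def K0.trace (t : A →+ T) (ht : ∀ a b, t (a * b) = t (b * a)) : K0 A →+ T :=
  K0.lift (hsRank t) <| by
    rintro P Q R ⟨e⟩
    obtain ⟨n, q, g, hq⟩ := exists_isDualBasis A Q.carrier
    obtain ⟨m, r, k, hr⟩ := exists_isDualBasis A R.carrier
    have h : IsDualBasis (P := P.carrier)
        (Sum.elim (fun i => e.symm (q i, 0)) fun i => e.symm (0, r i))
        (Sum.elim (fun i => g i ∘ₗ LinearMap.fst _ _ _ ∘ₗ e.toLinearMap)
          fun i => k i ∘ₗ LinearMap.snd _ _ _ ∘ₗ e.toLinearMap) := by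
      intro m
      apply e.injective
      rw [Fintype.sum_sum_type, map_add, map_sum, map_sum]
      simp only [Sum.elim_inl, Sum.elim_inr, map_smul, LinearEquiv.apply_symm_apply,
        LinearMap.comp_apply, LinearMap.fst_apply, LinearMap.snd_apply, LinearEquiv.coe_coe]
      ext
      · simpa [Prod.fst_sum] using hq (e m).1
      · simpa [Prod.snd_sum] using hr (e m).2
    rw [hsRank_eq ht P h, hsRank_eq ht Q hq, hsRank_eq ht R hr, Fintype.sum_sum_type]
    simp

lemma K0.trace_of {t : A →+ T} (ht : ∀ a b, t (a * b) = t (b * a))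
    {P : Type u} [AddCommGroup P] [Module Aᵐᵒᵖ P] [Module.Finite Aᵐᵒᵖ P] [Module.Projective Aᵐᵒᵖ P]
    {ι : Type*} [Fintype ι] {p : ι → P} {f : ι → P →ₗ[Aᵐᵒᵖ] A} (h : IsDualBasis p f) :
    K0.trace t ht (K0.of P) = ∑ i, t (f i (p i)) :=
  (K0.lift_of _ _ P).trans (hsRank_eq ht (FGProj.mk P) h)

end DualBasis

/-! ### Functoriality of the balanced tensor product -/

namespace BalancedTensor

variable {A C : Type u} [Ring A] [Ring C] {M M' M'' N : Type u}
  [AddCommGroup M] [Module Aᵐᵒᵖ M] [AddCommGroup M'] [Module Aᵐᵒᵖ M'] [AddCommGroup M'']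
  [Module Aᵐᵒᵖ M''] [AddCommGroup N] [Module A N] [Module Cᵐᵒᵖ N] [SMulCommClass A Cᵐᵒᵖ N]

variable (A C M N) in
/-- The submodule of relations defining the balanced tensor product. -/
abbrev rel : Submodule Cᵐᵒᵖ (N ⊗[ℤ] M) :=
  Submodule.span Cᵐᵒᵖ
    {z : N ⊗[ℤ] M | ∃ (m : M) (a : A) (n : N),
      z = n ⊗ₜ[ℤ] (MulOpposite.op a • m) - (a • n) ⊗ₜ[ℤ] m}

variable (A C) in
/-- The pure tensor `m ⊗ n`. -/
def tmul (m : M) (n : N) : BalancedTensor A C M N := (rel A C M N).mkQ (n ⊗ₜ[ℤ] m)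

lemma tmul_smul_left (m : M) (a : A) (n : N) :
    tmul A C (MulOpposite.op a • m) n = tmul A C m (a • n) :=
  (Submodule.Quotient.eq _).2 (Submodule.subset_span ⟨m, a, n, rfl⟩)

lemma tmul_add (m : M) (n n' : N) : tmul A C m (n + n') = tmul A C m n + tmul A C m n' := by
  simp [tmul, TensorProduct.add_tmul]

lemma add_tmul (m m' : M) (n : N) : tmul A C (m + m') n = tmul A C m n + tmul A C m' n := by
  simp [tmul, TensorProduct.tmul_add]

lemma tmul_smul_right (m : M) (c : Cᵐᵒᵖ) (n : N) : tmul A C m (c • n) = c • tmul A C m n := rfl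

variable (C N) in
/-- The pure tensors with fixed right factor, as an additive map. -/
def tmulHom (n : N) : M →+ BalancedTensor A C M N :=
  AddMonoidHom.mk' (fun m => tmul A C m n) fun m m' => add_tmul m m' n

variable (A N) in
/-- The pure tensors with fixed left factor, as a linear map. -/
def tmulLin (m : M) : N →ₗ[Cᵐᵒᵖ] BalancedTensor A C M N where
  toFun n := tmul A C m n
  map_add' := tmul_add m
  map_smul' c n := tmul_smul_right m c n

lemma sum_tmul {ι : Type*} (s : Finset ι) (m : ι → M) (n : N) :
    tmul A C (∑ i ∈ s, m i) n = ∑ i ∈ s, tmul A C (m i) n :=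
  map_sum (tmulHom C N n) m s

variable {X : Type*} [AddCommGroup X] [Module Cᵐᵒᵖ X]

lemma hom_ext {f g : BalancedTensor A C M N →ₗ[Cᵐᵒᵖ] X}
    (h : ∀ m n, f (tmul A C m n) = g (tmul A C m n)) : f = g := by
  refine Submodule.linearMap_qext _ (LinearMap.ext fun z => ?_)
  induction z using TensorProduct.induction_on with
  | zero => simp
  | tmul n m => exact h m n
  | add a b ha hb => rw [map_add, map_add, ha, hb]

/-- The universal property of the balanced tensor product. -/
def lift (g : M →+ (N →ₗ[Cᵐᵒᵖ] X)) (hg : ∀ m (a : A) n, g (MulOpposite.op a • m) n = g m (a • n)) :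
    BalancedTensor A C M N →ₗ[Cᵐᵒᵖ] X :=
  (rel A C M N).liftQ
    (TensorProduct.AlgebraTensorModule.lift (R := ℤ) (A := Cᵐᵒᵖ)
      { toFun := fun n =>
          { toFun := fun m => g m n
            map_add' := fun m m' => by rw [map_add]; rfl
            map_smul' := fun c m => by rw [map_zsmul]; rfl }
        map_add' := fun n n' => by ext m; simp
        map_smul' := fun c n => by ext m; simp }) <| by
    rw [Submodule.span_le]
    rintro z ⟨m, a, n, rfl⟩
    simp [hg]

variable (C N) in
/-- Functoriality of the balanced tensor product. -/
def map (f : M →ₗ[Aᵐᵒᵖ] M') : BalancedTensor A C M N →ₗ[Cᵐᵒᵖ] BalancedTensor A C M' N :=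
  lift (AddMonoidHom.mk' (fun m => tmulLin A N (f m)) fun m m' => by
    ext n; simp [tmulLin, add_tmul]) fun m a n => by
      simp [tmulLin, tmul_smul_left]

@[simp] lemma map_tmul (f : M →ₗ[Aᵐᵒᵖ] M') (m : M) (n : N) :
    map C N f (tmul A C m n) = tmul A C (f m) n := rfl

variable (C N) in
/-- The balanced tensor product is additive. -/
def prodEquiv (e : M ≃ₗ[Aᵐᵒᵖ] (M' × M'')) :
    BalancedTensor A C M N ≃ₗ[Cᵐᵒᵖ] (BalancedTensor A C M' N × BalancedTensor A C M'' N) :=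
  LinearEquiv.ofLinearMap
    ((map C N (LinearMap.fst _ _ _ ∘ₗ e.toLinearMap)).prod
      (map C N (LinearMap.snd _ _ _ ∘ₗ e.toLinearMap)))
    ((map C N (e.symm.toLinearMap ∘ₗ LinearMap.inl _ _ _)).coprod
      (map C N (e.symm.toLinearMap ∘ₗ LinearMap.inr _ _ _)))
    (by
      refine LinearMap.prod_ext ?_ ?_ <;> refine hom_ext fun m n => ?_ <;>
      ext <;> simp <;> exact (tmulHom C N n).map_zero)
    (by
      refine hom_ext fun m n => ?_
      simp only [LinearMap.comp_apply, LinearMap.prod_apply, Function.prod, LinearMap.coprod_apply,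
        map_tmul, LinearMap.id_apply, ← add_tmul]
      congr 1
      simp [← map_add])

end BalancedTensor

/-! ### Balanced tensor products as fixed vectors of an idempotent matrix -/

section Fixed

variable {A C : Type u} [Ring A] [Ring C] {M N : Type u}
  [AddCommGroup M] [Module Aᵐᵒᵖ M] [AddCommGroup N] [Module A N] [Module Cᵐᵒᵖ N]
  [SMulCommClass A Cᵐᵒᵖ N] {ι : Type*} [Fintype ι]

variable (C N) in
/-- The column vectors with entries in a bimodule that are fixed by a given matrix. -/
def fixedBy (E : ι → ι → A) : Submodule Cᵐᵒᵖ (ι → N) where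
  carrier := {v | ∀ i, ∑ k, E i k • v k = v i}
  add_mem' hv hw i := by simp [smul_add, Finset.sum_add_distrib, hv i, hw i]
  zero_mem' := by simp
  smul_mem' c v hv i := by
    simp only [Pi.smul_apply, smul_comm _ c, ← Finset.smul_sum, hv i]

variable {p : ι → M} {f : ι → M →ₗ[Aᵐᵒᵖ] A}

/-- For `m = p l` this is the idempotency of the matrix `f i (p k)`. -/
lemma IsDualBasis.sum_mul (h : IsDualBasis p f) (i : ι) (m : M) :
    ∑ k, f i (p k) * f k m = f i m := by
  conv_rhs => rw [← h m, map_sum]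
  simp

variable (C N) in
/-- Multiplication by the matrix of a dual basis, as a projection onto the fixed vectors. -/
def fixedByProj (h : IsDualBasis p f) :
    (ι → N) →ₗ[Cᵐᵒᵖ] fixedBy C N (fun i k => f i (p k)) where
  toFun v := ⟨fun i => ∑ k, f i (p k) • v k, fun i => by
    simp only [Finset.smul_sum, smul_smul]
    rw [Finset.sum_comm]
    simp only [← Finset.sum_smul, h.sum_mul]⟩
  map_add' v w := by ext i; simp [Finset.sum_add_distrib]
  map_smul' c v := by ext i; simp [smul_comm _ c, Finset.smul_sum]

lemma fixedByProj_coe (h : IsDualBasis p f) (v : fixedBy C N (fun i k => f i (p k))) :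
    fixedByProj C N h v = v := Subtype.ext (funext v.2)

lemma fixedBy_finite (h : IsDualBasis p f) [Module.Finite Cᵐᵒᵖ N] :
    Module.Finite Cᵐᵒᵖ (fixedBy C N (fun i k => f i (p k))) :=
  Module.Finite.of_surjective (fixedByProj C N h) fun v => ⟨v, fixedByProj_coe h v⟩

lemma fixedBy_projective (h : IsDualBasis p f) [Module.Projective Cᵐᵒᵖ N] :
    Module.Projective Cᵐᵒᵖ (fixedBy C N (fun i k => f i (p k))) :=
  Module.Projective.of_split (Submodule.subtype _) (fixedByProj C N h)
    (LinearMap.ext fun v => fixedByProj_coe h v)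

variable (C N) in
/-- The vector with entries `f_i(m) n`, for a dual basis `p_i, f_i`. -/
def coordinates (h : IsDualBasis p f) (m : M) :
    N →ₗ[Cᵐᵒᵖ] fixedBy C N (fun i k => f i (p k)) where
  toFun n := ⟨fun i => f i m • n, fun i => by
    simp only [smul_smul]
    rw [← Finset.sum_smul, h.sum_mul]⟩
  map_add' n n' := by ext i; simp
  map_smul' c n := by ext i; simp [smul_comm _ c]

variable (C N) in
/-- The balanced tensor product with a finitely generated projective module, described through
a dual basis. -/
def tensorEquivFixedBy (h : IsDualBasis p f) :
    BalancedTensor A C M N ≃ₗ[Cᵐᵒᵖ] fixedBy C N (fun i k => f i (p k)) :=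
  LinearEquiv.ofLinearMap
    (BalancedTensor.lift
      (AddMonoidHom.mk' (coordinates C N h) fun m m' => by
        ext n i; simp [coordinates, add_smul])
      fun m a n => by ext i; simp [coordinates, smul_smul])
    -- The inverse sends `v` to the sum of the `p i ⊗ v i`.
    ((∑ i, BalancedTensor.tmulLin A N (p i) ∘ₗ LinearMap.proj i) ∘ₗ Submodule.subtype _)
    (by
      refine LinearMap.ext fun v => Subtype.ext (funext fun i => ?_)
      simp only [LinearMap.comp_apply, Submodule.subtype_apply, LinearMap.sum_apply, map_sum,
        LinearMap.proj_apply, LinearMap.id_apply]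
      rw [← v.2 i, AddSubmonoidClass.coe_finsetSum, Finset.sum_apply]
      rfl)
    (by
      refine BalancedTensor.hom_ext fun m n => ?_
      simp only [LinearMap.comp_apply, Submodule.subtype_apply, LinearMap.sum_apply,
        LinearMap.proj_apply, LinearMap.id_apply]
      conv_rhs => rw [← h m, BalancedTensor.sum_tmul]
      simp only [BalancedTensor.tmul_smul_left]
      rfl)

end Fixed

/-! ### The map on `K_0` induced by a bimodule -/

section Functor

variable (A C : Type u) [Ring A] [Ring C] (N : Type u) [AddCommGroup N] [Module A N]
  [Module Cᵐᵒᵖ N] [SMulCommClass A Cᵐᵒᵖ N] [Module.Finite Cᵐᵒᵖ N] [Module.Projective Cᵐᵒᵖ N]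
  (P : Type u) [AddCommGroup P] [Module Aᵐᵒᵖ P] [Module.Finite Aᵐᵒᵖ P] [Module.Projective Aᵐᵒᵖ P]

instance BalancedTensor.finite : Module.Finite Cᵐᵒᵖ (BalancedTensor A C P N) := by
  obtain ⟨n, p, f, h⟩ := exists_isDualBasis A P
  have := fixedBy_finite (C := C) (N := N) h
  exact Module.Finite.equiv (tensorEquivFixedBy C N h).symm

instance BalancedTensor.projective : Module.Projective Cᵐᵒᵖ (BalancedTensor A C P N) := by
  obtain ⟨n, p, f, h⟩ := exists_isDualBasis A P
  have := fixedBy_projective (C := C) (N := N) h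
  exact Module.Projective.of_equiv (tensorEquivFixedBy C N h).symm

/-- The homomorphism on `K0` induced by tensoring with a bimodule that is finitely generated and
projective on the right. -/
def K0.tensor : K0 A →+ K0 C :=
  K0.lift (fun P => K0.of (BalancedTensor A C P.carrier N)) fun _ _ _ ⟨e⟩ =>
    K0.of_eq_add (BalancedTensor.prodEquiv C N e)

lemma K0.tensor_of : K0.tensor A C N (K0.of P) = K0.of (BalancedTensor A C P N) :=
  K0.lift_of _ _ P

lemma K0.hasClass_tensor :
    HasClass (BalancedTensor A C P N) (K0.tensor A C N (K0.of P)) :=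
  ⟨inferInstance, inferInstance, K0.tensor_of A C N P⟩

end Functor

open Polynomial

/-! ### The model: a skew Laurent ring over `ℂ[t]^m` -/

section Model

variable {m : ℕ} (lam : ZMod m → ℂ)

/-- The twisted cyclic shift of `ℂ[t]^m`. -/
def shift : (ZMod m → ℂ[X]) ≃ₐ[ℂ] (ZMod m → ℂ[X]) :=
  AlgEquiv.ofAlgHom
    (AlgHom.pi fun i => (taylorAlgHom (lam i)).comp (Pi.evalAlgHom ℂ _ (i - 1)))
    (AlgHom.pi fun i => (taylorAlgHom (-lam (i + 1))).comp (Pi.evalAlgHom ℂ _ (i + 1)))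
    (by
      refine AlgHom.ext fun p => funext fun i => ?_
      simp [taylor_taylor])
    (by
      refine AlgHom.ext fun p => funext fun i => ?_
      simp [taylor_taylor])

lemma shift_apply (p : ZMod m → ℂ[X]) (i : ZMod m) :
    shift lam p i = taylor (lam i) (p (i - 1)) := rfl

/-- The diagonal variable of `ℂ[t]^m`. -/
def diagX : ZMod m → ℂ[X] := fun _ => X

/-- Left multiplication by `x`. -/
def opX : Module.End ℂ (ℤ → ZMod m → ℂ[X]) where
  toFun f n := shift lam (f (n - 1))
  map_add' f g := by ext1 n; simp
  map_smul' c f := by ext1 n; simp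

/-- Left multiplication by `y`. -/
def opY : Module.End ℂ (ℤ → ZMod m → ℂ[X]) where
  toFun f n := diagX * (shift lam).symm (f (n + 1))
  map_add' f g := by ext1 n; simp [mul_add]
  map_smul' c f := by ext1 n; simp

/-- Left multiplication by an element of `ℂ[t]^m`. -/
def opD (d : ZMod m → ℂ[X]) : Module.End ℂ (ℤ → ZMod m → ℂ[X]) where
  toFun f n := d * f n
  map_add' f g := by ext1 n; simp [mul_add]
  map_smul' c f := by ext1 n; simp

/-- Right multiplication by `x`. -/
def ropX : Module.End ℂ (ℤ → ZMod m → ℂ[X]) where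
  toFun f n := f (n - 1)
  map_add' _ _ := rfl
  map_smul' _ _ := rfl

/-- Right multiplication by `y`. -/
def ropY : Module.End ℂ (ℤ → ZMod m → ℂ[X]) where
  toFun f n := f (n + 1) * (shift lam ^ (n + 1)) diagX
  map_add' f g := by ext1 n; simp [add_mul]
  map_smul' c f := by ext1 n; simp

/-- Right multiplication by an element of `ℂ[t]^m`. -/
def ropD (d : ZMod m → ℂ[X]) : Module.End ℂ (ℤ → ZMod m → ℂ[X]) where
  toFun f n := f n * (shift lam ^ n) d
  map_add' f g := by ext1 n; simp [add_mul]
  map_smul' c f := by ext1 n; simp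

lemma shift_zpow_succ (n : ℤ) (d : ZMod m → ℂ[X]) :
    (shift lam ^ (n + 1)) d = shift lam ((shift lam ^ n) d) := by
  rw [add_comm, zpow_add, zpow_one]; rfl

lemma shift_symm_zpow (n : ℤ) (d : ZMod m → ℂ[X]) :
    (shift lam).symm ((shift lam ^ (n + 1)) d) = (shift lam ^ n) d := by
  rw [shift_zpow_succ, AlgEquiv.symm_apply_apply]

/-- This and the following relations express associativity of the skew Laurent ring. They give
access to right multiplication in `B`, although `rho` only encodes left multiplication. -/
lemma commute_opX_ropX : Commute (opX lam) ropX := rfl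

lemma commute_opY_ropX : Commute (opY lam) ropX := by
  refine LinearMap.ext fun f => funext fun n => ?_
  change diagX * (shift lam).symm (f (n + 1 - 1)) = diagX * (shift lam).symm (f (n - 1 + 1))
  simp

lemma commute_opD_ropX (d : ZMod m → ℂ[X]) : Commute (opD d) ropX := rfl

lemma commute_opX_ropY : Commute (opX lam) (ropY lam) := by
  refine LinearMap.ext fun f => funext fun n => ?_
  change shift lam (f (n - 1 + 1) * (shift lam ^ (n - 1 + 1)) diagX) =
    shift lam (f (n + 1 - 1)) * (shift lam ^ (n + 1)) diagX
  rw [map_mul, sub_add_cancel, add_sub_cancel_right, shift_zpow_succ]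

lemma commute_opY_ropY : Commute (opY lam) (ropY lam) := by
  refine LinearMap.ext fun f => funext fun n => ?_
  change diagX * (shift lam).symm (f (n + 1 + 1) * (shift lam ^ (n + 1 + 1)) diagX) =
    diagX * (shift lam).symm (f (n + 1 + 1)) * (shift lam ^ (n + 1)) diagX
  rw [map_mul, shift_symm_zpow, mul_assoc]

lemma commute_opD_ropY (d : ZMod m → ℂ[X]) : Commute (opD d) (ropY lam) := by
  refine LinearMap.ext fun f => funext fun n => ?_
  exact (mul_assoc _ _ _).symm

lemma commute_opX_ropD (d : ZMod m → ℂ[X]) : Commute (opX lam) (ropD lam d) := by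
  refine LinearMap.ext fun f => funext fun n => ?_
  change shift lam (f (n - 1) * (shift lam ^ (n - 1)) d) =
    shift lam (f (n - 1)) * (shift lam ^ n) d
  rw [map_mul, ← shift_zpow_succ, sub_add_cancel]

lemma commute_opY_ropD (d : ZMod m → ℂ[X]) : Commute (opY lam) (ropD lam d) := by
  refine LinearMap.ext fun f => funext fun n => ?_
  change diagX * (shift lam).symm (f (n + 1) * (shift lam ^ (n + 1)) d) =
    diagX * (shift lam).symm (f (n + 1)) * (shift lam ^ n) d
  rw [map_mul, shift_symm_zpow, mul_assoc]

lemma commute_opD_ropD (d d' : ZMod m → ℂ[X]) : Commute (opD d) (ropD lam d') := by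
  refine LinearMap.ext fun f => funext fun n => ?_
  exact (mul_assoc _ _ _).symm

lemma opX_single (n : ℤ) (d : ZMod m → ℂ[X]) :
    opX lam (Pi.single n d) = Pi.single (n + 1) (shift lam d) := by
  ext1 k
  change shift lam ((Pi.single n d : ℤ → ZMod m → ℂ[X]) (k - 1)) = _
  by_cases h : k = n + 1
  · subst h; simp
  · rw [Pi.single_eq_of_ne h, Pi.single_eq_of_ne (by omega), map_zero]

lemma opY_single (n : ℤ) (d : ZMod m → ℂ[X]) :
    opY lam (Pi.single n d) = Pi.single (n - 1) (diagX * (shift lam).symm d) := by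
  ext1 k
  change diagX * (shift lam).symm ((Pi.single n d : ℤ → ZMod m → ℂ[X]) (k + 1)) = _
  by_cases h : k = n - 1
  · subst h; simp
  · rw [Pi.single_eq_of_ne h, Pi.single_eq_of_ne (by omega), map_zero, mul_zero]

lemma opD_single (n : ℤ) (d d' : ZMod m → ℂ[X]) :
    opD d (Pi.single n d') = Pi.single n (d * d') := by
  ext1 k
  change d * ((Pi.single n d' : ℤ → ZMod m → ℂ[X]) k) = _
  by_cases h : k = n
  · subst h; simp
  · rw [Pi.single_eq_of_ne h, Pi.single_eq_of_ne h, mul_zero]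

/-- The coefficient of `y ^ k` in the skew Laurent ring. -/
def ypow : ℕ → ZMod m → ℂ[X]
  | 0 => 1
  | k + 1 => diagX * (shift lam).symm (ypow k)

/-- Since `y = t x⁻¹`, the coefficient of `y ^ k` is a product of `k` translates of `t`. Distinct
powers thus have distinct `t`-degrees, which is what makes the monomials independent. -/
lemma ypow_monic (k : ℕ) (i : ZMod m) : (ypow lam k i).Monic ∧ (ypow lam k i).natDegree = k := by
  induction k generalizing i with
  | zero => simp [ypow]
  | succ k ih =>
    have h : ypow lam (k + 1) i = X * taylor (-lam (i + 1)) (ypow lam k (i + 1)) := rfl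
    have h1 : (taylor (-lam (i + 1)) (ypow lam k (i + 1))).Monic := by
      rw [Monic, leadingCoeff_taylor]; exact (ih _).1
    rw [h, natDegree_X_mul h1.ne_zero, natDegree_taylor, (ih _).2]
    exact ⟨monic_X.mul h1, rfl⟩

lemma linearIndependent_ypow (i : ZMod m) : LinearIndependent ℂ fun k => ypow lam k i := by
  let S : Polynomial.Sequence ℂ :=
    ⟨fun k => ypow lam k i, fun k => by
      rw [degree_eq_natDegree (ypow_monic lam k i).1.ne_zero, (ypow_monic lam k i).2]⟩
  exact S.linearIndependent

end Model

/-- An algebra generated by `ℂ^m = ⊕ ℂ e_i` and `x`, `y` with the commutation relations of `B^τ`,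
that acts on the skew Laurent ring over `ℂ[t]^m`. -/
class CyclicWeyl (B : Type u) [Ring B] [Algebra ℂ B] (m : outParam ℕ) [NeZero m]
    (lam : outParam (ZMod m → ℂ)) where
  e : ZMod m → B
  x : B
  y : B
  e_mul_e : ∀ i j, e i * e j = if i = j then e i else 0
  sum_e : ∑ i, e i = 1
  x_mul_e : ∀ i, x * e i = e (i + 1) * x
  y_mul_e : ∀ i, y * e (i + 1) = e i * y
  comm : x * y - y * x = ∑ i, lam i • e i
  adjoin_eq : Algebra.adjoin ℂ ({x, y} ∪ Set.range e) = ⊤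
  rho : B →ₐ[ℂ] Module.End ℂ (ℤ → ZMod m → ℂ[X])
  rho_x : rho x = opX lam
  rho_y : rho y = opY lam
  rho_e : ∀ i, rho (e i) = opD (Pi.single i 1)

namespace CyclicWeyl

variable {m : ℕ} [NeZero m] {lam : ZMod m → ℂ} {B : Type u} [Ring B] [Algebra ℂ B]
  [CyclicWeyl B m lam]

lemma e_mul_self (i : ZMod m) : (e i * e i : B) = e i := by simp [e_mul_e]

lemma e_mul_ne {i j : ZMod m} (h : i ≠ j) : (e i * e j : B) = 0 := by simp [e_mul_e, h]

/-- The elements whose left multiplication preserves `S` form a subalgebra, and it contains the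
generators. -/
lemma mem_of_closed (S : Submodule ℂ B) (h1 : 1 ∈ S) (hx : ∀ b ∈ S, x * b ∈ S)
    (hy : ∀ b ∈ S, y * b ∈ S) (he : ∀ i, ∀ b ∈ S, e i * b ∈ S) (b : B) : b ∈ S := by
  have key : ∀ a ∈ Algebra.adjoin ℂ ({x, y} ∪ Set.range e : Set B), ∀ b ∈ S, a * b ∈ S := by
    intro a ha
    induction ha using Algebra.adjoin_induction with
    | mem a ha =>
      rcases ha with (rfl | rfl) | ⟨i, rfl⟩
      exacts [hx, hy, he i]
    | algebraMap r => intro b hb; rw [← Algebra.smul_def]; exact S.smul_mem _ hb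
    | add a a' _ _ h h' => intro b hb; rw [add_mul]; exact S.add_mem (h b hb) (h' b hb)
    | mul a a' _ _ h h' => intro b hb; rw [mul_assoc]; exact h _ (h' b hb)
  simpa using key b (adjoin_eq (B := B) ▸ Algebra.mem_top) 1 h1

lemma rho_commute {r : Module.End ℂ (ℤ → ZMod m → ℂ[X])} (hx : Commute (opX lam) r)
    (hy : Commute (opY lam) r) (he : ∀ d, Commute (opD d) r) (b : B) : Commute (rho b) r := by
  have hb : b ∈ Algebra.adjoin ℂ ({x, y} ∪ Set.range e : Set B) :=
    adjoin_eq (B := B) ▸ Algebra.mem_top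
  induction hb using Algebra.adjoin_induction with
  | mem a ha =>
    rcases ha with (rfl | rfl) | ⟨i, rfl⟩
    · rwa [rho_x]
    · rwa [rho_y]
    · rw [rho_e]; exact he _
  | algebraMap c => rw [AlgHom.commutes]; exact Algebra.commute_algebraMap_left c r
  | add a a' _ _ h h' => rw [map_add]; exact h.add_left h'
  | mul a a' _ _ h h' => rw [map_mul]; exact h.mul_left h'

/-- The normal form of an element of `B` in the skew Laurent ring: its coefficients in
`ℂ[t]^m`. -/
def nf : B →ₗ[ℂ] (ℤ → ZMod m → ℂ[X]) :=
  (LinearMap.applyₗ (Pi.single 0 1)).comp (rho (B := B)).toLinearMap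

lemma nf_apply (b : B) : nf b = rho b (Pi.single 0 1) := rfl

lemma nf_mul (a b : B) : nf (a * b) = rho a (nf b) := by
  rw [nf_apply, map_mul]; rfl

lemma nf_x_mul (b : B) (n : ℤ) : nf (x * b) n = shift lam (nf b (n - 1)) := by
  rw [nf_mul, rho_x]; rfl

lemma nf_y_mul (b : B) (n : ℤ) : nf (y * b) n = diagX * (shift lam).symm (nf b (n + 1)) := by
  rw [nf_mul, rho_y]; rfl

lemma nf_e_mul (i : ZMod m) (b : B) (n : ℤ) : nf (e i * b) n = Pi.single i 1 * nf b n := by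
  rw [nf_mul, rho_e]; rfl

/-- The normal form of `x` is the right translate of `1`, and `rho b` commutes with right
multiplication. The next two lemmas use the same argument. -/
lemma nf_mul_x (b : B) (n : ℤ) : nf (b * x) n = nf b (n - 1) := by
  have h : nf (x : B) = ropX (Pi.single 0 1) := by
    rw [nf_apply, rho_x, opX_single, map_one]
    ext1 n
    change _ = (Pi.single 0 1 : ℤ → ZMod m → ℂ[X]) (n - 1)
    by_cases hn : n = 1
    · subst hn; simp
    · rw [Pi.single_eq_of_ne (by omega), Pi.single_eq_of_ne (by omega)]
  have hc := rho_commute (commute_opX_ropX lam) (commute_opY_ropX lam) commute_opD_ropX b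
  rw [nf_mul, h, ← Module.End.mul_apply, hc.eq]
  rfl

lemma nf_mul_y (b : B) (n : ℤ) :
    nf (b * y) n = nf b (n + 1) * (shift lam ^ (n + 1)) diagX := by
  have h : nf (y : B) = ropY lam (Pi.single 0 1) := by
    rw [nf_apply, rho_y, opY_single, map_one]
    ext1 n
    change _ = (Pi.single 0 1 : ℤ → ZMod m → ℂ[X]) (n + 1) * _
    by_cases hn : n = -1
    · subst hn; simp
    · rw [Pi.single_eq_of_ne (by omega), Pi.single_eq_of_ne (by omega), zero_mul]
  have hc := rho_commute (commute_opX_ropY lam) (commute_opY_ropY lam) (commute_opD_ropY lam) b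
  rw [nf_mul, h, ← Module.End.mul_apply, hc.eq]
  rfl

lemma nf_mul_e (b : B) (i : ZMod m) (n : ℤ) :
    nf (b * e i) n = nf b n * (shift lam ^ n) (Pi.single i 1) := by
  have h : nf (e i : B) = ropD lam (Pi.single i 1) (Pi.single 0 1) := by
    rw [nf_apply, rho_e, opD_single, mul_one]
    ext1 n
    change _ = (Pi.single 0 1 : ℤ → ZMod m → ℂ[X]) n * _
    by_cases hn : n = 0
    · subst hn; simp
    · rw [Pi.single_eq_of_ne hn, Pi.single_eq_of_ne hn, zero_mul]
  have hc := rho_commute (commute_opX_ropD lam (Pi.single i 1))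
    (commute_opY_ropD lam (Pi.single i 1)) (fun d => commute_opD_ropD lam d (Pi.single i 1)) b
  rw [nf_mul, h, ← Module.End.mul_apply, hc.eq]
  rfl

lemma rho_x_pow_single (a : ℕ) : rho (x ^ a : B) (Pi.single 0 1) = Pi.single (a : ℤ) 1 := by
  induction a with
  | zero => simp
  | succ a ih => rw [pow_succ', map_mul, Module.End.mul_apply, ih, rho_x, opX_single, map_one]; simp

lemma rho_y_pow_single (k : ℕ) (n : ℤ) :
    rho (y ^ k : B) (Pi.single n 1) = Pi.single (n - k) (ypow lam k) := by
  induction k with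
  | zero => simp [ypow]
  | succ k ih =>
    rw [pow_succ', map_mul, Module.End.mul_apply, ih, rho_y, opY_single]
    congr 1
    push_cast; ring

lemma nf_monomial (j : ZMod m) (k a : ℕ) :
    nf (e j * y ^ k * x ^ a : B) = Pi.single ((a : ℤ) - k) (Pi.single j 1 * ypow lam k) := by
  rw [nf_apply, map_mul, map_mul, Module.End.mul_apply, Module.End.mul_apply, rho_x_pow_single,
    rho_y_pow_single, rho_e, opD_single]

end CyclicWeyl

namespace CyclicWeyl

variable {m : ℕ} [NeZero m] {lam : ZMod m → ℂ} {B : Type u} [Ring B] [Algebra ℂ B]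
  [CyclicWeyl B m lam]

/-! ### The basis of `B` as a right `ℂ[x]`-module -/

/-- `ℂ[X]` acts on `B` from the right through `X ↦ x`. -/
instance polyModule : Module ℂ[X] B :=
  Module.compHom B (aeval (MulOpposite.op x) : ℂ[X] →ₐ[ℂ] Bᵐᵒᵖ).toRingHom

lemma poly_smul_eq (p : ℂ[X]) (b : B) :
    p • b = (aeval (MulOpposite.op x) p : Bᵐᵒᵖ) • b := rfl

lemma X_smul (b : B) : (X : ℂ[X]) • b = b * x := by
  rw [poly_smul_eq, aeval_X, op_smul_eq_mul]

lemma C_smul (c : ℂ) (b : B) : (C c : ℂ[X]) • b = c • b := by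
  rw [poly_smul_eq, aeval_C, MulOpposite.algebraMap_apply, op_smul_eq_mul, Algebra.smul_def,
    Algebra.commutes]

lemma monomial_smul (a : ℕ) (c : ℂ) (b : B) : (monomial a c : ℂ[X]) • b = c • (b * x ^ a) := by
  rw [← C_mul_X_pow_eq_monomial, mul_smul, C_smul, poly_smul_eq, map_pow, aeval_X,
    ← MulOpposite.op_pow, op_smul_eq_mul]

lemma mul_poly_smul (p : ℂ[X]) (a b : B) : a * p • b = p • (a * b) := by
  simp only [poly_smul_eq]
  exact mul_smul_comm _ _ _

/-- Left multiplication, as a `ℂ[X]`-linear map. -/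
def mulLeft (a : B) : B →ₗ[ℂ[X]] B where
  toFun b := a * b
  map_add' := mul_add a
  map_smul' p b := mul_poly_smul p a b

/-- The coefficient of a polynomial at an integer. -/
def coeffInt (p : ℂ[X]) (n : ℤ) : ℂ := if 0 ≤ n then p.coeff n.toNat else 0

lemma nf_poly_smul (p : ℂ[X]) (j : ZMod m) (k : ℕ) (n : ℤ) (i : ZMod m) :
    nf (p • (e j * y ^ k : B)) n i = if j = i then coeffInt p (n + k) • ypow lam k i else 0 := by
  induction p using Polynomial.induction_on' with
  | add p q hp hq =>
    rw [add_smul, map_add, Pi.add_apply, Pi.add_apply, hp, hq]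
    by_cases h : j = i
    · have : coeffInt (p + q) (n + k) = coeffInt p (n + k) + coeffInt q (n + k) := by
        unfold coeffInt; split_ifs <;> simp
      simp [h, this, add_smul]
    · simp [h]
  | monomial a c =>
    rw [monomial_smul, map_smul, nf_monomial]
    by_cases h : j = i
    · subst h
      by_cases hn : n = a - k
      · subst hn; simp [coeffInt]
      · have : coeffInt (monomial a c) (n + k) = 0 := by
          unfold coeffInt
          split_ifs with h0
          · rw [coeff_monomial, if_neg (by omega)]
          · rfl
        simp [this, hn]
    · rw [if_neg h]
      by_cases hn : n = a - k
      · subst hn; simp [h]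
      · simp [hn]

variable (B) in
/-- The generators `e_j y ^ k` of `B` over `ℂ[x]`. -/
def gen (q : ZMod m × ℕ) : B := e q.1 * y ^ q.2

/-- At a fixed power of the Laurent variable and a fixed component `i`, each `e_i y^k` contributes
one coefficient times a polynomial of degree `k`, and the other components contribute nothing. -/
lemma linearIndependent_gen : LinearIndependent ℂ[X] (gen B) := by
  classical
  rw [linearIndependent_iff']
  rintro s g hg ⟨i, k⟩ hk
  ext a
  -- The monomial `e_i y^k x^a` sits at index `a - k`, so this is where the coefficient of `x^a` in
  -- `g (i, k)` is visible.
  have h : nf (∑ q ∈ s, g q • gen B q) ((a : ℤ) - k) i = 0 := by rw [hg]; simp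
  rw [map_sum, Finset.sum_apply, Finset.sum_apply] at h
  simp only [gen, nf_poly_smul] at h
  rw [← Finset.sum_filter, Finset.sum_congr rfl (g := fun q => (fun k' =>
    coeffInt (g (i, k')) ((a : ℤ) - k + k') • ypow lam k' i) q.2) (by
      rintro ⟨j, k'⟩ hq
      obtain rfl : j = i := (Finset.mem_filter.1 hq).2
      rfl), ← Finset.sum_image (s := s.filter fun q => q.1 = i) (g := Prod.snd) (f := fun k' =>
    coeffInt (g (i, k')) ((a : ℤ) - k + k') • ypow lam k' i)] at h
  · have := linearIndependent_iff'.1 (linearIndependent_ypow lam i) _ _ h k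
      (Finset.mem_image.2 ⟨(i, k), Finset.mem_filter.2 ⟨hk, rfl⟩, rfl⟩)
    simpa [coeffInt] using this
  · rintro ⟨j, k⟩ hq ⟨j', k'⟩ hq' hkk
    obtain rfl : j = i := (Finset.mem_filter.1 hq).2
    obtain rfl : j' = j := (Finset.mem_filter.1 hq').2
    exact Prod.ext rfl hkk

variable (B) in
/-- The elements of `y`-degree less than `n`. -/
def G (n : ℕ) : Submodule ℂ[X] B := Submodule.span ℂ[X] (gen B '' {q | q.2 < n})

lemma gen_mem_G {j : ZMod m} {k n : ℕ} (h : k < n) : (e j * y ^ k : B) ∈ G B n :=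
  Submodule.subset_span ⟨(j, k), h, rfl⟩

lemma G_mono {k n : ℕ} (h : k ≤ n) : G B k ≤ G B n :=
  Submodule.span_mono (Set.image_mono fun _ hq => lt_of_lt_of_le hq h)

lemma G_zero : G B 0 = ⊥ := by
  simp [G]

/-- Left multiplication commutes with the right action of `ℂ[x]`, so only generators need testing.
-/
lemma mul_mem_of_gen {k n : ℕ} (a : B)
    (h : ∀ (j : ZMod m) (l : ℕ), l < k → a * (e j * y ^ l : B) ∈ G B n) {b : B} (hb : b ∈ G B k) :
    a * b ∈ G B n := by
  have : G B k ≤ (G B n).comap (mulLeft a) := by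
    refine Submodule.span_le.2 ?_
    rintro _ ⟨⟨j, l⟩, hl, rfl⟩
    exact h j l hl
  exact this hb

lemma e_mul_mem_G {n : ℕ} (i : ZMod m) {b : B} (hb : b ∈ G B n) : e i * b ∈ G B n :=
  mul_mem_of_gen _ (fun j l hl => by
    rw [← mul_assoc, e_mul_e]
    split_ifs with h
    · exact gen_mem_G hl
    · simp) hb

lemma y_mul_mem_G {n : ℕ} {b : B} (hb : b ∈ G B n) : y * b ∈ G B (n + 1) :=
  mul_mem_of_gen _ (fun j l hl => by
    have : (y * (e j * y ^ l) : B) = e (j - 1) * y ^ (l + 1) := by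
      rw [← mul_assoc, pow_succ', ← mul_assoc, ← y_mul_e, sub_add_cancel]
    rw [this]
    exact gen_mem_G (by omega)) hb

lemma y_pow_mul_mem_G {n : ℕ} (k : ℕ) {b : B} (hb : b ∈ G B n) : y ^ k * b ∈ G B (n + k) := by
  induction k with
  | zero => simpa
  | succ k ih => rw [pow_succ', mul_assoc, ← add_assoc]; exact y_mul_mem_G ih

lemma complex_smul_mem_G {n : ℕ} (c : ℂ) {b : B} (hb : b ∈ G B n) : c • b ∈ G B n := by
  rw [← C_smul]; exact Submodule.smul_mem _ _ hb

lemma sum_lam_mul_mem_G {n : ℕ} {b : B} (hb : b ∈ G B n) : (∑ i, lam i • e i) * b ∈ G B n := by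
  rw [Finset.sum_mul]
  refine Submodule.sum_mem _ fun i _ => ?_
  rw [smul_mul_assoc]
  exact complex_smul_mem_G _ (e_mul_mem_G i hb)

lemma one_mem_G : (1 : B) ∈ G B 1 := by
  rw [← sum_e]
  exact Submodule.sum_mem _ fun i _ => by simpa using gen_mem_G (B := B) (j := i) (k := 0) one_pos

lemma y_pow_mem_G (k : ℕ) : (y ^ k : B) ∈ G B (k + 1) := by
  simpa [add_comm] using y_pow_mul_mem_G k (one_mem_G (B := B))

lemma mul_x_mem_G {n : ℕ} {b : B} (hb : b ∈ G B n) : b * x ∈ G B n := by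
  rw [← X_smul]; exact Submodule.smul_mem _ _ hb

/-- Moving `x` to the right past a power of `y` costs only terms of lower `y`-degree, by `x y = y x
+ ∑ λ_i e_i`. -/
lemma x_mul_mem_G {n : ℕ} {b : B} (hb : b ∈ G B n) : x * b ∈ G B n := by
  have key : ∀ l : ℕ, (x * y ^ l : B) ∈ G B (l + 1) := by
    intro l
    induction l with
    | zero =>
      rw [pow_zero, mul_one]
      simpa using mul_x_mem_G (one_mem_G (B := B))
    | succ l ih =>
      have : (x * y ^ (l + 1) : B) = y * (x * y ^ l) + (∑ i, lam i • e i) * y ^ l := by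
        rw [← comm, pow_succ']; noncomm_ring
      rw [this]
      refine Submodule.add_mem _ (y_mul_mem_G ih) (sum_lam_mul_mem_G ?_)
      exact G_mono (by omega) (y_pow_mem_G l)
  refine mul_mem_of_gen _ (fun j l hl => ?_) hb
  rw [← mul_assoc, x_mul_e, mul_assoc]
  exact e_mul_mem_G _ (G_mono hl (key l))

/-- This is the spanning half of the basis theorem: the union of the filtration contains `1` and is
stable under left multiplication by the generators. -/
lemma exists_mem_G (b : B) : ∃ n, b ∈ G B n := by
  let S : Submodule ℂ B :=
    { carrier := {b | ∃ n, b ∈ G B n}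
      add_mem' := by
        rintro a b ⟨n, hn⟩ ⟨k, hk⟩
        exact ⟨max n k, Submodule.add_mem _ (G_mono (le_max_left _ _) hn)
          (G_mono (le_max_right _ _) hk)⟩
      zero_mem' := ⟨0, Submodule.zero_mem _⟩
      smul_mem' := by
        rintro c b ⟨n, hn⟩
        exact ⟨n, complex_smul_mem_G c hn⟩ }
  exact mem_of_closed S ⟨1, one_mem_G⟩ (fun b ⟨n, hn⟩ => ⟨n, x_mul_mem_G hn⟩)
    (fun b ⟨n, hn⟩ => ⟨n + 1, y_mul_mem_G hn⟩) (fun i b ⟨n, hn⟩ => ⟨n, e_mul_mem_G i hn⟩) b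

lemma poly_one_mul_mem_G {n : ℕ} (p : ℂ[X]) {b : B} (hb : b ∈ G B n) :
    p • (1 : B) * b ∈ G B n := by
  induction p using Polynomial.induction_on' with
  | add p q hp hq => rw [add_smul, add_mul]; exact Submodule.add_mem _ hp hq
  | monomial a c =>
    rw [monomial_smul, one_mul, smul_mul_assoc]
    refine complex_smul_mem_G _ ?_
    induction a with
    | zero => simpa
    | succ a ih => rw [pow_succ', mul_assoc]; exact x_mul_mem_G ih

lemma poly_smul_eq_mul (p : ℂ[X]) (b : B) : p • b = b * p • (1 : B) := by
  rw [mul_poly_smul, mul_one]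

/-- The filtration by `y`-degree is multiplicative. -/
lemma mul_mem_G {k n : ℕ} {a b : B} (ha : a ∈ G B (k + 1)) (hb : b ∈ G B n) :
    a * b ∈ G B (n + k) := by
  induction ha using Submodule.span_induction generalizing b with
  | mem a ha =>
    obtain ⟨⟨j, l⟩, hl, rfl⟩ := ha
    have hl : l < k + 1 := hl
    simp only [gen, mul_assoc]
    exact e_mul_mem_G _ (G_mono (by omega) (y_pow_mul_mem_G l hb))
  | zero => simp
  | add a a' _ _ h h' => rw [add_mul]; exact Submodule.add_mem _ (h hb) (h' hb)
  | smul p a _ h =>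
    rw [poly_smul_eq_mul, mul_assoc]
    exact h (poly_one_mul_mem_G p hb)

variable (B) in
/-- The basis `e_j y ^ k` of `B` as a right `ℂ[x]`-module. -/
def basis : Module.Basis (ZMod m × ℕ) ℂ[X] B :=
  Module.Basis.mk (linearIndependent_gen (B := B)) fun b _ => by
    obtain ⟨n, hn⟩ := exists_mem_G b
    exact Submodule.span_mono (Set.image_subset_range _ _) hn

@[simp] lemma basis_apply (q : ZMod m × ℕ) : basis B q = gen B q := Module.Basis.mk_apply _ _ _

lemma mem_G_iff {n : ℕ} {b : B} :
    b ∈ G B n ↔ ∀ j k, n ≤ k → (basis B).repr b (j, k) = 0 := by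
  have : G B n = Submodule.span ℂ[X] (basis B '' {q | q.2 < n}) := by
    rw [G, Set.image_congr fun q _ => (basis_apply (B := B) q).symm]
  rw [this, Module.Basis.mem_span_image, Set.subset_def]
  refine ⟨fun h j k hk => ?_, fun h q hq => ?_⟩
  · refine Finsupp.notMem_support_iff.1 fun h0 => ?_
    exact absurd (h (j, k) h0) (not_lt.2 hk)
  · obtain ⟨j, k⟩ := q
    have hjk : (basis B).repr b (j, k) ≠ 0 := Finsupp.mem_support_iff.1 hq
    change k < n
    by_contra hk
    exact hjk (h j k (not_lt.1 hk))

/-- The coefficient of `y ^ k`. -/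
def lc (k : ℕ) : B →ₗ[ℂ[X]] (ZMod m → ℂ[X]) :=
  LinearMap.pi fun j => Finsupp.lapply (j, k) ∘ₗ (basis B).repr.toLinearMap

lemma lc_apply (k : ℕ) (b : B) (j : ZMod m) : lc k b j = (basis B).repr b (j, k) := rfl

lemma lc_eq_zero {n k : ℕ} {b : B} (hb : b ∈ G B n) (hk : n ≤ k) : lc k b = 0 :=
  funext fun j => mem_G_iff.1 hb j k hk

lemma mem_G_of_lc_eq_zero {n : ℕ} {b : B} (hb : b ∈ G B (n + 1)) (h : lc n b = 0) : b ∈ G B n :=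
  mem_G_iff.2 fun j k hk => by
    obtain rfl | hk := hk.eq_or_lt
    · exact congrFun h j
    · exact mem_G_iff.1 hb j k hk

lemma lc_gen (n : ℕ) (j : ZMod m) (k : ℕ) :
    lc n (e j * y ^ k : B) = if n = k then Pi.single j 1 else 0 := by
  ext1 i
  have h := (basis B).repr_self (j, k)
  rw [basis_apply] at h
  rw [lc_apply, show (e j * y ^ k : B) = gen B (j, k) from rfl, h]
  by_cases hn : n = k
  · subst hn
    by_cases hi : i = j
    · subst hi; simp
    · rw [Finsupp.single_eq_of_ne (by simpa using hi)]; simp [hi]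
  · rw [Finsupp.single_eq_of_ne (by simp [hn]), if_neg hn]; rfl

lemma lc_sum (n : ℕ) (q : ZMod m → ℂ[X]) : lc n (∑ j, q j • (e j * y ^ n : B)) = q := by
  rw [map_sum]
  ext1 i
  simp [lc_gen, Pi.single_apply]

lemma sum_mem_G (n : ℕ) (q : ZMod m → ℂ[X]) : ∑ j, q j • (e j * y ^ n : B) ∈ G B (n + 1) :=
  Submodule.sum_mem _ fun _ _ => Submodule.smul_mem _ _ (gen_mem_G (Nat.lt_succ_self n))

lemma sub_lc_mem_G {n : ℕ} {b : B} (hb : b ∈ G B (n + 1)) :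
    b - ∑ j, lc n b j • (e j * y ^ n) ∈ G B n :=
  mem_G_of_lc_eq_zero (Submodule.sub_mem _ hb (sum_mem_G _ _)) (by rw [map_sub, lc_sum, sub_self])

lemma y_mem_G : (y : B) ∈ G B 2 := by simpa using y_pow_mem_G (B := B) 1

lemma e_mem_G (i : ZMod m) : (e i : B) ∈ G B 1 := by simpa using e_mul_mem_G i (one_mem_G (B := B))

lemma mul_y_mem_G {n : ℕ} {b : B} (hb : b ∈ G B n) : b * y ∈ G B (n + 1) := by
  cases n with
  | zero =>
    rw [G_zero, Submodule.mem_bot] at hb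
    simp [hb]
  | succ n => simpa [add_comm, add_left_comm] using mul_mem_G hb (y_mem_G (B := B))

lemma mul_mem_G_of_mem_G_one {n : ℕ} {a b : B} (ha : a ∈ G B n) (hb : b ∈ G B 1) :
    a * b ∈ G B n := by
  cases n with
  | zero =>
    rw [G_zero, Submodule.mem_bot] at ha
    simp [ha]
  | succ n => simpa [add_comm] using mul_mem_G ha hb

/-- `y` commutes with `ℂ[x]` modulo terms of `y`-degree zero. -/
lemma poly_mul_y_sub_mem_G (p : ℂ[X]) : p • (1 : B) * y - p • y ∈ G B 1 := by
  induction p using Polynomial.induction_on' with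
  | add p q hp hq =>
    have : (p + q) • (1 : B) * y - (p + q) • y = (p • (1 : B) * y - p • y) +
      (q • (1 : B) * y - q • y) := by rw [add_smul, add_smul, add_mul]; abel
    rw [this]
    exact Submodule.add_mem _ hp hq
  | monomial a c =>
    rw [monomial_smul, monomial_smul, one_mul, smul_mul_assoc, ← smul_sub]
    refine complex_smul_mem_G _ ?_
    induction a with
    | zero => simp
    | succ a ih =>
      have : (x ^ (a + 1) * y - y * x ^ (a + 1) : B) =
          x * (x ^ a * y - y * x ^ a) + (∑ i, lam i • e i) * x ^ a := by
        rw [← comm, pow_succ']; noncomm_ring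
      rw [this]
      refine Submodule.add_mem _ (x_mul_mem_G ih) (sum_lam_mul_mem_G ?_)
      have := poly_one_mul_mem_G (X ^ a) (one_mem_G (B := B))
      rwa [← monomial_one_right_eq_X_pow, monomial_smul, one_smul, one_mul, mul_one] at this

lemma poly_smul_mul_y_sub_mem_G {n : ℕ} (p : ℂ[X]) {b : B} (hb : b ∈ G B n) :
    (p • b) * y - p • (b * y) ∈ G B n := by
  have : (p • b) * y - p • (b * y) = b * (p • (1 : B) * y - p • y) := by
    rw [poly_smul_eq_mul, ← mul_poly_smul p b y, mul_sub, mul_assoc]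
  rw [this]
  exact mul_mem_G_of_mem_G_one hb (poly_mul_y_sub_mem_G p)

/-- Modulo lower `y`-degree, `y` commutes with `ℂ[x]`, so multiplying `e_j y^n p(x)` by `y` on the
right only raises the exponent of `y`. -/
lemma lc_mul_y {n : ℕ} {b : B} (hb : b ∈ G B (n + 1)) : lc (n + 1) (b * y) = lc n b := by
  have h1 : b * y - ∑ j, lc n b j • (e j * y ^ (n + 1)) ∈ G B (n + 1) := by
    have : b * y - ∑ j, lc n b j • (e j * y ^ (n + 1)) =
        (b - ∑ j, lc n b j • (e j * y ^ n)) * y +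
        ∑ j, ((lc n b j • (e j * y ^ n)) * y - lc n b j • (e j * y ^ n * y)) := by
      rw [Finset.sum_sub_distrib, sub_mul, Finset.sum_mul]
      simp only [pow_succ, mul_assoc]
      abel
    rw [this]
    refine Submodule.add_mem _ (mul_y_mem_G (sub_lc_mem_G hb)) (Submodule.sum_mem _ fun j _ => ?_)
    exact poly_smul_mul_y_sub_mem_G _ (gen_mem_G (Nat.lt_succ_self n))
  have h2 := lc_eq_zero h1 le_rfl
  rwa [map_sub, lc_sum, sub_eq_zero] at h2

/-- Start from any degree bound for `b` and lower it step by step: a leading coefficient of `b`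
above the claimed bound would survive in `b * y`. -/
lemma mem_G_of_mul_y_mem_G {n : ℕ} {b : B} (hb : b * y ∈ G B (n + 1)) : b ∈ G B n := by
  have key : ∀ k, b ∈ G B (n + k) → b ∈ G B n := by
    intro k
    induction k with
    | zero => exact id
    | succ k ih =>
      intro h
      refine ih (mem_G_of_lc_eq_zero (n := n + k) h ?_)
      rw [← lc_mul_y (n := n + k) h]
      exact lc_eq_zero hb (by omega)
  obtain ⟨k, hk⟩ := exists_mem_G b
  exact key k (G_mono (by omega) hk)

lemma mem_G_of_mul_y_pow_mem_G {n k : ℕ} {b : B} (hb : b * y ^ k ∈ G B (n + k)) : b ∈ G B n := by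
  induction k with
  | zero => simpa using hb
  | succ k ih =>
    refine ih (mem_G_of_mul_y_mem_G ?_)
    rwa [mul_assoc, ← pow_succ]

lemma poly_mul_y_pow_sub_mem_G (p : ℂ[X]) (n : ℕ) : p • (1 : B) * y ^ n - p • y ^ n ∈ G B n := by
  induction n with
  | zero => simp
  | succ n ih =>
    have : p • (1 : B) * y ^ (n + 1) - p • y ^ (n + 1) =
        (p • (1 : B) * y ^ n - p • y ^ n) * y + ((p • y ^ n) * y - p • (y ^ n * y)) := by
      rw [sub_mul, mul_assoc, ← pow_succ]; abel
    rw [this]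
    exact Submodule.add_mem _ (mul_y_mem_G ih) (poly_smul_mul_y_sub_mem_G p (y_pow_mem_G n))

/-- Products of elements with given leading coefficients. -/
lemma poly_smul_mul_y_pow_sub_mem_G {k : ℕ} (p : ℂ[X]) (n : ℕ) {b : B} (hb : b ∈ G B (k + 1)) :
    (p • b) * y ^ n - p • (b * y ^ n) ∈ G B (n + k) := by
  have : (p • b) * y ^ n - p • (b * y ^ n) = b * (p • (1 : B) * y ^ n - p • y ^ n) := by
    rw [poly_smul_eq_mul, ← mul_poly_smul p b (y ^ n), mul_sub, mul_assoc]
  rw [this]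
  exact mul_mem_G hb (poly_mul_y_pow_sub_mem_G p n)

end CyclicWeyl

/-! ### Homogeneous bases of `ℤ/m`-graded modules over `ℂ[X]` -/

section Graded

variable {m : ℕ} {W : Type*} [AddCommGroup W] [Module ℂ[X] W]

/-- The projections onto the components of a `ℤ/m`-graded `ℂ[X]`-module, with `X` of degree `1`. -/
structure IsGrading (E : ZMod m → W →+ W) : Prop where
  idem : ∀ i w, E i (E i w) = E i w
  orth : ∀ i j w, i ≠ j → E i (E j w) = 0
  map_C_smul : ∀ i c w, E i ((C c : ℂ[X]) • w) = (C c : ℂ[X]) • E i w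
  map_X_smul : ∀ i w, E (i + 1) ((X : ℂ[X]) • w) = (X : ℂ[X]) • E i w

namespace IsGrading

variable {E : ZMod m → W →+ W} (hE : IsGrading E)
include hE

lemma map_monomial_smul (i : ZMod m) (a : ℕ) (c : ℂ) (w : W) :
    E (i + a) ((monomial a c : ℂ[X]) • w) = (monomial a c : ℂ[X]) • E i w := by
  rw [← C_mul_X_pow_eq_monomial, mul_smul, mul_smul, hE.map_C_smul]
  congr 1
  induction a generalizing w with
  | zero => simp
  | succ a ih =>
    rw [pow_succ', mul_smul, mul_smul, ← ih, Nat.cast_succ, ← add_assoc, hE.map_X_smul]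

/-- The monomial `X ^ a` raises degrees by `a`, so a projection of `p • w` selects coefficients of
`p`. In particular it is again a multiple of `w`. -/
lemma exists_component {j : ZMod m} {w : W} (hw : E j w = w) (i : ZMod m) (p : ℂ[X]) :
    ∃ q : ℂ[X], E i (p • w) = q • w ∧ ∀ a, q.coeff a = if i = j + a then p.coeff a else 0 := by
  induction p using Polynomial.induction_on' with
  | add p p' hp hp' =>
    obtain ⟨q, hq, hq'⟩ := hp
    obtain ⟨r, hr, hr'⟩ := hp'
    refine ⟨q + r, by rw [add_smul, map_add, hq, hr, add_smul], fun a => ?_⟩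
    rw [coeff_add, hq', hr']
    split_ifs <;> simp
  | monomial a c =>
    by_cases h : i = j + a
    · subst h
      refine ⟨monomial a c, by rw [hE.map_monomial_smul, hw], fun b => ?_⟩
      rw [coeff_monomial]
      split_ifs with h1 h2 h3
      · rfl
      · subst h1; simp at h2
      · rfl
      · rfl
    · refine ⟨0, ?_, fun b => ?_⟩
      · have h1 : i = (i - a) + a := by ring
        rw [h1, hE.map_monomial_smul, ← hw, hE.orth _ _ _ (fun h2 => h (by rw [← h2, ← h1])),
          smul_zero, zero_smul]
      · rw [coeff_zero, coeff_monomial]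
        split_ifs with h1 h2
        · subst h2; exact absurd h1 h
        · rfl
        · rfl

lemma map_mem_span {ι : Type*} {u : ι → W} {j : ι → ZMod m} (hu : ∀ s, E (j s) (u s) = u s)
    (i : ZMod m) {w : W} (hw : w ∈ Submodule.span ℂ[X] (Set.range u)) :
    E i w ∈ Submodule.span ℂ[X] (Set.range u) := by
  induction hw using Submodule.closure_induction with
  | zero => simp
  | add a b _ _ ha hb => rw [map_add]; exact Submodule.add_mem _ ha hb
  | smul_mem p w hw =>
    obtain ⟨s, rfl⟩ := hw
    obtain ⟨q, hq, -⟩ := hE.exists_component (hu s) i p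
    rw [hq]
    exact Submodule.smul_mem _ _ (Submodule.subset_span ⟨s, rfl⟩)

/-- A graded submodule of a module with a finite homogeneous basis has a finite homogeneous
basis. -/
lemma exists_homogeneous_basis {n : ℕ} {u : Fin n → W} (hu : LinearIndependent ℂ[X] u)
    {j : Fin n → ZMod m} (hj : ∀ s, E (j s) (u s) = u s) (Y : Submodule ℂ[X] W)
    (hY : Y ≤ Submodule.span ℂ[X] (Set.range u)) (hYE : ∀ i, ∀ w ∈ Y, E i w ∈ Y) :
    ∃ (n' : ℕ) (u' : Fin n' → W) (j' : Fin n' → ZMod m), LinearIndependent ℂ[X] u' ∧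
      Submodule.span ℂ[X] (Set.range u') = Y ∧ ∀ s, E (j' s) (u' s) = u' s := by
  induction n generalizing Y with
  | zero =>
    refine ⟨0, u, j, hu, le_antisymm ?_ hY, hj⟩
    rw [Set.range_eq_empty, Submodule.span_empty]
    exact bot_le
  | succ n ih =>
    -- Induction on the rank: `Y ⊓ L` is handled by the induction hypothesis, and at most one
    -- further generator, with nonzero coordinate along `u 0`, has to be added.
    set L := Submodule.span ℂ[X] (Set.range fun s : Fin n => u s.succ) with hL
    have huniq : ∀ (p : ℂ[X]), ∀ z ∈ L, p • u 0 + z = 0 → p = 0 := by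
      intro p z hz h
      obtain ⟨c, rfl⟩ := (Submodule.mem_span_range_iff_exists_fun _).1 hz
      have := Fintype.linearIndependent_iff.1 hu (Fin.cons p c) (by
        rw [Fin.sum_univ_succ]; simpa using h) 0
      simpa using this
    have hdec : ∀ w ∈ Y, ∃ p : ℂ[X], ∃ z ∈ L, w = p • u 0 + z := by
      intro w hw
      obtain ⟨c, rfl⟩ := (Submodule.mem_span_range_iff_exists_fun _).1 (hY hw)
      rw [Fin.sum_univ_succ]
      exact ⟨_, _, Submodule.sum_mem _ fun s _ => Submodule.smul_mem _ _
        (Submodule.subset_span ⟨s, rfl⟩), rfl⟩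
    have hLE : ∀ i, ∀ w ∈ L, E i w ∈ L := fun i w => hE.map_mem_span (fun s => hj s.succ) i
    obtain ⟨n', u', j', hli, hspan, hj'⟩ := ih (u := fun s => u s.succ)
      (hu.comp _ (Fin.succ_injective _)) (fun s => hj s.succ) (Y ⊓ L) inf_le_right
      fun i w hw => ⟨hYE i w hw.1, hLE i w hw.2⟩
    by_cases hI : ∃ d : ℕ, ∃ p : ℂ[X], ∃ z ∈ L, p ≠ 0 ∧ p.natDegree = d ∧ p • u 0 + z ∈ Y
    · classical
      -- `p` has least degree `d` among the nonzero coordinates along `u 0` of elements of `Y`.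
      obtain ⟨p, z, hz, hp0, hpd, hpY⟩ := Nat.find_spec hI
      set d := Nat.find hI
      have hmin : ∀ p' : ℂ[X], ∀ z ∈ L, p' • u 0 + z ∈ Y → p' ≠ 0 → d ≤ p'.natDegree :=
        fun p' z hz h h0 => Nat.find_min' hI ⟨p', z, hz, h0, rfl, h⟩
      -- The component in which the top term of `p` lies keeps that term, so the coordinate `q` of
      -- the homogeneous element still has degree `d`.
      obtain ⟨q, hq, hqc⟩ := hE.exists_component (hj 0) (j 0 + d) p
      have hy : q • u 0 + E (j 0 + d) z ∈ Y := by
        rw [← hq, ← map_add]; exact hYE _ _ hpY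
      have hqd : q.coeff d ≠ 0 := by
        rw [hqc, if_pos rfl, ← hpd]; simpa using hp0
      have hq0 : q ≠ 0 := fun h => hqd (by simp [h])
      have hqn : q.natDegree ≤ d := natDegree_le_iff_coeff_eq_zero.2 fun a ha => by
        rw [hqc]
        split_ifs
        · exact coeff_eq_zero_of_natDegree_lt (by omega)
        · rfl
      set y₀ := q • u 0 + E (j 0 + d) z with hy₀
      have hz' := hLE (j 0 + d) z hz
      refine ⟨n' + 1, Fin.cons y₀ u', Fin.cons (j 0 + d) j', ?_, ?_, ?_⟩
      · refine hli.finCons' _ _ fun c w hw hsum => ?_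
        have hwL : w ∈ L := (hspan ▸ hw : w ∈ Y ⊓ L).2
        have := huniq (c * q) (c • E (j 0 + d) z + w)
          (Submodule.add_mem _ (Submodule.smul_mem _ _ hz') hwL) (by
            rw [← hsum, hy₀, smul_add, mul_smul]; abel)
        exact (mul_eq_zero.1 this).resolve_right hq0
      · rw [Fin.range_cons, Submodule.span_insert, hspan]
        refine le_antisymm (sup_le ?_ inf_le_left) fun w hw => ?_
        · rw [Submodule.span_singleton_le_iff_mem]; exact hy
        · obtain ⟨p', z', hz1, rfl⟩ := hdec w hw
          have hr : ((p' % q) • u 0 + (z' - (p' / q) • E (j 0 + d) z) : W) =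
              p' • u 0 + z' - (p' / q) • y₀ := by
            have : p' % q = p' - q * (p' / q) := by
              rw [eq_sub_iff_add_eq, EuclideanDomain.mod_add_div]
            rw [this, hy₀, sub_smul, smul_add, smul_smul, mul_comm q]
            abel
          have hrL : z' - (p' / q) • E (j 0 + d) z ∈ L :=
            Submodule.sub_mem _ hz1 (Submodule.smul_mem _ _ hz')
          have hrY : p' • u 0 + z' - (p' / q) • y₀ ∈ Y :=
            Submodule.sub_mem _ hw (Submodule.smul_mem _ _ hy)
          -- Division with remainder by `q`: a nonzero remainder would contradict the minimality of
          -- `d`.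
          have hmod : p' % q = 0 := by
            by_contra h0
            have h1 := hmin _ _ hrL (hr ▸ hrY) h0
            have h2 := natDegree_lt_natDegree h0 (degree_mod_lt p' hq0)
            omega
          rw [hmod, zero_smul, zero_add] at hr
          have : p' • u 0 + z' = (p' / q) • y₀ + (p' • u 0 + z' - (p' / q) • y₀) := by abel
          rw [this]
          refine Submodule.add_mem_sup (Submodule.smul_mem _ _
            (Submodule.mem_span_singleton_self _)) ⟨hrY, hr ▸ hrL⟩
      · refine Fin.cases ?_ fun s => ?_
        · simp only [Fin.cons_zero]
          rw [hy₀, ← hq, ← map_add, hE.idem]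
        · simpa using hj' s
    · refine ⟨n', u', j', hli, hspan.trans (inf_eq_left.2 fun w hw => ?_), hj'⟩
      obtain ⟨p, z, hz, rfl⟩ := hdec w hw
      have hp : p = 0 := by
        by_contra h0
        exact hI ⟨_, p, z, hz, h0, rfl, hw⟩
      rw [hp, zero_smul, zero_add]
      exact hz

end IsGrading

end Graded

/-! ### Column vectors over a ring and their linear combinations -/

section Columns

variable {B : Type u} [Ring B]

lemma op_smul_apply {N : ℕ} (b : B) (w : Fin N → B) (c : Fin N) :
    (MulOpposite.op b • w) c = w c * b := rfl

/-- The linear combinations of the columns `w`. -/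
def comb {N b : ℕ} (w : Fin b → Fin N → B) : (Fin b → B) →ₗ[Bᵐᵒᵖ] (Fin N → B) where
  toFun z c := ∑ t, w t c * z t
  map_add' z z' := by ext c; simp [mul_add, Finset.sum_add_distrib]
  map_smul' r z := by ext c; simp [Finset.sum_mul, mul_assoc]

lemma comb_apply {N b : ℕ} (w : Fin b → Fin N → B) (z : Fin b → B) (c : Fin N) :
    comb w z c = ∑ t, w t c * z t := rfl

lemma comb_comb {N b a : ℕ} (w : Fin b → Fin N → B) (k : Fin a → Fin b → B) (z : Fin a → B) :
    comb w (comb k z) = comb (fun s => comb w (k s)) z := by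
  ext c
  simp only [comb_apply, Finset.mul_sum, Finset.sum_mul, mul_assoc]
  exact Finset.sum_comm

end Columns

namespace CyclicWeyl

variable {m : ℕ} [NeZero m] {lam : ZMod m → ℂ} {B : Type u} [Ring B] [Algebra ℂ B]
  [CyclicWeyl B m lam]

/-! ### Resolutions of submodules of free modules -/

lemma e_mul_y_pow (j : ZMod m) (k : ℕ) : (e j * y ^ k : B) = y ^ k * e (j + (k : ZMod m)) := by
  induction k generalizing j with
  | zero => simp
  | succ k ih =>
    rw [pow_succ', ← mul_assoc, ← y_mul_e, mul_assoc, ih, mul_assoc]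
    congr 3
    push_cast; ring

/-- The vectors with entries of `y`-degree less than `n`. -/
def GN (N n : ℕ) : Submodule ℂ[X] (Fin N → B) := Submodule.pi Set.univ fun _ => G B n

lemma mem_GN {N n : ℕ} {w : Fin N → B} : w ∈ GN N n ↔ ∀ c, w c ∈ G B n := by
  simp [GN, Submodule.mem_pi]

/-- The grading of a free right `B`-module by the idempotents `e_i`. -/
def grade (N : ℕ) (i : ZMod m) : (Fin N → B) →+ (Fin N → B) where
  toFun w := MulOpposite.op (e (-i) : B) • w
  map_zero' := smul_zero _
  map_add' := smul_add _

lemma grade_apply {N : ℕ} (i : ZMod m) (w : Fin N → B) (c : Fin N) :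
    grade N i w c = w c * e (-i) := rfl

lemma isGrading_grade (N : ℕ) : IsGrading (grade (B := B) N) where
  idem i w := by ext c; simp only [grade_apply, mul_assoc, e_mul_self]
  orth i j w h := by
    ext c
    simp only [grade_apply, mul_assoc, Pi.zero_apply]
    rw [e_mul_ne (fun h' => h (neg_injective h').symm), mul_zero]
  map_C_smul i a w := by ext c; simp only [grade_apply, Pi.smul_apply, C_smul, smul_mul_assoc]
  map_X_smul i w := by
    ext c
    simp only [grade_apply, Pi.smul_apply, X_smul, mul_assoc]
    rw [x_mul_e]
    congr 3
    ring

/-- A graded submodule of vectors of bounded `y`-degree has a homogeneous `ℂ[x]`-basis. -/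
lemma exists_basis_of_le_GN {N n : ℕ} (Y : Submodule ℂ[X] (Fin N → B)) (hY : Y ≤ GN N n)
    (hYe : ∀ i : ZMod m, ∀ w ∈ Y, MulOpposite.op (e i : B) • w ∈ Y) :
    ∃ (n' : ℕ) (u : Fin n' → Fin N → B) (j : Fin n' → ZMod m), LinearIndependent ℂ[X] u ∧
      Submodule.span ℂ[X] (Set.range u) = Y ∧ ∀ s c, u s c * e (j s) = u s c := by
  let I := Fin N × ZMod m × Fin n
  let q : I → Σ _ : Fin N, ZMod m × ℕ := fun p => ⟨p.1, p.2.1, p.2.2⟩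
  have hq : Function.Injective q := by
    rintro ⟨c, j, k⟩ ⟨c', j', k'⟩ h
    simp only [q, Sigma.mk.injEq, heq_eq_eq, Prod.mk.injEq, Fin.val_inj] at h
    obtain ⟨rfl, rfl, rfl⟩ := h
    rfl
  let bs := Pi.basis fun _ : Fin N => basis B
  have hbs : ∀ p : I, bs (q p) = Pi.single p.1 (e p.2.1 * y ^ (p.2.2 : ℕ)) := by
    intro p
    simp only [bs, q, Pi.basis_apply, basis_apply, gen]
  let eI := (Fintype.equivFin I).symm
  have hli : LinearIndependent ℂ[X] fun s => bs (q (eI s)) :=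
    bs.linearIndependent.comp _ (hq.comp eI.injective)
  have hspan : Submodule.span ℂ[X] (Set.range fun s => bs (q (eI s))) =
      Submodule.span ℂ[X] (Set.range fun p => bs (q p)) := by
    congr 1
    exact eI.surjective.range_comp fun p => bs (q p)
  -- As `e_j y^k = y^k e_{j+k}`, this generator is fixed by right multiplication by `e_{j+k}`. The
  -- projection of degree `i` is right multiplication by `e_{-i}`, whence the sign.
  obtain ⟨n', u, j, h1, h2, h3⟩ := (isGrading_grade (B := B) N).exists_homogeneous_basis hli
    (j := fun s => -((eI s).2.1 + (((eI s).2.2 : ℕ) : ZMod m))) (fun s => by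
      ext c
      rw [grade_apply, neg_neg, hbs]
      by_cases hc : c = (eI s).1
      · rw [hc, Pi.single_eq_same, e_mul_y_pow, mul_assoc, e_mul_self]
      · rw [Pi.single_eq_of_ne hc, zero_mul]) Y (by
      rw [hspan]
      refine hY.trans fun w hw => ?_
      rw [mem_GN] at hw
      rw [← Finset.univ_sum_single w]
      refine Submodule.sum_mem _ fun c _ => ?_
      have : G B n ≤ (Submodule.span ℂ[X] (Set.range fun p => bs (q p))).comap
          (LinearMap.single ℂ[X] (fun _ : Fin N => B) c) := by
        refine Submodule.span_le.2 ?_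
        rintro _ ⟨⟨i, k⟩, hk, rfl⟩
        refine Submodule.subset_span ⟨(c, i, ⟨k, hk⟩), ?_⟩
        exact hbs (c, i, ⟨k, hk⟩)
      exact this (hw c)) fun i w hw => hYe _ w hw
  exact ⟨n', u, fun s => -j s, h1, h2, fun s c => congrFun (h3 s) c⟩

variable (B) in
/-- The module `⊕ e_{j(t)} B`, as a submodule of a free module. -/
def cutPi {b : ℕ} (j : Fin b → ZMod m) : Submodule Bᵐᵒᵖ (Fin b → B) where
  carrier := {z | ∀ t, e (j t) * z t = z t}
  add_mem' h h' t := by simp only [Pi.add_apply, mul_add, h t, h' t]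
  zero_mem' t := mul_zero _
  smul_mem' r z h t := by
    change e (j t) * (z t * r.unop) = z t * r.unop
    rw [← mul_assoc, h t]

/-- Left multiplication by `e i` removes every other component of the leading coefficient, so a
single polynomial is left. -/
lemma exists_leading {d : ℕ} {i : ZMod m} {z : B} (hz : e i * z = z) (h : z ∈ G B (d + 1)) :
    ∃ q : ℂ[X], z - q • (e i * y ^ d) ∈ G B d := by
  refine ⟨lc d z i, ?_⟩
  have h1 := e_mul_mem_G i (sub_lc_mem_G h)
  rw [mul_sub, hz, Finset.mul_sum, Finset.sum_eq_single i] at h1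
  · rwa [mul_poly_smul, ← mul_assoc, e_mul_self] at h1
  · intro k _ hk
    rw [mul_poly_smul, ← mul_assoc, e_mul_ne hk.symm, zero_mul, smul_zero]
  · simp

lemma exists_eq_smul_e {i : ZMod m} {z : B} (hz : e i * z = z) (h : z ∈ G B 1) :
    ∃ q : ℂ[X], z = q • e i := by
  obtain ⟨q, hq⟩ := exists_leading (d := 0) hz h
  rw [G_zero, Submodule.mem_bot, sub_eq_zero] at hq
  exact ⟨q, by simpa using hq⟩

/-- The vectors of `y`-degree less than `n` in a submodule of a free module. -/
def trunc {N : ℕ} (M : Submodule Bᵐᵒᵖ (Fin N → B)) (n : ℕ) : Submodule ℂ[X] (Fin N → B) where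
  carrier := {w | w ∈ M ∧ w ∈ GN N n}
  add_mem' h h' := ⟨M.add_mem h.1 h'.1, Submodule.add_mem _ h.2 h'.2⟩
  zero_mem' := ⟨M.zero_mem, Submodule.zero_mem _⟩
  smul_mem' p _ h := ⟨M.smul_mem (aeval (MulOpposite.op x) p : Bᵐᵒᵖ) h.1,
    Submodule.smul_mem _ p h.2⟩

lemma trunc_mono {N : ℕ} {M : Submodule Bᵐᵒᵖ (Fin N → B)} {k n : ℕ} (h : k ≤ n) :
    trunc M k ≤ trunc M n := fun _ hw =>
  ⟨hw.1, mem_GN.2 fun c => G_mono h (mem_GN.1 hw.2 c)⟩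

lemma y_smul_mem_trunc {N : ℕ} {M : Submodule Bᵐᵒᵖ (Fin N → B)} {n : ℕ} {w : Fin N → B}
    (h : w ∈ trunc M n) : MulOpposite.op (y : B) • w ∈ trunc M (n + 1) :=
  ⟨M.smul_mem _ h.1, mem_GN.2 fun c => mul_y_mem_G (mem_GN.1 h.2 c)⟩

lemma e_smul_mem_trunc {N : ℕ} {M : Submodule Bᵐᵒᵖ (Fin N → B)} {n : ℕ} {w : Fin N → B}
    (i : ZMod m) (h : w ∈ trunc M n) : MulOpposite.op (e i : B) • w ∈ trunc M n :=
  ⟨M.smul_mem _ h.1, mem_GN.2 fun c => mul_mem_G_of_mem_G_one (mem_GN.1 h.2 c) (e_mem_G i)⟩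

lemma exists_mem_GN {N : ℕ} (w : Fin N → B) : ∃ n, w ∈ GN N n := by
  choose n hn using fun c => exists_mem_G (w c)
  exact ⟨Finset.univ.sup n, mem_GN.2 fun c => G_mono (Finset.le_sup (Finset.mem_univ c)) (hn c)⟩

/-- The leading coefficients of a submodule stabilize. -/
lemma exists_trunc_stable {N : ℕ} (M : Submodule Bᵐᵒᵖ (Fin N → B)) :
    ∃ n, ∀ k, n ≤ k → ∀ w ∈ trunc M (k + 1), ∃ v ∈ trunc M k,
      w - MulOpposite.op (y : B) • v ∈ trunc M k := by
  let lcN : ∀ k, (Fin N → B) →ₗ[ℂ[X]] (Fin N → ZMod m → ℂ[X]) := fun k =>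
    LinearMap.pi fun c => lc k ∘ₗ LinearMap.proj c
  -- `L k` consists of the coefficients of `y ^ k` of vectors in `M` of `y`-degree at most `k`. The
  -- chain is increasing because right multiplication by `y` keeps leading coefficients.
  let L : ℕ →o Submodule ℂ[X] (Fin N → ZMod m → ℂ[X]) :=
    ⟨fun k => (trunc M (k + 1)).map (lcN k), monotone_nat_of_le_succ fun k => by
      rintro _ ⟨w, hw, rfl⟩
      refine ⟨_, y_smul_mem_trunc hw, ?_⟩
      ext1 c
      exact lc_mul_y (mem_GN.1 hw.2 c)⟩
  obtain ⟨n, hn⟩ := monotone_stabilizes_iff_noetherian.2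
    (inferInstanceAs (IsNoetherian ℂ[X] (Fin N → ZMod m → ℂ[X]))) L
  -- The bound is `n + 1` since the vector `v` has to come from the level below that of `w`.
  refine ⟨n + 1, fun k hk w hw => ?_⟩
  obtain ⟨k, rfl⟩ := Nat.exists_eq_add_of_le' hk
  have h1 : lcN (k + n + 1) w ∈ L (k + n) := by
    rw [← hn (k + n) (by omega), hn (k + n + 1) (by omega)]
    exact ⟨w, hw, rfl⟩
  obtain ⟨v, hv, hvw⟩ := h1
  refine ⟨v, hv, M.sub_mem hw.1 (M.smul_mem _ hv.1), mem_GN.2 fun c => ?_⟩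
  have hv' := mem_GN.1 hv.2 c
  refine mem_G_of_lc_eq_zero (n := k + n + 1) (Submodule.sub_mem _ (mem_GN.1 hw.2 c)
    (mul_y_mem_G hv')) ?_
  rw [Pi.sub_apply, map_sub, op_smul_apply, lc_mul_y hv', sub_eq_zero]
  exact (congrFun hvw c).symm

end CyclicWeyl

/-! ### The two-term resolution attached to two consecutive truncations -/

namespace CyclicWeyl

variable {m : ℕ} [NeZero m] {lam : ZMod m → ℂ} {B : Type u} [Ring B] [Algebra ℂ B]
  [CyclicWeyl B m lam]

lemma comb_poly_smul {N b : ℕ} (w : Fin b → Fin N → B) (p : ℂ[X]) (z : Fin b → B) :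
    comb w (p • z) = p • comb w z :=
  (comb w).map_smul (aeval (MulOpposite.op x) p : Bᵐᵒᵖ) z

lemma comb_smul_e {N b : ℕ} {w : Fin b → Fin N → B} {j : Fin b → ZMod m}
    (hw : ∀ t c, w t c * e (j t) = w t c) (q : Fin b → ℂ[X]) :
    comb w (fun t => q t • e (j t)) = ∑ t, q t • w t := by
  ext c
  rw [comb_apply, Finset.sum_apply]
  refine Finset.sum_congr rfl fun t _ => ?_
  rw [mul_poly_smul, hw, Pi.smul_apply]

lemma smul_e_mem_cutPi {b : ℕ} (j : Fin b → ZMod m) (q : Fin b → ℂ[X]) :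
    (fun t => q t • (e (j t) : B)) ∈ cutPi B j := fun t => by
  rw [mul_poly_smul, e_mul_self]

lemma smul_e_mem_G {i : ZMod m} (q : ℂ[X]) : q • (e i : B) ∈ G B 1 :=
  Submodule.smul_mem _ _ (e_mem_G i)

/-- On vectors of `y`-degree zero, `comb w` is injective if `w` is `ℂ[x]`-independent. -/
lemma eq_zero_of_comb_eq_zero {N b : ℕ} {w : Fin b → Fin N → B} {j : Fin b → ZMod m}
    (hw : ∀ t c, w t c * e (j t) = w t c) (hli : LinearIndependent ℂ[X] w)
    {z : Fin b → B} (hz : z ∈ cutPi B j) (hG : ∀ t, z t ∈ G B 1) (h : comb w z = 0) : z = 0 := by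
  choose q hq using fun t => exists_eq_smul_e (hz t) (hG t)
  obtain rfl : z = fun t => q t • e (j t) := funext hq
  rw [comb_smul_e hw] at h
  have := Fintype.linearIndependent_iff.1 hli q h
  ext t
  simp [this t]

lemma exists_comb_eq {N b : ℕ} {w : Fin b → Fin N → B} {j : Fin b → ZMod m}
    (hw : ∀ t c, w t c * e (j t) = w t c) {u : Fin N → B}
    (hu : u ∈ Submodule.span ℂ[X] (Set.range w)) :
    ∃ z ∈ cutPi B j, (∀ t, z t ∈ G B 1) ∧ comb w z = u := by
  obtain ⟨q, rfl⟩ := (Submodule.mem_span_range_iff_exists_fun _).1 hu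
  exact ⟨_, smul_e_mem_cutPi j q, fun t => smul_e_mem_G _, comb_smul_e hw q⟩

/-- The data from which the resolution of a submodule is built. -/
structure ResolutionData {N : ℕ} (M : Submodule Bᵐᵒᵖ (Fin N → B)) where
  n : ℕ
  stable : ∀ k, n ≤ k → ∀ w ∈ trunc M (k + 1), ∃ v ∈ trunc M k,
    w - MulOpposite.op (y : B) • v ∈ trunc M k
  (a b : ℕ)
  v : Fin a → Fin N → B
  jv : Fin a → ZMod m
  hv : LinearIndependent ℂ[X] v
  span_v : Submodule.span ℂ[X] (Set.range v) = trunc M n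
  v_mul : ∀ s c, v s c * e (jv s) = v s c
  w : Fin b → Fin N → B
  jw : Fin b → ZMod m
  hw : LinearIndependent ℂ[X] w
  span_w : Submodule.span ℂ[X] (Set.range w) = trunc M (n + 1)
  w_mul : ∀ s c, w s c * e (jw s) = w s c
  l : Fin a → Fin b → B
  l_mem : ∀ s, l s ∈ cutPi B jw
  l_mem_G : ∀ s t, l s t ∈ G B 1
  comb_l : ∀ s, comb w (l s) = v s
  r : Fin a → Fin b → B
  r_mem : ∀ s, r s ∈ cutPi B jw
  r_mem_G : ∀ s t, r s t ∈ G B 1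
  comb_r : ∀ s, comb w (r s) = MulOpposite.op (y : B) • v s

/-- For a basis vector `v s` of the smaller truncation, both `v s` and `v s * y` lie in the larger
one. Their coordinates in the basis `w` are `l s` and `r s`, and the relations of the resolution are
`l s * y - r s`. -/
lemma nonempty_resolutionData {N : ℕ} (M : Submodule Bᵐᵒᵖ (Fin N → B)) :
    Nonempty (ResolutionData M) := by
  obtain ⟨n, hn⟩ := exists_trunc_stable M
  obtain ⟨a, v, jv, hv, span_v, v_mul⟩ := exists_basis_of_le_GN (trunc M n)
    (fun _ h => h.2) fun i w h => e_smul_mem_trunc i h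
  obtain ⟨b, w, jw, hw, span_w, w_mul⟩ := exists_basis_of_le_GN (trunc M (n + 1))
    (fun _ h => h.2) fun i w h => e_smul_mem_trunc i h
  have hmem : ∀ s, v s ∈ trunc M n := fun s => span_v ▸ Submodule.subset_span ⟨s, rfl⟩
  choose l h1 h2 h3 using fun s => exists_comb_eq w_mul
    (span_w.symm ▸ trunc_mono n.le_succ (hmem s))
  choose r h4 h5 h6 using fun s => exists_comb_eq w_mul
    (span_w.symm ▸ y_smul_mem_trunc (hmem s))
  exact ⟨⟨n, hn, a, b, v, jv, hv, span_v, v_mul, w, jw, hw, span_w, w_mul, l, h1, h2, h3, r,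
    h4, h5, h6⟩⟩

namespace ResolutionData

variable {N : ℕ} {M : Submodule Bᵐᵒᵖ (Fin N → B)} (D : ResolutionData M)

lemma w_mem (s : Fin D.b) : D.w s ∈ trunc M (D.n + 1) :=
  D.span_w ▸ Submodule.subset_span ⟨s, rfl⟩

/-- Coordinates with respect to `w` are unique, so they inherit the homogeneity of `v s`. The same
reasoning applies to `r s`, where `e_j y = y e_{j+1}` shifts the index. -/
lemma l_mul (s : Fin D.a) (t : Fin D.b) : D.l s t * e (D.jv s) = D.l s t := by
  have h : MulOpposite.op (e (D.jv s) : B) • D.l s - D.l s = 0 := by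
    refine eq_zero_of_comb_eq_zero D.w_mul D.hw ?_ (fun t => ?_) ?_
    · exact Submodule.sub_mem _ (Submodule.smul_mem _ _ (D.l_mem s)) (D.l_mem s)
    · exact Submodule.sub_mem _ (mul_mem_G_of_mem_G_one (D.l_mem_G s t) (e_mem_G _)) (D.l_mem_G s t)
    · rw [map_sub, map_smul, D.comb_l, sub_eq_zero]
      exact funext fun c => D.v_mul s c
  exact congrFun (sub_eq_zero.1 h) t

lemma r_mul (s : Fin D.a) (t : Fin D.b) : D.r s t * e (D.jv s + 1) = D.r s t := by
  have h : MulOpposite.op (e (D.jv s + 1) : B) • D.r s - D.r s = 0 := by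
    refine eq_zero_of_comb_eq_zero D.w_mul D.hw ?_ (fun t => ?_) ?_
    · exact Submodule.sub_mem _ (Submodule.smul_mem _ _ (D.r_mem s)) (D.r_mem s)
    · exact Submodule.sub_mem _ (mul_mem_G_of_mem_G_one (D.r_mem_G s t) (e_mem_G _)) (D.r_mem_G s t)
    · rw [map_sub, map_smul, D.comb_r, sub_eq_zero]
      refine funext fun c => ?_
      simp only [op_smul_apply, mul_assoc, y_mul_e]
      rw [← mul_assoc, D.v_mul]
  exact congrFun (sub_eq_zero.1 h) t

/-- The relations of the resolution. -/
def rel (s : Fin D.a) : Fin D.b → B := MulOpposite.op (y : B) • D.l s - D.r s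

lemma rel_apply (s : Fin D.a) (t : Fin D.b) : D.rel s t = D.l s t * y - D.r s t := rfl

lemma rel_mem (s : Fin D.a) : D.rel s ∈ cutPi B D.jw :=
  Submodule.sub_mem _ (Submodule.smul_mem _ _ (D.l_mem s)) (D.r_mem s)

lemma rel_mul (s : Fin D.a) (t : Fin D.b) : D.rel s t * e (D.jv s + 1) = D.rel s t := by
  rw [rel_apply, sub_mul, mul_assoc, y_mul_e, ← mul_assoc, D.l_mul, D.r_mul]

lemma comb_rel (s : Fin D.a) : comb D.w (D.rel s) = 0 := by
  rw [rel, map_sub, map_smul, D.comb_l, D.comb_r, sub_self]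

lemma comb_comb_rel (z : Fin D.a → B) : comb D.w (comb D.rel z) = 0 := by
  rw [comb_comb]
  ext c
  simp [comb_apply, D.comb_rel]

lemma comb_rel_mem (z : Fin D.a → B) : comb D.rel z ∈ cutPi B D.jw := fun t => by
  rw [comb_apply, Finset.mul_sum]
  refine Finset.sum_congr rfl fun s _ => ?_
  rw [← mul_assoc, D.rel_mem s t]

lemma comb_w_mem (z : Fin D.b → B) : comb D.w z ∈ M := by
  have : comb D.w z = ∑ t, MulOpposite.op (z t) • D.w t := by
    ext c; simp [comb_apply]
  rw [this]
  exact Submodule.sum_mem _ fun t _ => M.smul_mem _ (D.w_mem t).1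

/-- The leading coefficient of an image of the relations. -/
lemma comb_rel_sub_mem_G (g : Fin D.a → ℂ[X]) (d : ℕ) (t : Fin D.b) :
    comb D.rel (fun s => g s • (e (D.jv s + 1) * y ^ d)) t - (∑ s, g s • D.l s t) * y ^ (d + 1) ∈
      G B (d + 1) := by
  rw [comb_apply, Finset.sum_mul, ← Finset.sum_sub_distrib]
  refine Submodule.sum_mem _ fun s _ => ?_
  have h1 : D.rel s t * g s • (e (D.jv s + 1) * y ^ d) - (g s • D.l s t) * y ^ (d + 1) =
      -((g s • D.l s t) * y ^ (d + 1) - g s • (D.l s t * y ^ (d + 1))) -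
        g s • (D.r s t * y ^ d) := by
    rw [mul_poly_smul, ← mul_assoc, D.rel_mul, rel_apply, sub_mul, smul_sub, mul_assoc, pow_succ']
    abel
  rw [h1]
  refine Submodule.sub_mem _ (Submodule.neg_mem _ ?_) (Submodule.smul_mem _ _ ?_)
  · exact poly_smul_mul_y_pow_sub_mem_G (k := 0) _ _ (D.l_mem_G s t)
  · simpa [add_comm] using mul_mem_G (k := 0) (D.r_mem_G s t) (y_pow_mem_G (B := B) d)

lemma comb_sum_l (g : Fin D.a → ℂ[X]) :
    comb D.w (∑ s, g s • D.l s) = ∑ s, g s • D.v s := by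
  rw [map_sum]
  refine Finset.sum_congr rfl fun s _ => ?_
  rw [comb_poly_smul, D.comb_l]

/-- Induction on the `y`-degree of a syzygy `z`: its leading term is that of a combination of the
relations, and subtracting this combination lowers the degree. -/
lemma exact_aux (d : ℕ) (z : Fin D.b → B) (hz : z ∈ cutPi B D.jw) (hd : ∀ t, z t ∈ G B d)
    (h : comb D.w z = 0) :
    ∃ b ∈ cutPi B (fun s => D.jv s + 1), comb D.rel b = z := by
  induction d generalizing z with
  | zero =>
    refine ⟨0, Submodule.zero_mem _, ?_⟩
    rw [map_zero]
    ext t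
    have := hd t
    rw [G_zero, Submodule.mem_bot] at this
    exact this.symm
  | succ d ih =>
    cases d with
    | zero =>
      exact ⟨0, Submodule.zero_mem _, by
        rw [map_zero, eq_zero_of_comb_eq_zero D.w_mul D.hw hz hd h]⟩
    | succ d =>
      choose q hq using fun t => exists_leading (hz t) (hd t)
      -- The top terms must cancel: since `comb D.w z = 0`, multiplying this vector by `y ^ (d + 1)`
      -- gives only terms of lower degree, so its own `y`-degree is below `D.n`.
      have hu : ∑ t, q t • D.w t ∈ trunc M D.n := by
        refine ⟨?_, mem_GN.2 fun c => ?_⟩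
        · have : ∑ t, q t • D.w t ∈ trunc M (D.n + 1) :=
            Submodule.sum_mem _ fun t _ => Submodule.smul_mem _ _ (D.w_mem t)
          exact this.1
        · refine mem_G_of_mul_y_pow_mem_G (k := d + 1) ?_
          have h1 : (∑ t, q t • D.w t) c * y ^ (d + 1) =
              ∑ t, ((q t • D.w t c) * y ^ (d + 1) - q t • (D.w t c * y ^ (d + 1))) -
              ∑ t, D.w t c * (z t - q t • (e (D.jw t) * y ^ (d + 1))) := by
            have h0 := congrFun h c
            rw [comb_apply, Pi.zero_apply] at h0
            simp only [mul_sub, Finset.sum_sub_distrib, h0, Finset.sum_apply, Pi.smul_apply,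
              Finset.sum_mul, mul_poly_smul, ← mul_assoc, D.w_mul]
            abel
          rw [h1]
          refine Submodule.sub_mem _ (Submodule.sum_mem _ fun t _ => ?_)
            (Submodule.sum_mem _ fun t _ => ?_)
          · rw [add_comm]
            exact poly_smul_mul_y_pow_sub_mem_G _ _ (mem_GN.1 (D.w_mem t).2 c)
          · rw [add_comm]
            exact mul_mem_G (mem_GN.1 (D.w_mem t).2 c) (hq t)
      obtain ⟨g, hg⟩ := (Submodule.mem_span_range_iff_exists_fun _).1 (D.span_v.symm ▸ hu)
      -- Both sides have the same combination of the independent vectors `w`, hence the leading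
      -- coefficients of `z` are those of the relations weighted by `g`.
      have hql : (fun t => q t • e (D.jw t)) = ∑ s, g s • D.l s := by
        refine sub_eq_zero.1 (eq_zero_of_comb_eq_zero D.w_mul D.hw ?_ (fun t => ?_) ?_)
        · refine Submodule.sub_mem _ (smul_e_mem_cutPi _ _) (Submodule.sum_mem _ fun s _ => ?_)
          exact Submodule.smul_mem _ (aeval (MulOpposite.op x) (g s) : Bᵐᵒᵖ) (D.l_mem s)
        · rw [Pi.sub_apply, Finset.sum_apply]
          exact Submodule.sub_mem _ (smul_e_mem_G _) (Submodule.sum_mem _ fun s _ =>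
            Submodule.smul_mem _ _ (D.l_mem_G s t))
        · rw [map_sub, comb_smul_e D.w_mul, D.comb_sum_l, hg, sub_self]
      have hb0 : (fun s => g s • (e (D.jv s + 1) * y ^ d : B)) ∈
          cutPi B (fun s => D.jv s + 1) := fun s => by
        rw [mul_poly_smul, ← mul_assoc, e_mul_self]
      set b₀ : Fin D.a → B := fun s => g s • (e (D.jv s + 1) * y ^ d) with hb₀
      obtain ⟨b, hb, hbz⟩ := ih (z - comb D.rel b₀) (Submodule.sub_mem _ hz (D.comb_rel_mem _))
        (fun t => by
          have h1 := D.comb_rel_sub_mem_G g d t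
          have h2 : ∑ s, g s • D.l s t = q t • e (D.jw t) := by
            have := congrFun hql t
            rw [Finset.sum_apply] at this
            exact this.symm
          have h3 := poly_smul_mul_y_pow_sub_mem_G (k := 0) (q t) (d + 1) (e_mem_G (B := B) (D.jw t))
          rw [h2] at h1
          have h4 : (z - comb D.rel b₀) t = (z t - q t • (e (D.jw t) * y ^ (d + 1))) -
              ((q t • e (D.jw t)) * y ^ (d + 1) - q t • (e (D.jw t) * y ^ (d + 1))) -
              (comb D.rel b₀ t - (q t • e (D.jw t)) * y ^ (d + 1)) := by
            rw [Pi.sub_apply]; abel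
          rw [h4]
          exact Submodule.sub_mem _ (Submodule.sub_mem _ (hq t) h3) h1)
        (by rw [map_sub, h, D.comb_comb_rel, sub_zero])
      exact ⟨b + b₀, Submodule.add_mem _ hb hb0, by rw [map_add, hbz, sub_add_cancel]⟩

/-- If the leading coefficients of `b` are `g s`, that of its image is the sum of the `g s • D.l s`.
Applying `comb D.w` gives a vanishing combination of the independent vectors `v s`, so all `g s` are
zero. -/
lemma injective_aux (d : ℕ) (b : Fin D.a → B) (hb : b ∈ cutPi B (fun s => D.jv s + 1))
    (hd : ∀ s, b s ∈ G B d) (h : comb D.rel b = 0) : b = 0 := by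
  induction d with
  | zero =>
    ext s
    have := hd s
    rwa [G_zero, Submodule.mem_bot] at this
  | succ d ih =>
    choose g hg using fun s => exists_leading (hb s) (hd s)
    have hl : ∑ s, g s • D.l s = 0 := by
      ext t
      have h1 := D.comb_rel_sub_mem_G g d t
      have h2 : comb D.rel (fun s => g s • (e (D.jv s + 1) * y ^ d)) t ∈ G B (d + 1) := by
        have : comb D.rel (fun s => g s • (e (D.jv s + 1) * y ^ d)) =
            comb D.rel b - comb D.rel (fun s => b s - g s • (e (D.jv s + 1) * y ^ d)) := by
          rw [← map_sub]
          congr 1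
          ext s
          simp
        rw [this, h, zero_sub, Pi.neg_apply, comb_apply]
        refine Submodule.neg_mem _ (Submodule.sum_mem _ fun s _ => mul_mem_G ?_ (hg s))
        exact Submodule.sub_mem _ (mul_y_mem_G (D.l_mem_G s t))
          (G_mono one_le_two (D.r_mem_G s t))
      have h3 := Submodule.sub_mem _ h2 h1
      rw [sub_sub_cancel] at h3
      have h4 := mem_G_of_mul_y_pow_mem_G (n := 0) (k := d + 1) (by rwa [Nat.zero_add])
      rw [G_zero, Submodule.mem_bot] at h4
      rwa [Finset.sum_apply]
    have hg0 : ∀ s, g s = 0 := by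
      refine Fintype.linearIndependent_iff.1 D.hv g ?_
      rw [← D.comb_sum_l, hl, map_zero]
    exact ih fun s => by simpa [hg0 s] using hg s

/-- Stability writes a vector of a higher truncation as `r + v * y` with `r` and `v` one level
lower, so everything descends to the truncation spanned by `w`. -/
lemma comb_w_surjective {u : Fin N → B} (hu : u ∈ M) : ∃ z ∈ cutPi B D.jw, comb D.w z = u := by
  have key : ∀ k, ∀ u ∈ trunc M (D.n + 1 + k), u ∈ (cutPi B D.jw).map (comb D.w) := by
    intro k
    induction k with
    | zero =>
      intro u hu
      obtain ⟨z, hz, -, h⟩ := exists_comb_eq D.w_mul (D.span_w.symm ▸ hu)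
      exact ⟨z, hz, h⟩
    | succ k ih =>
      intro u hu
      obtain ⟨v, hv, hr⟩ := D.stable (D.n + 1 + k) (by omega) u hu
      have := Submodule.add_mem _ (ih _ hr) (Submodule.smul_mem _ (MulOpposite.op (y : B)) (ih _ hv))
      rwa [sub_add_cancel] at this
  obtain ⟨n, hn⟩ := exists_mem_GN u
  exact key n u (trunc_mono (by omega) (⟨hu, hn⟩ : u ∈ trunc M n))

end ResolutionData

/-- Every submodule of a free right `B`-module of finite rank has a resolution of length one by
direct sums of the modules `e_i B`. -/
theorem exists_resolution {N : ℕ} (M : Submodule Bᵐᵒᵖ (Fin N → B)) :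
    ∃ (a b : ℕ) (i : Fin a → ZMod m) (j : Fin b → ZMod m) (f : cutPi B j →ₗ[Bᵐᵒᵖ] M)
      (g : cutPi B i →ₗ[Bᵐᵒᵖ] cutPi B j),
      Function.Surjective f ∧ Function.Injective g ∧ LinearMap.range g = LinearMap.ker f := by
  obtain ⟨D⟩ := nonempty_resolutionData M
  refine ⟨D.a, D.b, fun s => D.jv s + 1, D.jw,
    (comb D.w ∘ₗ Submodule.subtype _).codRestrict M fun z => D.comb_w_mem z,
    (comb D.rel ∘ₗ Submodule.subtype _).codRestrict _ fun z => D.comb_rel_mem z, ?_, ?_, ?_⟩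
  · rintro ⟨u, hu⟩
    obtain ⟨z, hz, h⟩ := D.comb_w_surjective hu
    exact ⟨⟨z, hz⟩, Subtype.ext h⟩
  · refine (injective_iff_map_eq_zero _).2 fun b hb => Subtype.ext ?_
    obtain ⟨n, hn⟩ := exists_mem_GN b.1
    exact D.injective_aux n b.1 b.2 (mem_GN.1 hn) (congrArg Subtype.val hb)
  · refine le_antisymm ?_ fun z hz => ?_
    · rintro _ ⟨b, rfl⟩
      exact Subtype.ext (D.comb_comb_rel b.1)
    · obtain ⟨n, hn⟩ := exists_mem_GN z.1
      obtain ⟨b, hb, h⟩ := D.exact_aux n z.1 z.2 (mem_GN.1 hn) (congrArg Subtype.val hz)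
      exact ⟨⟨b, hb⟩, Subtype.ext h⟩

end CyclicWeyl

/-! ### Modules cut out by idempotents -/

section Cut

variable {A : Type u} (C N : Type u) [Ring A] [Ring C] [AddCommGroup N] [Module A N]
  [Module Cᵐᵒᵖ N] [SMulCommClass A Cᵐᵒᵖ N] (a : A)

/-- The right module `a N` for an idempotent `a`. -/
def cut : Submodule Cᵐᵒᵖ N where
  carrier := {n | a • n = n}
  add_mem' h h' := by
    change _ • _ = _
    rw [smul_add, h, h']
  zero_mem' := smul_zero _
  smul_mem' c n h := by
    change _ • _ = _
    rw [smul_comm, h]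

variable {C N a}

lemma mem_cut {n : N} : n ∈ cut C N a ↔ a • n = n := Iff.rfl

variable (C N) in
/-- The projection onto `a N`. -/
def cutProj (ha : IsIdempotentElem a) : N →ₗ[Cᵐᵒᵖ] cut C N a where
  toFun n := ⟨a • n, by rw [mem_cut, smul_smul, ha.eq]⟩
  map_add' n n' := Subtype.ext (smul_add a n n')
  map_smul' c n := Subtype.ext (smul_comm a c n)

lemma cutProj_coe (ha : IsIdempotentElem a) (n : cut C N a) : cutProj C N ha n = n :=
  Subtype.ext n.2

lemma cut_finite (ha : IsIdempotentElem a) [Module.Finite Cᵐᵒᵖ N] :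
    Module.Finite Cᵐᵒᵖ (cut C N a) :=
  Module.Finite.of_surjective (cutProj C N ha) fun n => ⟨n, cutProj_coe ha n⟩

lemma cut_projective (ha : IsIdempotentElem a) [Module.Projective Cᵐᵒᵖ N] :
    Module.Projective Cᵐᵒᵖ (cut C N a) :=
  Module.Projective.of_split (Submodule.subtype _) (cutProj C N ha)
    (LinearMap.ext fun n => cutProj_coe ha n)

variable (C N) in
/-- The class of `a N` in `K0`. -/
def K0.ofCut (ha : IsIdempotentElem a) [Module.Finite Cᵐᵒᵖ N] [Module.Projective Cᵐᵒᵖ N] : K0 C :=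
  have := cut_finite (C := C) (N := N) ha
  have := cut_projective (C := C) (N := N) ha
  K0.of (cut C N a)

lemma K0.ofCut_eq (ha : IsIdempotentElem a) [Module.Finite Cᵐᵒᵖ N] [Module.Projective Cᵐᵒᵖ N]
    {P : Type u} [AddCommGroup P] [Module Cᵐᵒᵖ P] [Module.Finite Cᵐᵒᵖ P] [Module.Projective Cᵐᵒᵖ P]
    (f : P ≃ₗ[Cᵐᵒᵖ] cut C N a) : K0.of P = K0.ofCut C N ha :=
  have := cut_finite (C := C) (N := N) ha
  have := cut_projective (C := C) (N := N) ha
  K0.of_congr f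

lemma isDualBasis_cut (ha : IsIdempotentElem a) :
    IsDualBasis (P := cut A A a) (fun _ : Unit => ⟨a, ha.eq⟩) (fun _ => Submodule.subtype _) :=
  fun n => by
    rw [Fintype.sum_unique]
    exact Subtype.ext n.2

instance finite_self : Module.Finite Aᵐᵒᵖ A :=
  IsDualBasis.finite (p := fun _ : Unit => (1 : A)) (f := fun _ => LinearMap.id)
    fun n => by simp

instance projective_self : Module.Projective Aᵐᵒᵖ A :=
  IsDualBasis.projective (p := fun _ : Unit => (1 : A)) (f := fun _ => LinearMap.id)
    fun n => by simp

variable (C N) in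
/-- Vectors of length one fixed by an idempotent. -/
def fixedByUnitEquiv : fixedBy C N (fun _ _ : Unit => a) ≃ₗ[Cᵐᵒᵖ] cut C N a where
  toFun v := ⟨v.1 (), (Fintype.sum_unique _).symm.trans (v.2 ())⟩
  invFun n := ⟨fun _ => n.1, fun _ => (Fintype.sum_unique _).trans n.2⟩
  map_add' _ _ := rfl
  map_smul' _ _ := rfl
  left_inv _ := rfl
  right_inv _ := rfl

/-- The module `a A` has a dual basis with one member, whose matrix is `(a)`; the fixed vectors of
this matrix in `N` are `a N`. -/
lemma K0.tensor_ofCut [Module.Finite Cᵐᵒᵖ N] [Module.Projective Cᵐᵒᵖ N] (ha : IsIdempotentElem a) :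
    K0.tensor A C N (K0.ofCut A A ha) = K0.ofCut C N ha := by
  have := cut_finite (C := A) (N := A) ha
  have := cut_projective (C := A) (N := A) ha
  refine (K0.tensor_of A C N (cut A A a)).trans (K0.ofCut_eq ha ?_)
  exact (tensorEquivFixedBy C N (isDualBasis_cut ha)).trans (fixedByUnitEquiv C N)

lemma K0.of_exact {P Q R : Type u} [AddCommGroup P] [Module Aᵐᵒᵖ P] [Module.Finite Aᵐᵒᵖ P]
    [Module.Projective Aᵐᵒᵖ P] [AddCommGroup Q] [Module Aᵐᵒᵖ Q] [Module.Finite Aᵐᵒᵖ Q]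
    [Module.Projective Aᵐᵒᵖ Q] [AddCommGroup R] [Module Aᵐᵒᵖ R] [Module.Finite Aᵐᵒᵖ R]
    [Module.Projective Aᵐᵒᵖ R] (g : P →ₗ[Aᵐᵒᵖ] Q) (f : Q →ₗ[Aᵐᵒᵖ] R) (hg : Function.Injective g)
    (hf : Function.Surjective f) (h : LinearMap.range g = LinearMap.ker f) :
    (K0.of Q : K0 A) = K0.of R + K0.of P := by
  obtain ⟨s, hs⟩ := Module.projective_lifting_property f LinearMap.id hf
  have hs' : ∀ r, f (s r) = r := fun r => LinearMap.congr_fun hs r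
  refine K0.of_eq_add (LinearEquiv.ofBijective (s.coprod g) ⟨?_, fun q => ?_⟩).symm
  · refine (injective_iff_map_eq_zero _).2 ?_
    rintro ⟨r, p⟩ hrp
    rw [LinearMap.coprod_apply] at hrp
    have hp : f (g p) = 0 := LinearMap.mem_ker.1 (h ▸ LinearMap.mem_range_self g p)
    have hr : r = 0 := by
      have := congrArg f hrp
      rwa [map_add, hs', hp, add_zero, map_zero] at this
    subst hr
    rw [map_zero, zero_add] at hrp
    exact Prod.ext rfl (hg (hrp.trans (map_zero g).symm))
  · have : q - s (f q) ∈ LinearMap.range g := by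
      rw [h, LinearMap.mem_ker, map_sub, hs', sub_self]
    obtain ⟨p, hp⟩ := this
    exact ⟨(f q, p), by rw [LinearMap.coprod_apply, hp]; abel⟩

end Cut

namespace CyclicWeyl

variable {m : ℕ} [NeZero m] {lam : ZMod m → ℂ} {B : Type u} [Ring B] [Algebra ℂ B]
  [CyclicWeyl B m lam]

lemma isIdempotentElem_e (i : ZMod m) : IsIdempotentElem (e i : B) := e_mul_self i

variable (B) in
/-- The module `⊕ e_{j(t)} B` as a product. -/
def cutPiEquiv {b : ℕ} (j : Fin b → ZMod m) :
    cutPi B j ≃ₗ[Bᵐᵒᵖ] (∀ t, cut B B (e (j t) : B)) where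
  toFun z t := ⟨z.1 t, z.2 t⟩
  invFun z := ⟨fun t => z t, fun t => (z t).2⟩
  map_add' _ _ := rfl
  map_smul' _ _ := rfl
  left_inv _ := rfl
  right_inv _ := rfl

instance cut_e_finite (i : ZMod m) : Module.Finite Bᵐᵒᵖ (cut B B (e i : B)) :=
  cut_finite (isIdempotentElem_e i)

instance cut_e_projective (i : ZMod m) : Module.Projective Bᵐᵒᵖ (cut B B (e i : B)) :=
  cut_projective (isIdempotentElem_e i)

instance cutPi_finite {b : ℕ} (j : Fin b → ZMod m) : Module.Finite Bᵐᵒᵖ (cutPi B j) :=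
  Module.Finite.equiv (cutPiEquiv B j).symm

instance cutPi_projective {b : ℕ} (j : Fin b → ZMod m) : Module.Projective Bᵐᵒᵖ (cutPi B j) :=
  Module.Projective.of_equiv (cutPiEquiv B j).symm

lemma of_cutPi_mem {b : ℕ} (j : Fin b → ZMod m) :
    K0.of (cutPi B j) ∈ AddSubgroup.closure
      (Set.range fun i : ZMod m => K0.ofCut B B (isIdempotentElem_e (B := B) i)) := by
  rw [K0.of_congr (cutPiEquiv B j), K0.of_pi]
  exact AddSubgroup.sum_mem _ fun t _ => AddSubgroup.subset_closure ⟨j t, rfl⟩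

/-- `K0 B` is generated by the classes of the modules `e_i B`. -/
theorem K0_eq_closure (ξ : K0 B) : ξ ∈ AddSubgroup.closure
    (Set.range fun i : ZMod m => K0.ofCut B B (isIdempotentElem_e (B := B) i)) := by
  refine K0.mem_of_forall _ (fun P => ?_) ξ
  obtain ⟨n, p, φ, h⟩ := exists_isDualBasis B P.carrier
  -- The dual basis embeds `P` into a free module. The resolution of the image splits because `P` is
  -- projective, and it writes `[P]` as a difference of sums of the `[e_i B]`.
  let ι : P.carrier →ₗ[Bᵐᵒᵖ] (Fin n → B) := LinearMap.pi φ
  have hι : Function.Injective ι := fun v w hvw => by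
    rw [← h v, ← h w]
    exact Finset.sum_congr rfl fun i _ => by rw [show φ i v = φ i w from congrFun hvw i]
  obtain ⟨a, b, i, j, f, g, hf, hg, hfg⟩ := exists_resolution (LinearMap.range ι)
  let E := LinearEquiv.ofInjective ι hι
  have := Module.Finite.equiv E
  have := Module.Projective.of_equiv E
  have key := K0.of_exact g f hg hf hfg
  rw [K0.of_congr E, eq_sub_of_add_eq key.symm]
  exact AddSubgroup.sub_mem _ (of_cutPi_mem j) (of_cutPi_mem i)

end CyclicWeyl

/-! ### Right Noetherianity of `B` -/

section Noetherian

variable {m : ℕ} [NeZero m] {lam : ZMod m → ℂ} {B : Type u} [Ring B] [Algebra ℂ B]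

lemma CyclicWeyl.isNoetherian_pi (D : CyclicWeyl B m lam) (N : ℕ) :
    IsNoetherian Bᵐᵒᵖ (Fin N → B) := by
  refine ⟨fun M => ?_⟩
  obtain ⟨a, b, i, j, f, g, hf, -, -⟩ := exists_resolution M
  exact Module.Finite.iff_fg.1 (Module.Finite.of_surjective f hf)

lemma CyclicWeyl.isNoetherian_self (D : CyclicWeyl B m lam) : IsNoetherian Bᵐᵒᵖ B := by
  have := D.isNoetherian_pi 1
  exact isNoetherian_of_surjective (LinearMap.proj (R := Bᵐᵒᵖ) (φ := fun _ : Fin 1 => B) 0)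
    (LinearMap.range_eq_top.2 fun b => ⟨fun _ => b, rfl⟩)

end Noetherian

lemma sum_range_zmod {m : ℕ} [NeZero m] {M : Type*} [AddCommMonoid M] (f : ZMod m → M) :
    ∑ k ∈ Finset.range m, f k = ∑ i, f i :=
  Finset.sum_nbij' (fun k => (k : ZMod m)) ZMod.val (by simp)
    (fun i _ => Finset.mem_range.2 (ZMod.val_lt i))
    (fun k hk => ZMod.val_cast_of_lt (Finset.mem_range.1 hk)) (fun i _ => ZMod.natCast_zmod_val i)
    (fun _ _ => rfl)

/-- The map `d ↦ σ(t d) - t d` on `ℂ[t]^m`. -/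
def traceRel {m : ℕ} (lam : ZMod m → ℂ) : (ZMod m → ℂ[X]) →ₗ[ℂ] (ZMod m → ℂ[X]) :=
  ((shift lam).toLinearMap - LinearMap.id) ∘ₗ LinearMap.mulLeft ℂ diagX

lemma traceRel_apply {m : ℕ} (lam : ZMod m → ℂ) (d : ZMod m → ℂ[X]) :
    traceRel lam d = shift lam (diagX * d) - diagX * d := rfl

namespace CyclicWeyl

variable {m : ℕ} [NeZero m] {lam : ZMod m → ℂ} {B : Type u} [Ring B] [Algebra ℂ B]
  [CyclicWeyl B m lam]

/-! ### Zero divisors -/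

lemma exists_lc_ne_zero {b : B} (hb : b ≠ 0) : ∃ n, b ∈ G B (n + 1) ∧ lc n b ≠ 0 := by
  classical
  have h := exists_mem_G b
  have h1 := Nat.find_spec h
  cases hn : Nat.find h with
  | zero => rw [hn, G_zero, Submodule.mem_bot] at h1; exact absurd h1 hb
  | succ n =>
    rw [hn] at h1
    exact ⟨n, h1, fun h0 => Nat.find_min h (m := n) (by omega) (mem_G_of_lc_eq_zero h1 h0)⟩

lemma mul_y_pow_mem_G {n : ℕ} {b : B} (hb : b ∈ G B n) (d : ℕ) : b * y ^ d ∈ G B (n + d) := by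
  induction d with
  | zero => simpa
  | succ d ih => rw [pow_succ, ← mul_assoc]; exact mul_y_mem_G ih

lemma lc_mul_y_pow {n : ℕ} {b : B} (hb : b ∈ G B (n + 1)) (d : ℕ) :
    lc (n + d) (b * y ^ d) = lc n b := by
  induction d with
  | zero => simp
  | succ d ih =>
    rw [pow_succ, ← mul_assoc, ← add_assoc, lc_mul_y, ih]
    have := mul_y_pow_mem_G hb d
    rwa [add_right_comm] at this

/-- Because `e i` sits between the factors, the leading term of `c` is `e_i y^d p(x)` with one
nonzero polynomial `p`. The leading coefficient of the product is then `p` times that of `b`. -/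
lemma mul_ne_zero_of_e {i : ZMod m} {b c : B} (hb : b * e i = b) (hc : e i * c = c) (hb0 : b ≠ 0)
    (hc0 : c ≠ 0) : b * c ≠ 0 := by
  obtain ⟨n, hbn, hbl⟩ := exists_lc_ne_zero hb0
  obtain ⟨d, hcd, hcl⟩ := exists_lc_ne_zero hc0
  obtain ⟨p, hp⟩ := exists_leading hc hcd
  have hp0 : p ≠ 0 := by
    rintro rfl
    rw [zero_smul, sub_zero] at hp
    exact hcl (lc_eq_zero hp le_rfl)
  intro h
  have h1 : b * c = b * (c - p • (e i * y ^ d)) + p • (b * y ^ d) := by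
    rw [mul_sub, mul_poly_smul, ← mul_assoc, hb]; abel
  have h2 : b * (c - p • (e i * y ^ d)) ∈ G B (n + d) := by
    rw [add_comm]; exact mul_mem_G hbn hp
  have h3 := congrArg (lc (n + d)) h1
  rw [h, map_zero, map_add, lc_eq_zero h2 le_rfl, zero_add, map_smul, lc_mul_y_pow hbn] at h3
  obtain ⟨j, hj⟩ := Function.ne_iff.1 hbl
  have := congrFun h3 j
  rw [Pi.zero_apply, Pi.smul_apply, smul_eq_mul] at this
  exact mul_ne_zero hp0 hj this.symm

/-! ### The trace -/

variable (lam) in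
/-- The target of the trace. -/
abbrev TraceSpace : Type := (ZMod m → ℂ[X]) ⧸ LinearMap.range (traceRel lam)

/-- The trace on `B` given by the constant term of the normal form. -/
def trace : B →ₗ[ℂ] TraceSpace lam :=
  (LinearMap.range (traceRel lam)).mkQ ∘ₗ LinearMap.proj 0 ∘ₗ nf

/-- The coefficient at index `-1` comes from monomials with at least one `y`, and the leftmost `y =
t x⁻¹` contributes a factor `t`. -/
lemma exists_nf_neg_one (b : B) : ∃ d : ZMod m → ℂ[X], nf b (-1) = diagX * d := by
  have hb : b ∈ Submodule.span ℂ[X] (Set.range (gen B)) := by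
    obtain ⟨n, hn⟩ := exists_mem_G b
    exact Submodule.span_mono (Set.image_subset_range _ _) hn
  induction hb using Submodule.closure_induction with
  | zero => exact ⟨0, by simp⟩
  | add b c _ _ hb hc =>
    obtain ⟨d, hd⟩ := hb
    obtain ⟨d', hd'⟩ := hc
    exact ⟨d + d', by rw [map_add, Pi.add_apply, hd, hd', mul_add]⟩
  | smul_mem p b hb =>
    obtain ⟨⟨j, k⟩, rfl⟩ := hb
    cases k with
    | zero =>
      refine ⟨0, funext fun i => ?_⟩
      have := nf_poly_smul (B := B) p j 0 (-1) i
      simpa [gen, coeffInt] using this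
    | succ k =>
      refine ⟨fun i => if j = i then coeffInt p (k : ℤ) • (shift lam).symm (ypow lam k) i else 0,
        funext fun i => ?_⟩
      simp only [gen, nf_poly_smul p j (k + 1), Pi.mul_apply]
      split_ifs
      · rw [show (-1 + ((k + 1 : ℕ) : ℤ)) = k by push_cast; ring, mul_smul_comm]; rfl
      · simp

/-- It suffices to take `a` a generator. For `x` the constant term of the commutator is `σ(c) - c`
with `c = t d` the coefficient of `b` at index `-1`; for `y` it is the value of `traceRel` at `-σ⁻¹`
of the coefficient at index `1`; for `e i` it is zero. -/
lemma trace_mul_comm (a b : B) : trace (a * b) = trace (b * a) := by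
  have ha : a ∈ Algebra.adjoin ℂ ({x, y} ∪ Set.range e : Set B) :=
    adjoin_eq (B := B) ▸ Algebra.mem_top
  have key : ∀ d d' : ZMod m → ℂ[X], (∃ c, d - d' = traceRel lam c) →
      (LinearMap.range (traceRel lam)).mkQ d = (LinearMap.range (traceRel lam)).mkQ d' := by
    rintro d d' ⟨c, hc⟩
    exact (Submodule.Quotient.eq _).2 ⟨c, hc.symm⟩
  induction ha using Algebra.adjoin_induction generalizing b with
  | mem a ha =>
    rcases ha with (rfl | rfl) | ⟨i, rfl⟩
    · refine key _ _ ?_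
      obtain ⟨d, hd⟩ := exists_nf_neg_one b
      refine ⟨d, ?_⟩
      change nf _ 0 - nf _ 0 = _
      rw [nf_x_mul, nf_mul_x, traceRel_apply, zero_sub,
        hd]
    · refine key _ _ ⟨-(shift lam).symm (nf b 1), ?_⟩
      change nf _ 0 - nf _ 0 = _
      rw [nf_y_mul, nf_mul_y, traceRel_apply, zero_add,
        zpow_one]
      simp only [mul_neg, map_neg, map_mul, AlgEquiv.apply_symm_apply]
      ring
    · refine key _ _ ⟨0, ?_⟩
      change nf _ 0 - nf _ 0 = _
      rw [nf_e_mul, nf_mul_e, map_zero, zpow_zero]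
      change _ * _ - _ * Pi.single i 1 = _
      ring
  | algebraMap r => rw [Algebra.commutes]
  | add a a' _ _ h h' => rw [add_mul, mul_add, map_add, map_add, h, h']
  | mul a a' _ _ h h' => rw [mul_assoc, h, mul_assoc, h', mul_assoc]

lemma trace_e (i : ZMod m) :
    trace (e i : B) = (LinearMap.range (traceRel lam)).mkQ (Pi.single i 1) := by
  have : nf (e i : B) 0 = Pi.single i 1 := by
    rw [nf_apply, rho_e, opD_single]; simp
  rw [← this]
  rfl

end CyclicWeyl

open CyclicWeyl

/-! ### Constants in the range of `traceRel` -/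

section

variable {m : ℕ} [NeZero m] {lam : ZMod m → ℂ}

/-- A periodic polynomial takes the value `p.eval 0` at all multiples of the period, hence
infinitely often. -/
lemma eq_C_of_taylor_eq {c : ℂ} (hc : c ≠ 0) {p : ℂ[X]} (h : taylor c p = p) :
    p = C (p.eval 0) := by
  have h1 : ∀ n : ℕ, p.eval (n * c) = p.eval 0 := by
    intro n
    induction n with
    | zero => simp
    | succ n ih => rw [← ih]; conv_rhs => rw [← h, taylor_eval]
                   congr 1; push_cast; ring
  refine Polynomial.eq_of_infinite_eval_eq _ _
    (Set.infinite_of_injective_forall_mem (f := fun n : ℕ => (n * c : ℂ)) ?_ fun n => ?_)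
  · intro a b hab
    exact_mod_cast mul_right_cancel₀ hc hab
  · simp [h1 n]

/-- The only constants that are killed by all traces are the multiples of `λ`. -/
lemma exists_eq_mul_lam (hlam : ∑ i, lam i ≠ 0) {n : ZMod m → ℂ} {q : ZMod m → ℂ[X]}
    (h : traceRel lam q = fun i => C (n i)) : ∃ c, ∀ i, n i = c * lam i := by
  -- Differentiation kills the constants `n i`, so consecutive `g i` differ only by a translation.
  set g : ZMod m → ℂ[X] := fun i => derivative (X * q i) with hg
  have hq : ∀ i, taylor (lam (i + 1)) (X * q i) - X * q (i + 1) = C (n (i + 1)) := by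
    intro i
    have := congrFun h (i + 1)
    rw [traceRel_apply] at this
    simpa [shift_apply, diagX] using this
  have hstep : ∀ i, g (i + 1) = taylor (lam (i + 1)) (g i) := by
    intro i
    have := congrArg derivative (hq i)
    rw [derivative_sub, derivative_C, sub_eq_zero] at this
    rw [hg]
    simp only
    rw [← this]
    simp [taylor_apply, derivative_comp]
  have hiter : ∀ k : ℕ, g k = taylor (∑ l ∈ Finset.range k, lam (l + 1)) (g 0) := by
    intro k
    induction k with
    | zero => simp
    | succ k ih =>
      rw [Nat.cast_succ, hstep, ih, taylor_taylor, Finset.sum_range_succ, add_comm]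
  have hsum : ∑ l ∈ Finset.range m, lam (l + 1) = ∑ i, lam i := by
    rw [sum_range_zmod fun i => lam (i + 1)]
    exact Fintype.sum_equiv (Equiv.addRight 1) _ _ fun _ => rfl
  -- Once around the cycle, `g 0` is translated by the nonzero sum of all `λ_i` and returns to
  -- itself.
  have h0 : g 0 = C ((g 0).eval 0) := by
    refine eq_C_of_taylor_eq hlam ?_
    rw [← hsum, ← hiter m, ZMod.natCast_self]
  set c := (g 0).eval 0
  have hconst : ∀ i, g i = C c := by
    intro i
    rw [← ZMod.natCast_zmod_val i, hiter, h0, taylor_C]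
  -- The two sides have equal derivatives and both vanish at zero. The defining equation then reads
  -- `n i = c (t + λ_i) - c t`.
  have hlin : ∀ i, X * q i = C c * X := by
    intro i
    have h1 : derivative (X * q i - C c * X) = 0 := by
      rw [derivative_sub, show derivative (X * q i) = C c from hconst i]
      simp
    have h2 := derivative_eq_zero.1 h1
    rw [natDegree_eq_zero] at h2
    obtain ⟨a, ha⟩ := h2
    have : a = 0 := by
      have := congrArg (eval 0) ha
      simpa using this
    rw [this, C_0] at ha
    exact sub_eq_zero.1 ha.symm
  refine ⟨c, fun i => ?_⟩
  have := hq (i - 1)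
  rw [sub_add_cancel, hlin, hlin] at this
  apply C_injective
  rw [← this]
  simp [mul_add]

end

namespace CyclicWeyl

variable {m : ℕ} [NeZero m] {lam : ZMod m → ℂ} {B : Type u} [Ring B] [Algebra ℂ B]
  [CyclicWeyl B m lam]

lemma eq_zero_of_trace_eq_zero (hlam : ∑ i, lam i ≠ 0) {n : ZMod m → ℤ} (hn : ∑ i, n i = 0)
    (h : ∑ i, n i • trace (e i : B) = 0) : n = 0 := by
  have h1 : (LinearMap.range (traceRel lam)).mkQ (fun i => C (n i : ℂ)) = 0 := by
    rw [← h]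
    simp only [trace_e, ← map_zsmul, ← map_sum]
    congr 1
    ext1 i
    simp [Finset.sum_apply, Pi.single_apply]
  rw [Submodule.mkQ_apply, Submodule.Quotient.mk_eq_zero] at h1
  obtain ⟨q, hq⟩ := h1
  obtain ⟨c, hc⟩ := exists_eq_mul_lam hlam hq
  have h2 : c * ∑ i, lam i = 0 := by
    rw [Finset.mul_sum, ← Finset.sum_congr rfl fun i _ => hc i]
    exact_mod_cast hn
  have h3 := (mul_eq_zero.1 h2).resolve_right hlam
  ext i
  have := hc i
  rw [h3, zero_mul] at this
  exact_mod_cast this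

end CyclicWeyl

namespace CyclicWeyl

variable {m : ℕ} [NeZero m] {lam : ZMod m → ℂ} {B : Type u} [Ring B] [Algebra ℂ B]
  [CyclicWeyl B m lam]

/-! ### The ideal generated by `e_0` -/

variable (B) in
/-- The two-sided ideal `B e_0 B`. -/
def ideal0 : Submodule ℂ B := Submodule.span ℂ {z | ∃ a b : B, z = a * e 0 * b}

lemma mul_mul_mem_ideal0 (a b : B) {z : B} (hz : z ∈ ideal0 B) : a * z * b ∈ ideal0 B := by
  induction hz using Submodule.span_induction with
  | mem z hz =>
    obtain ⟨c, d, rfl⟩ := hz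
    exact Submodule.subset_span ⟨a * c, d * b, by simp only [mul_assoc]⟩
  | zero => simp
  | add z z' _ _ h h' => rw [mul_add, add_mul]; exact Submodule.add_mem _ h h'
  | smul c z _ h => rw [mul_smul_comm, smul_mul_assoc]; exact Submodule.smul_mem _ _ h

lemma mul_mem_ideal0 (a : B) {z : B} (hz : z ∈ ideal0 B) : a * z ∈ ideal0 B := by
  simpa using mul_mul_mem_ideal0 a 1 hz

/-- The polynomials `p` such that `p(y x) e_j` lies in `B e_0 B`. -/
def polyIdeal (B : Type u) [Ring B] [Algebra ℂ B] [CyclicWeyl B m lam] (j : ZMod m) :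
    Ideal ℂ[X] where
  carrier := {p | aeval (y * x : B) p * e j ∈ ideal0 B}
  add_mem' h h' := by
    change _ ∈ ideal0 B
    rw [map_add, add_mul]; exact Submodule.add_mem _ h h'
  zero_mem' := by
    change _ ∈ ideal0 B
    simp
  smul_mem' p q h := by
    change _ ∈ ideal0 B
    rw [smul_eq_mul, map_mul, mul_assoc]; exact mul_mem_ideal0 _ h

lemma mem_polyIdeal {j : ZMod m} {p : ℂ[X]} :
    p ∈ polyIdeal B j ↔ aeval (y * x : B) p * e j ∈ ideal0 B := Iff.rfl

lemma aeval_comm (a b : B) (p : ℂ[X]) : a * aeval (b * a) p * b = aeval (a * b) (X * p) := by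
  induction p using Polynomial.induction_on' with
  | add p q hp hq => rw [map_add, mul_add, add_mul, hp, hq, mul_add, map_add]
  | monomial n c =>
    rw [aeval_monomial, X_mul_monomial, aeval_monomial, ← mul_assoc, ← Algebra.commutes, mul_assoc,
      mul_assoc]
    congr 1
    induction n with
    | zero => simp
    | succ n ih => rw [pow_succ', pow_succ', ← ih]; simp only [mul_assoc]

lemma x_mul_y_mul_e (j : ZMod m) : (x * y * e j : B) = y * x * e j + lam j • e j := by
  have h : (∑ i, lam i • e i : B) * e j = lam j • e j := by
    rw [Finset.sum_mul, Finset.sum_eq_single j]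
    · rw [smul_mul_assoc, e_mul_self]
    · intro i _ hi; rw [smul_mul_assoc, e_mul_ne hi, smul_zero]
    · simp
  rw [← h, ← comm]; noncomm_ring

lemma x_mul_y_mul_e' (j : ZMod m) : (x * y * e j : B) = e j * (x * y) := by
  rw [mul_assoc, ← sub_add_cancel j 1, y_mul_e, ← mul_assoc, x_mul_e, mul_assoc]

/-- On `e j` the elements `x y` and `y x` differ by the scalar `lam j`. -/
lemma aeval_x_mul_y_mul_e (j : ZMod m) (p : ℂ[X]) :
    (aeval (x * y) p * e j : B) = aeval (y * x) (taylor (lam j) p) * e j := by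
  induction p using Polynomial.induction_on' with
  | add p q hp hq => rw [map_add, add_mul, hp, hq, map_add, map_add, add_mul]
  | monomial n c =>
    rw [aeval_monomial, taylor_monomial, map_mul, aeval_C, mul_assoc, mul_assoc]
    congr 1
    induction n with
    | zero => simp
    | succ n ih =>
      rw [pow_succ, mul_assoc, x_mul_y_mul_e', ← mul_assoc, ih, pow_succ, map_mul, mul_assoc,
        mul_assoc, ← x_mul_y_mul_e', x_mul_y_mul_e, map_add, aeval_X, aeval_C, add_mul,
        Algebra.smul_def]

/-- Multiplying `p(yx) e_j` by `x` on the left and `y` on the right gives `(xy) p(xy) e_{j+1}`,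
which is then rewritten in terms of `yx`. The companion lemma exchanges the roles of `x` and `y`. -/
lemma polyIdeal_succ {j : ZMod m} {p : ℂ[X]} (hp : p ∈ polyIdeal B j) :
    taylor (lam (j + 1)) (X * p) ∈ polyIdeal B (j + 1) := by
  have h := mul_mul_mem_ideal0 x y hp
  rw [mem_polyIdeal, ← aeval_x_mul_y_mul_e, ← aeval_comm]
  have h1 : (x * (aeval (y * x) p * e j) * y : B) = x * aeval (y * x) p * y * e (j + 1) := by
    simp only [mul_assoc, y_mul_e]
  rwa [h1] at h

lemma polyIdeal_pred {j : ZMod m} {p : ℂ[X]} (hp : p ∈ polyIdeal B (j + 1)) :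
    X * taylor (-lam (j + 1)) p ∈ polyIdeal B j := by
  have h := mul_mul_mem_ideal0 y x hp
  have h0 : p = taylor (lam (j + 1)) (taylor (-lam (j + 1)) p) := by simp [taylor_taylor]
  rw [mem_polyIdeal, ← aeval_comm]
  rw [h0, ← aeval_x_mul_y_mul_e] at h
  have h1 : (y * (aeval (x * y) (taylor (-lam (j + 1)) p) * e (j + 1)) * x : B) =
      y * aeval (x * y) (taylor (-lam (j + 1)) p) * x * e j := by
    simp only [mul_assoc, x_mul_e]
  rwa [h1] at h

lemma polyIdeal_zero : (1 : ℂ[X]) ∈ polyIdeal B 0 := by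
  rw [mem_polyIdeal]
  exact Submodule.subset_span ⟨1, 1, by simp⟩

/-- `a` is a common zero of the polynomials in `polyIdeal j`. -/
def IsCommonZero (B : Type u) [Ring B] [Algebra ℂ B] [CyclicWeyl B m lam] (j : ZMod m) (a : ℂ) :
    Prop :=
  ∀ p ∈ polyIdeal B j, p.eval a = 0

lemma not_isCommonZero_zero (a : ℂ) : ¬ IsCommonZero B 0 a := fun h => by
  simpa using h 1 polyIdeal_zero

lemma IsCommonZero.pred {j : ZMod m} {a : ℂ} (h : IsCommonZero B (j + 1) a)
    (h0 : a + lam (j + 1) ≠ 0) : IsCommonZero B j (a + lam (j + 1)) := fun p hp => by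
  have := h _ (polyIdeal_succ hp)
  rw [taylor_eval, eval_mul, eval_X] at this
  exact (mul_eq_zero.1 this).resolve_left h0

lemma IsCommonZero.succ {j : ZMod m} {a : ℂ} (h : IsCommonZero B j a) (h0 : a ≠ 0) :
    IsCommonZero B (j + 1) (a - lam (j + 1)) := fun p hp => by
  have := h _ (polyIdeal_pred hp)
  rw [eval_mul, eval_X, taylor_eval] at this
  simpa [sub_eq_add_neg] using (mul_eq_zero.1 this).resolve_left h0

/-- A common zero moves down from vertex `j` by adding successive `lam s`. It cannot reach vertex
`0`, where `1` lies in the ideal, so some partial sum must vanish. -/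
lemma IsCommonZero.exists_sum_Icc (j : ℕ) {a : ℂ} (h : IsCommonZero B (j : ZMod m) a) :
    ∃ i, 1 ≤ i ∧ i ≤ j ∧ a + ∑ s ∈ Finset.Icc i j, lam s = 0 := by
  induction j generalizing a with
  | zero => rw [Nat.cast_zero] at h; exact absurd h (not_isCommonZero_zero a)
  | succ j ih =>
    rw [Nat.cast_succ] at h
    by_cases h0 : a + lam (j + 1) = 0
    · exact ⟨j + 1, by omega, le_rfl, by simpa using h0⟩
    · obtain ⟨i, hi, hij, hs⟩ := ih (h.pred h0)
      refine ⟨i, hi, by omega, ?_⟩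
      rw [Finset.sum_Icc_succ_top (by omega), ← hs, Nat.cast_succ]
      ring

/-- The same movement in the upward direction: it has to stop before vertex `m`, which is vertex `0`
again. -/
lemma IsCommonZero.exists_sum_Ioc (l : ℕ) {j : ℕ} (hj : j + l = m) {a : ℂ}
    (h : IsCommonZero B (j : ZMod m) a) :
    ∃ i, j ≤ i ∧ i < m ∧ a = ∑ s ∈ Finset.Ioc j i, lam s := by
  induction l generalizing a j with
  | zero =>
    obtain rfl : j = m := by omega
    rw [ZMod.natCast_self] at h
    exact absurd h (not_isCommonZero_zero a)
  | succ l ih =>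
    by_cases h0 : a = 0
    · exact ⟨j, le_rfl, by omega, by simpa using h0⟩
    · have h1 := h.succ h0
      rw [← Nat.cast_succ] at h1
      obtain ⟨i, hi, him, hs⟩ := ih (by omega) h1
      refine ⟨i, by omega, him, ?_⟩
      rw [← Finset.sum_Ioc_consecutive _ (Nat.le_succ j) hi, Nat.Ioc_succ_singleton,
        Finset.sum_singleton, ← hs]
      simp

lemma not_isCommonZero (hlam : ∀ i i' : ℕ, 1 ≤ i → i ≤ i' → i' < m →
    ∑ s ∈ Finset.Icc i i', lam s ≠ 0) (j : ZMod m) (a : ℂ) : ¬ IsCommonZero B j a := by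
  intro h
  rw [← ZMod.natCast_zmod_val j] at h
  obtain ⟨i, hi, hij, h1⟩ := h.exists_sum_Icc
  -- Eliminating `a` between the two conclusions gives a vanishing sum over the interval from `i` to
  -- `i'`, which avoids vertex `0`.
  obtain ⟨i', hi', him, h2⟩ := h.exists_sum_Ioc (m - j.val) (by have := ZMod.val_lt j; omega)
  refine hlam i i' hi (hij.trans hi') him ?_
  obtain ⟨k, rfl⟩ : ∃ k, i = k + 1 := ⟨i - 1, by omega⟩
  rw [Finset.Icc_add_one_left_eq_Ioc] at h1 ⊢
  rw [← Finset.sum_Ioc_consecutive _ (by omega : k ≤ j.val) hi', ← h2, ← h1, add_comm]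

lemma e_mem_ideal0 (hlam : ∀ i i' : ℕ, 1 ≤ i → i ≤ i' → i' < m →
    ∑ s ∈ Finset.Icc i i', lam s ≠ 0) (j : ZMod m) : (e j : B) ∈ ideal0 B := by
  have htop : (1 : ℂ[X]) ∈ polyIdeal B j := by
    obtain ⟨g, hg⟩ := IsPrincipalIdealRing.principal (polyIdeal B j)
    rw [Ideal.submodule_span_eq] at hg
    by_contra h1
    -- This covers `g = 0` as well, whose degree is `⊥`; any point is then a root.
    have hd : g.degree ≠ 0 := by
      intro hd
      refine h1 ((Ideal.eq_top_iff_one _).1 ?_)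
      rw [hg, Ideal.span_singleton_eq_top]
      exact isUnit_iff_degree_eq_zero.2 hd
    obtain ⟨a, ha⟩ := IsAlgClosed.exists_root g hd
    refine not_isCommonZero (B := B) hlam j a fun p hp => ?_
    rw [hg, Ideal.mem_span_singleton] at hp
    obtain ⟨q, rfl⟩ := hp
    rw [eval_mul, ha.eq_zero, zero_mul]
  simpa using mem_polyIdeal.1 htop

/-- For generic parameters, `B e_0 B = B`. -/
lemma exists_sum_eq_one (hlam : ∀ i i' : ℕ, 1 ≤ i → i ≤ i' → i' < m →
    ∑ s ∈ Finset.Icc i i', lam s ≠ 0) :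
    ∃ (n : ℕ) (a b : Fin n → B), ∑ k, a k * e 0 * b k = 1 := by
  have key : ∀ z ∈ ideal0 B, ∃ (n : ℕ) (a b : Fin n → B), ∑ k, a k * e 0 * b k = z := by
    intro z hz
    induction hz using Submodule.span_induction with
    | mem z hz =>
      obtain ⟨a, b, rfl⟩ := hz
      exact ⟨1, fun _ => a, fun _ => b, by simp⟩
    | zero => exact ⟨0, 0, 0, by simp⟩
    | add z z' _ _ h h' =>
      obtain ⟨n, a, b, rfl⟩ := h
      obtain ⟨n', a', b', rfl⟩ := h'
      exact ⟨n + n', Fin.append a a', Fin.append b b', by simp [Fin.sum_univ_add]⟩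
    | smul c z _ h =>
      obtain ⟨n, a, b, rfl⟩ := h
      exact ⟨n, fun k => c • a k, b, by simp [Finset.smul_sum]⟩
  refine key 1 ?_
  rw [← sum_e]
  exact Submodule.sum_mem _ fun j _ => e_mem_ideal0 hlam j

end CyclicWeyl

/-! ### Rank over a Noetherian domain -/

section Rank

variable {R : Type u} [Ring R] [IsDomain R]
  {M N : Type v} [AddCommGroup M] [Module R M] [AddCommGroup N] [Module R N]

/-- A maximal linearly independent family. -/
def IsMaxIndep {n : ℕ} (v : Fin n → M) : Prop :=
  LinearIndependent R v ∧ ∀ w : M, ∃ r : R, r ≠ 0 ∧ r • w ∈ Submodule.span R (Set.range v)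

/-- Nonzero multiples move any independent family into the free module spanned by `v`. Independence
is preserved because `R` has no zero divisors, so the family has at most `n` members. -/
lemma rank_eq_of_isMaxIndep [StrongRankCondition R] {n : ℕ} {v : Fin n → M} (hv : IsMaxIndep (R := R) v) :
    Module.rank R M = n := by
  refine le_antisymm ?_ (by simpa using hv.1.cardinal_lift_le_rank)
  rw [Module.rank_def]
  refine ciSup_le' fun ⟨s, hs⟩ => ?_
  choose r hr0 hr using hv.2
  let L := Submodule.span R (Set.range v)
  have hli : LinearIndependent R fun i : s => (⟨r i • (i : M), hr i⟩ : L) := by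
    refine LinearIndependent.of_comp L.subtype ?_
    have hs' : LinearIndependent R fun i : s => (i : M) := hs
    rw [linearIndependent_iff'] at hs' ⊢
    intro t g hg i hi
    have := hs' t (fun i => g i * r i) (by simpa [mul_smul] using hg) i hi
    exact (mul_eq_zero.1 this).resolve_right (hr0 _)
  have h1 := hli.cardinal_le_rank
  have h2 : Module.rank R L = n := by
    rw [rank_eq_card_basis (Module.Basis.span hv.1), Fintype.card_fin]
  exact h1.trans h2.le

lemma exists_isMaxIndep {n : ℕ} (h : Module.rank R M = n) :
    ∃ v : Fin n → M, IsMaxIndep (R := R) v := by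
  obtain ⟨s, hs, hli⟩ := Module.le_rank_iff_exists_finset.1 h.ge
  let v : Fin n → M := fun i => (s.equivFinOfCardEq hs).symm i
  have hv : LinearIndependent R v := hli.comp _ (s.equivFinOfCardEq hs).symm.injective
  refine ⟨v, hv, fun w => ?_⟩
  by_contra! hw
  have : LinearIndependent R (Fin.cons w v : Fin (n + 1) → M) := by
    refine hv.finCons' _ _ fun c z hz hcz => ?_
    by_contra hc
    refine hw c hc ?_
    rw [eq_neg_of_add_eq_zero_left hcz]
    exact Submodule.neg_mem _ hz
  have h1 := this.cardinal_lift_le_rank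
  rw [h] at h1
  simp at h1

lemma rank_prod_of_isDomain [StrongRankCondition R] {a b : ℕ} (hM : Module.rank R M = a) (hN : Module.rank R N = b) :
    Module.rank R (M × N) = (a + b : ℕ) := by
  obtain ⟨v, hv, hv'⟩ := exists_isMaxIndep hM
  obtain ⟨w, hw, hw'⟩ := exists_isMaxIndep hN
  have hli : LinearIndependent R (Sum.elim (LinearMap.inl R M N ∘ v) (LinearMap.inr R M N ∘ w)) :=
    linearIndependent_inl_union_inr' hv hw
  let u : Fin (a + b) → M × N := Sum.elim (LinearMap.inl R M N ∘ v) (LinearMap.inr R M N ∘ w) ∘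
    finSumFinEquiv.symm
  refine rank_eq_of_isMaxIndep (v := u) ⟨hli.comp _ finSumFinEquiv.symm.injective, fun z => ?_⟩
  obtain ⟨r, hr, hrv⟩ := hv' z.1
  -- Choosing `s` after `r` produces the common multiplier `s * r` without commutativity or an Ore
  -- condition.
  obtain ⟨s, hs, hsw⟩ := hw' (r • z.2)
  refine ⟨s * r, mul_ne_zero hs hr, ?_⟩
  have hu : Set.range u = (LinearMap.inl R M N '' Set.range v) ∪
      (LinearMap.inr R M N '' Set.range w) := by
    rw [EquivLike.range_comp, Set.Sum.elim_range, Set.range_comp, Set.range_comp]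
  rw [hu, Submodule.span_union, Submodule.span_image, Submodule.span_image]
  have hz : (s * r) • z = LinearMap.inl R M N (s • r • z.1) + LinearMap.inr R M N (s • r • z.2) := by
    ext <;> simp [mul_smul]
  rw [hz]
  exact Submodule.add_mem_sup ⟨_, Submodule.smul_mem _ s hrv, rfl⟩ ⟨_, hsw, rfl⟩

end Rank

/-! ### Characters of a finite cyclic group -/

section Characters

variable {Γ : Type u} [CommGroup Γ] (ε : Γ →* ℂˣ)

/-- The character `ε ^ i`. -/
def chi (i : ZMod (Nat.card Γ)) : Γ →* ℂ :=
  (Units.coeHom ℂ).comp (ε ^ i.val)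

lemma chi_apply (i : ZMod (Nat.card Γ)) (g : Γ) : chi ε i g = (ε g : ℂ) ^ i.val := by
  simp [chi]

/-- The extension of `ε ^ i` to the group algebra. -/
def chiAlg (i : ZMod (Nat.card Γ)) : MonoidAlgebra ℂ Γ →ₐ[ℂ] ℂ :=
  MonoidAlgebra.lift ℂ ℂ Γ (chi ε i)

lemma chiAlg_of {ε : Γ →* ℂˣ} (i : ZMod (Nat.card Γ)) (g : Γ) :
    chiAlg ε i (MonoidAlgebra.of ℂ Γ g) = chi ε i g := MonoidAlgebra.lift_of _ _

lemma chiAlg_eq_traceOn {ε : Γ →* ℂˣ} (i : ZMod (Nat.card Γ)) (τ : MonoidAlgebra ℂ Γ) :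
    chiAlg ε i τ = traceOn ε τ i := by
  rw [chiAlg, MonoidAlgebra.lift_apply, traceOn]
  simp only [chi_apply, smul_eq_mul]

lemma chi_natCast (n : ℕ) (g : Γ) : chi ε (n : ZMod (Nat.card Γ)) g = (ε g : ℂ) ^ n := by
  have h : ε g ^ (n % Nat.card Γ) = ε g ^ n := by rw [← map_pow, pow_mod_natCard, map_pow]
  rw [chi_apply, ZMod.val_natCast, ← Units.val_pow_eq_pow_val, h, Units.val_pow_eq_pow_val]

lemma chi_zero (g : Γ) : chi ε 0 g = 1 := by simp [chi_apply]

variable [Fintype Γ]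

lemma chi_add (i j : ZMod (Nat.card Γ)) (g : Γ) : chi ε (i + j) g = chi ε i g * chi ε j g := by
  rw [← ZMod.natCast_zmod_val i, ← ZMod.natCast_zmod_val j, ← Nat.cast_add]
  simp only [chi_natCast, pow_add]

lemma chi_add_one (i : ZMod (Nat.card Γ)) (g : Γ) : chi ε (i + 1) g = ε g * chi ε i g := by
  rw [← ZMod.natCast_zmod_val i, ← Nat.cast_add_one]
  simp only [chi_natCast, pow_succ']

lemma chi_neg_mul (i : ZMod (Nat.card Γ)) (g : Γ) : chi ε (-i) g * chi ε i g = 1 := by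
  rw [← chi_add, neg_add_cancel, chi_zero]


lemma sum_chi {ε : Γ →* ℂˣ} (hε : Function.Injective ε) (i : ZMod (Nat.card Γ)) :
    ∑ g, chi ε i g = if i = 0 then (Nat.card Γ : ℂ) else 0 := by
  split_ifs with h
  · subst h
    simp [chi_zero]
  · refine sum_hom_units_eq_zero (chi ε i) fun h1 => h ?_
    -- On a generator, the `i.val`-th power of the faithful `ε` is trivial only if the order of the
    -- group divides `i.val`.
    have : IsCyclic Γ := isCyclic_of_injective_ringHom ((Units.coeHom ℂ).comp ε)
      (Units.val_injective.comp hε)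
    obtain ⟨g, hg⟩ := IsCyclic.exists_ofOrder_eq_natCard (α := Γ)
    have h2 := DFunLike.congr_fun h1 g
    rw [chi_apply, MonoidHom.one_apply, ← Units.val_pow_eq_pow_val, Units.val_eq_one, ← map_pow,
      map_eq_one_iff ε hε] at h2
    have h3 := Nat.eq_zero_of_dvd_of_lt (hg.symm.dvd.trans (orderOf_dvd_of_pow_eq_one h2)) (ZMod.val_lt i)
    exact (ZMod.val_eq_zero i).1 h3

lemma sum_chi_apply {ε : Γ →* ℂˣ} (hε : Function.Injective ε) {g : Γ} (hg : g ≠ 1) :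
    ∑ i, chi ε i g = 0 := by
  rw [← sum_range_zmod]
  simp only [chi_natCast]
  have h1 : (ε g : ℂ) ≠ 1 := by
    rwa [Ne, Units.val_eq_one, map_eq_one_iff ε hε]
  rw [geom_sum_eq h1, ← Units.val_pow_eq_pow_val, ← map_pow, pow_card_eq_one', map_one]
  simp

variable {ε}

variable (ε) in
/-- The primitive idempotent of the group algebra with character `ε ^ i`. -/
def charIdem (i : ZMod (Nat.card Γ)) : MonoidAlgebra ℂ Γ :=
  (Nat.card Γ : ℂ)⁻¹ • ∑ g, chi ε (-i) g • MonoidAlgebra.of ℂ Γ g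

lemma of_mul_charIdem (g : Γ) (i : ZMod (Nat.card Γ)) :
    MonoidAlgebra.of ℂ Γ g * charIdem ε i = chi ε i g • charIdem ε i := by
  have h : ∀ k : Γ, MonoidAlgebra.of ℂ Γ g * chi ε (-i) k • MonoidAlgebra.of ℂ Γ k =
      chi ε i g • chi ε (-i) (g * k) • MonoidAlgebra.of ℂ Γ (g * k) := fun k => by
    rw [mul_smul_comm, ← map_mul, smul_smul, map_mul (chi ε (-i)), ← mul_assoc,
      mul_comm (chi ε i g), chi_neg_mul, one_mul]
  rw [charIdem, mul_smul_comm, smul_comm (chi ε i g), Finset.mul_sum]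
  simp only [h, ← Finset.smul_sum]
  congr 2
  exact Equiv.sum_comp (Equiv.mulLeft g) fun k => chi ε (-i) k • MonoidAlgebra.of ℂ Γ k

lemma mul_charIdem (a : MonoidAlgebra ℂ Γ) (i : ZMod (Nat.card Γ)) :
    a * charIdem ε i = chiAlg ε i a • charIdem ε i := by
  induction a using MonoidAlgebra.induction_on with
  | of g => rw [of_mul_charIdem, chiAlg_of]
  | add a b ha hb => rw [add_mul, ha, hb, map_add, add_smul]
  | smul c a ha => rw [smul_mul_assoc, ha, map_smul, smul_smul, smul_eq_mul]

lemma chiAlg_charIdem (hε : Function.Injective ε) (i j : ZMod (Nat.card Γ)) :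
    chiAlg ε j (charIdem ε i) = if i = j then 1 else 0 := by
  have hc : (Nat.card Γ : ℂ) ≠ 0 := Nat.cast_ne_zero.2 Nat.card_pos.ne'
  have h : ∑ g, chi ε (-i) g * chi ε j g = ∑ g, chi ε (j - i) g :=
    Finset.sum_congr rfl fun g _ => by rw [← chi_add, sub_eq_neg_add]
  rw [charIdem, map_smul, map_sum]
  simp only [map_smul, chiAlg_of, smul_eq_mul]
  rw [h, sum_chi hε]
  simp only [sub_eq_zero, eq_comm (a := j)]
  split_ifs <;> simp

lemma charIdem_mul (hε : Function.Injective ε) (i j : ZMod (Nat.card Γ)) :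
    charIdem ε i * charIdem ε j = if i = j then charIdem ε i else 0 := by
  rw [mul_charIdem, chiAlg_charIdem hε]
  split_ifs with h
  · rw [one_smul, h]
  · rw [zero_smul]

lemma sum_charIdem (hε : Function.Injective ε) : ∑ i, charIdem ε i = 1 := by
  have hc : (Nat.card Γ : ℂ) ≠ 0 := Nat.cast_ne_zero.2 Nat.card_pos.ne'
  simp only [charIdem]
  rw [← Finset.smul_sum, Finset.sum_comm]
  simp only [← Finset.sum_smul]
  have h : ∀ g : Γ, ∑ i, chi ε (-i) g = ∑ i, chi ε i g := fun g =>
    Fintype.sum_equiv (Equiv.neg _) _ _ fun _ => rfl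
  simp only [h]
  rw [Finset.sum_eq_single 1, map_one, smul_smul]
  · simp
  · intro g _ hg
    rw [sum_chi_apply hε hg, zero_smul]
  · simp

lemma eq_sum_charIdem (hε : Function.Injective ε) (a : MonoidAlgebra ℂ Γ) :
    a = ∑ i, chiAlg ε i a • charIdem ε i := by
  simp only [← mul_charIdem]
  rw [← Finset.mul_sum, sum_charIdem hε, mul_one]

end Characters

/-! ### The algebra `B^τ` is a cyclic Weyl algebra -/

section Instance

variable {Γ : Type u} [CommGroup Γ] {ε : Γ →* ℂˣ} {τ : MonoidAlgebra ℂ Γ}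

variable (ε τ) in
/-- The generator `x` of `B^τ`. -/
def B.x : B ε τ := B.mk ε τ (FreeAlgebra.ι ℂ Gen.x)

variable (ε τ) in
/-- The generator `y` of `B^τ`. -/
def B.y : B ε τ := B.mk ε τ (FreeAlgebra.ι ℂ Gen.y)

lemma B.ofGroupAlgebra_of (g : Γ) :
    B.ofGroupAlgebra ε τ (MonoidAlgebra.of ℂ Γ g) = B.grp ε τ g := MonoidAlgebra.lift_of _ _

lemma B.grp_mul_x (g : Γ) : B.grp ε τ g * B.x ε τ = (ε g : ℂ) • (B.x ε τ * B.grp ε τ g) := by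
  have h := RingQuot.mkAlgHom_rel ℂ (Rel.grp_x (ε := ε) (τ := τ) g)
  rwa [map_mul, map_smul, map_mul] at h

lemma B.grp_mul_y (g : Γ) :
    B.grp ε τ g * B.y ε τ = ((ε g)⁻¹ : ℂ) • (B.y ε τ * B.grp ε τ g) := by
  have h := RingQuot.mkAlgHom_rel ℂ (Rel.grp_y (ε := ε) (τ := τ) g)
  rwa [map_mul, map_smul, map_mul] at h

lemma B.x_mul_grp (g : Γ) : B.x ε τ * B.grp ε τ g = ((ε g)⁻¹ : ℂ) • (B.grp ε τ g * B.x ε τ) := by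
  rw [B.grp_mul_x, smul_smul, inv_mul_cancel₀ (ε g).ne_zero, one_smul]

lemma B.y_mul_grp (g : Γ) : B.y ε τ * B.grp ε τ g = (ε g : ℂ) • (B.grp ε τ g * B.y ε τ) := by
  rw [B.grp_mul_y, smul_smul, mul_inv_cancel₀ (ε g).ne_zero, one_smul]

lemma B.comm : B.x ε τ * B.y ε τ - B.y ε τ * B.x ε τ = B.ofGroupAlgebra ε τ τ := by
  have h := RingQuot.mkAlgHom_rel ℂ (Rel.comm (ε := ε) (τ := τ))
  rw [map_sub, map_mul, map_mul] at h
  refine h.trans ?_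
  rw [B.ofGroupAlgebra, MonoidAlgebra.lift_apply, Finsupp.sum, Finsupp.sum, map_sum]
  simp only [map_smul]
  rfl

variable [Fintype Γ]

variable (ε τ) in
/-- The image of a primitive idempotent of the group algebra in `B^τ`. -/
def B.e (i : ZMod (Nat.card Γ)) : B ε τ := B.ofGroupAlgebra ε τ (charIdem ε i)

lemma B.e_eq (i : ZMod (Nat.card Γ)) :
    B.e ε τ i = (Nat.card Γ : ℂ)⁻¹ • ∑ g, chi ε (-i) g • B.grp ε τ g := by
  simp only [B.e, charIdem, map_smul, map_sum, B.ofGroupAlgebra_of]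

lemma B.e_zero : B.e ε τ 0 = symIdem ε τ := by
  rw [B.e_eq, symIdem, finsum_eq_sum_of_fintype]
  simp [chi_zero]

lemma chi_mul_inv (i : ZMod (Nat.card Γ)) (g : Γ) :
    chi ε (-i) g * (ε g : ℂ)⁻¹ = chi ε (-(i + 1)) g := by
  have h := chi_add_one ε (-(i + 1)) g
  rw [neg_add, neg_add_cancel_right, ← neg_add] at h
  rw [h, mul_comm, inv_mul_cancel_left₀ (ε g).ne_zero]

lemma B.x_mul_e (i : ZMod (Nat.card Γ)) : B.x ε τ * B.e ε τ i = B.e ε τ (i + 1) * B.x ε τ := by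
  rw [B.e_eq, B.e_eq, mul_smul_comm, smul_mul_assoc, Finset.mul_sum, Finset.sum_mul]
  congr 1
  refine Finset.sum_congr rfl fun g _ => ?_
  rw [mul_smul_comm, B.x_mul_grp, smul_smul, chi_mul_inv, smul_mul_assoc]

lemma B.y_mul_e (i : ZMod (Nat.card Γ)) : B.y ε τ * B.e ε τ (i + 1) = B.e ε τ i * B.y ε τ := by
  rw [B.e_eq, B.e_eq, mul_smul_comm, smul_mul_assoc, Finset.mul_sum, Finset.sum_mul]
  congr 1
  refine Finset.sum_congr rfl fun g _ => ?_
  rw [mul_smul_comm, B.y_mul_grp, smul_smul, ← chi_mul_inv, inv_mul_cancel_right₀ (ε g).ne_zero,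
    smul_mul_assoc]

lemma B.grp_eq_sum (hε : Function.Injective ε) (g : Γ) :
    B.grp ε τ g = ∑ i, chi ε i g • B.e ε τ i := by
  rw [← B.ofGroupAlgebra_of, eq_sum_charIdem hε (MonoidAlgebra.of ℂ Γ g), map_sum]
  simp only [map_smul, chiAlg_of]
  rfl

/-- By Fourier inversion each group element is a combination of the idempotents, which may thus
replace `Γ` among the generators. -/
lemma B.adjoin_eq (hε : Function.Injective ε) :
    Algebra.adjoin ℂ ({B.x ε τ, B.y ε τ} ∪ Set.range (B.e ε τ)) = ⊤ := by
  refine top_le_iff.1 ?_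
  have h : (B.mk ε τ).range = ⊤ :=
    (AlgHom.range_eq_top _).2 (RingQuot.mkAlgHom_surjective ℂ (Rel ε τ))
  rw [← h, ← Algebra.map_top, ← FreeAlgebra.adjoin_range_ι, AlgHom.map_adjoin, Algebra.adjoin_le_iff]
  rintro _ ⟨_, ⟨g, rfl⟩, rfl⟩
  cases g with
  | x => exact Algebra.subset_adjoin (by left; left; rfl)
  | y => exact Algebra.subset_adjoin (by left; right; rfl)
  | grp g =>
    change B.grp ε τ g ∈ _
    rw [B.grp_eq_sum hε]
    exact Subalgebra.sum_mem _ fun i _ => Subalgebra.smul_mem _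
      (Algebra.subset_adjoin (by right; exact ⟨i, rfl⟩)) _

variable (ε τ) in
/-- The action of the generators of `B^τ` on the skew Laurent ring. -/
def genOp : Gen Γ → Module.End ℂ (ℤ → ZMod (Nat.card Γ) → ℂ[X])
  | .grp g => opD fun i => C (chi ε i g)
  | .x => opX (traceOn ε τ)
  | .y => opY (traceOn ε τ)

/-- The crossed-product relations hold since `σ` shifts the index of `chi` by one. The commutator
relation holds since `y x` acts as `t` and `x y` as `σ(t) = t + λ`. -/
lemma genOp_rel {a b : FreeAlgebra ℂ (Gen Γ)} (h : Rel ε τ a b) :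
    FreeAlgebra.lift ℂ (genOp ε τ) a = FreeAlgebra.lift ℂ (genOp ε τ) b := by
  cases h with
  | one =>
    rw [FreeAlgebra.lift_ι_apply, map_one]
    refine LinearMap.ext fun f => funext fun n => funext fun i => ?_
    change C (chi ε i 1) * f n i = f n i
    simp
  | mul g h =>
    simp only [map_mul, FreeAlgebra.lift_ι_apply]
    refine LinearMap.ext fun f => funext fun n => funext fun i => ?_
    change C (chi ε i (g * h)) * f n i = C (chi ε i g) * (C (chi ε i h) * f n i)
    simp [mul_assoc]
  | grp_x g =>
    simp only [map_mul, map_smul, FreeAlgebra.lift_ι_apply]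
    refine LinearMap.ext fun f => funext fun n => funext fun i => ?_
    change C (chi ε i g) * taylor (traceOn ε τ i) (f (n - 1) (i - 1)) =
      (ε g : ℂ) • taylor (traceOn ε τ i) (C (chi ε (i - 1) g) * f (n - 1) (i - 1))
    have h := chi_add_one ε (i - 1) g
    rw [sub_add_cancel] at h
    rw [h, taylor_mul, taylor_C, smul_eq_C_mul, C_mul, mul_assoc]
  | grp_y g =>
    simp only [map_mul, map_smul, FreeAlgebra.lift_ι_apply]
    refine LinearMap.ext fun f => funext fun n => funext fun i => ?_
    change C (chi ε i g) * (X * taylor (-traceOn ε τ (i + 1)) (f (n + 1) (i + 1))) =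
      ((ε g)⁻¹ : ℂ) • (X * taylor (-traceOn ε τ (i + 1)) (C (chi ε (i + 1) g) * f (n + 1) (i + 1)))
    rw [chi_add_one, taylor_mul, taylor_C, smul_eq_C_mul, C_mul, mul_left_comm X, mul_assoc (C _) (C _),
      ← mul_assoc (C _) (C _), ← C_mul, inv_mul_cancel₀ (ε g).ne_zero, C_1, one_mul]
  | comm =>
    simp only [map_sub, map_mul, FreeAlgebra.lift_ι_apply]
    rw [Finsupp.sum, map_sum]
    simp only [map_smul, FreeAlgebra.lift_ι_apply]
    refine LinearMap.ext fun f => funext fun n => funext fun i => ?_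
    rw [LinearMap.sum_apply, Finset.sum_apply, Finset.sum_apply]
    change taylor (traceOn ε τ i) (X * taylor (-traceOn ε τ (i - 1 + 1)) (f (n - 1 + 1) (i - 1 + 1)))
      - X * taylor (-traceOn ε τ (i + 1)) (taylor (traceOn ε τ (i + 1)) (f (n + 1 - 1) (i + 1 - 1)))
      = ∑ g ∈ τ.coeff.support, τ.coeff g • (C (chi ε i g) * f n i)
    have h : traceOn ε τ i = ∑ g ∈ τ.coeff.support, τ.coeff g * chi ε i g := by
      simp only [chi_apply]
      rfl
    simp only [sub_add_cancel, add_sub_cancel_right, taylor_mul, taylor_X, taylor_taylor,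
      neg_add_cancel, add_neg_cancel, taylor_zero]
    rw [add_mul, add_sub_cancel_left, h, map_sum, Finset.sum_mul]
    simp only [smul_eq_C_mul, C_mul, mul_assoc]

variable (ε τ) in
/-- The action of `B^τ` on the skew Laurent ring. -/
def B.rho : B ε τ →ₐ[ℂ] Module.End ℂ (ℤ → ZMod (Nat.card Γ) → ℂ[X]) :=
  RingQuot.liftAlgHom ℂ ⟨FreeAlgebra.lift ℂ (genOp ε τ), fun _ _ h => genOp_rel h⟩

lemma B.rho_mk (a : FreeAlgebra ℂ (Gen Γ)) :
    B.rho ε τ (B.mk ε τ a) = FreeAlgebra.lift ℂ (genOp ε τ) a :=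
  RingQuot.liftAlgHom_mkAlgHom_apply ℂ _ _ a

lemma B.rho_e (hε : Function.Injective ε) (i : ZMod (Nat.card Γ)) :
    B.rho ε τ (B.e ε τ i) = opD (Pi.single i 1) := by
  have hg : ∀ g, B.rho ε τ (B.grp ε τ g) = opD fun i => C (chi ε i g) := fun g =>
    (B.rho_mk _).trans (FreeAlgebra.lift_ι_apply _ _)
  rw [B.e_eq, map_smul, map_sum]
  simp only [map_smul, hg]
  refine LinearMap.ext fun f => funext fun n => funext fun j => ?_
  rw [LinearMap.smul_apply, LinearMap.sum_apply, Pi.smul_apply, Finset.sum_apply, Pi.smul_apply,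
    Finset.sum_apply]
  change (Nat.card Γ : ℂ)⁻¹ • ∑ g, chi ε (-i) g • (C (chi ε j g) * f n j) =
    (Pi.single i 1 : ZMod (Nat.card Γ) → ℂ[X]) j * f n j
  have h := chiAlg_charIdem hε i j
  rw [charIdem, map_smul, map_sum] at h
  simp only [map_smul, chiAlg_of, smul_eq_mul] at h
  simp only [← smul_eq_C_mul, smul_smul, ← Finset.sum_smul]
  rw [h]
  split_ifs with hij
  · subst hij; simp
  · rw [Pi.single_eq_of_ne' hij, zero_smul, zero_mul]

variable (τ) in
/-- The structure of a cyclic Weyl algebra on `B^τ`. -/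
@[reducible] def B.cyclicWeyl (hε : Function.Injective ε) :
    CyclicWeyl (B ε τ) (Nat.card Γ) (traceOn ε τ) where
  e := B.e ε τ
  x := B.x ε τ
  y := B.y ε τ
  e_mul_e i j := by
    rw [B.e, B.e, ← map_mul, charIdem_mul hε]
    split_ifs
    · rfl
    · exact map_zero _
  sum_e := by
    simp only [B.e]
    rw [← map_sum, sum_charIdem hε, map_one]
  x_mul_e := B.x_mul_e
  y_mul_e := B.y_mul_e
  comm := by
    have h := congrArg (B.ofGroupAlgebra ε τ) (eq_sum_charIdem hε τ)
    rw [map_sum] at h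
    simp only [map_smul, chiAlg_eq_traceOn] at h
    exact B.comm.trans h
  adjoin_eq := B.adjoin_eq hε
  rho := B.rho ε τ
  rho_x := (B.rho_mk _).trans (FreeAlgebra.lift_ι_apply _ _)
  rho_y := (B.rho_mk _).trans (FreeAlgebra.lift_ι_apply _ _)
  rho_e := B.rho_e hε

end Instance

/-! ### Generic parameters -/

section Generic

variable {Γ : Type u} [CommGroup Γ] [Finite Γ] {ε : Γ →* ℂˣ} {τ : MonoidAlgebra ℂ Γ}

/-- Genericity is applied to the imaginary root `(1, …, 1)`. -/
lemma IsGeneric.sum_ne_zero (hτ : IsGeneric ε τ) : ∑ i, traceOn ε τ i ≠ 0 := by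
  have h := hτ 1 ⟨one_ne_zero, by simp⟩
  simpa using h

lemma val_add_one {m : ℕ} [NeZero m] {z : ZMod m} (h : z.val + 1 < m) :
    (z + 1).val = z.val + 1 := by
  rw [ZMod.val_add_of_lt, ZMod.val_one'' (by omega)]
  rwa [ZMod.val_one'' (by omega)]

lemma isRoot_interval {m : ℕ} [NeZero m] {i i' : ℕ} (h : i ≤ i') (hm : i' < m) :
    IsRoot fun z : ZMod m => if i ≤ z.val ∧ z.val ≤ i' then (1 : ℤ) else 0 := by
  refine ⟨fun h0 => ?_, ?_⟩
  · have := congrFun h0 (i : ZMod m)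
    rw [ZMod.val_natCast_of_lt (h.trans_lt hm)] at this
    simp [h] at this
  · rw [← Finset.sum_sub_distrib]
    -- In the Tits form of an interval each member is cancelled by its product with the successor,
    -- except possibly the last one.
    have key : ∀ z : ZMod m, (if i ≤ z.val ∧ z.val ≤ i' then (1 : ℤ) else 0) ^ 2 -
        (if i ≤ z.val ∧ z.val ≤ i' then (1 : ℤ) else 0) *
          (if i ≤ (z + 1).val ∧ (z + 1).val ≤ i' then (1 : ℤ) else 0) ≤
        if z = (i' : ZMod m) then 1 else 0 := by
      intro z
      by_cases hz : i ≤ z.val ∧ z.val ≤ i'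
      · obtain hz' | hz' := hz.2.lt_or_eq
        · rw [if_pos hz, val_add_one (by omega), if_pos ⟨by omega, by omega⟩]
          split_ifs <;> simp
        · have hzi : z = (i' : ZMod m) := by rw [← hz', ZMod.natCast_zmod_val]
          rw [if_pos hz, if_pos hzi]
          split_ifs <;> simp
      · rw [if_neg hz]
        split_ifs <;> simp
    refine (Finset.sum_le_sum fun z _ => key z).trans ?_
    simp

lemma IsGeneric.sum_Icc_ne_zero (hτ : IsGeneric ε τ) (i i' : ℕ) (_ : 1 ≤ i) (h : i ≤ i')
    (hm : i' < Nat.card Γ) : ∑ s ∈ Finset.Icc i i', traceOn ε τ s ≠ 0 := by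
  have key := hτ _ (isRoot_interval h hm)
  rw [← sum_range_zmod] at key
  convert key using 1
  refine (Finset.sum_congr rfl fun s hs => ?_).trans (Finset.sum_subset (s₁ := Finset.Icc i i') ?_ ?_)
  · rw [Finset.mem_Icc] at hs
    rw [ZMod.val_natCast_of_lt (by omega), if_pos hs, Int.cast_one, one_mul]
  · intro s hs
    rw [Finset.mem_Icc] at hs
    exact Finset.mem_range.2 (by omega)
  · intro s hs hs'
    rw [Finset.mem_range] at hs
    rw [Finset.mem_Icc] at hs'
    rw [ZMod.val_natCast_of_lt hs, if_neg hs', Int.cast_zero, zero_mul]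

end Generic

/-! ### The Grothendieck group of the group algebra -/

section GroupAlgebra

variable {Γ : Type u} [CommGroup Γ] [Fintype Γ] {ε : Γ →* ℂˣ}

lemma isIdempotentElem_charIdem (hε : Function.Injective ε) (i : ZMod (Nat.card Γ)) :
    IsIdempotentElem (charIdem ε i) := by
  rw [IsIdempotentElem, charIdem_mul hε, if_pos rfl]

lemma eq_smul_of_mem_cut {i : ZMod (Nat.card Γ)} {a : MonoidAlgebra ℂ Γ}
    (ha : charIdem ε i * a = a) : a = chiAlg ε i a • charIdem ε i := by
  rw [← mul_charIdem, mul_comm, ha]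

lemma charIdem_ne_zero (hε : Function.Injective ε) (i : ZMod (Nat.card Γ)) :
    charIdem ε i ≠ 0 := fun h => by
  have := chiAlg_charIdem hε i i
  rw [h] at this
  simp at this

/-- The class of the irreducible module with character `ε ^ i`. -/
def irrClass (hε : Function.Injective ε) (i : ZMod (Nat.card Γ)) : K0 (MonoidAlgebra ℂ Γ) :=
  K0.ofCut (MonoidAlgebra ℂ Γ) (MonoidAlgebra ℂ Γ) (isIdempotentElem_charIdem hε i)

lemma dimHom_irrClass (hε : Function.Injective ε) (i : ZMod (Nat.card Γ)) :
    dimHom (MonoidAlgebra ℂ Γ) (irrClass hε i) = 1 := by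
  let A := MonoidAlgebra ℂ Γ
  have h : complexDim A (cut A A (charIdem ε i)) = 1 := by
    let _ : Module ℂ (cut A A (charIdem ε i)) := Module.compHom _ (algebraMap ℂ Aᵐᵒᵖ)
    refine finrank_eq_one_iff'.2 ⟨⟨charIdem ε i, isIdempotentElem_charIdem hε i⟩, fun h0 =>
      charIdem_ne_zero hε i (congrArg Subtype.val h0), fun w => ⟨chiAlg ε i w.1, Subtype.ext ?_⟩⟩
    change charIdem ε i * algebraMap ℂ A (chiAlg ε i w.1) = w.1
    conv_rhs => rw [eq_smul_of_mem_cut w.2]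
    rw [← Algebra.commutes, Algebra.smul_def]
  have h' : dimHom A (irrClass hε i) =
      complexDim A (cut A A (charIdem ε i)) := by
    refine (QuotientAddGroup.lift_mk' _ _ _).trans (FreeAbelianGroup.lift_apply_of _ _)
  rw [h', h, Nat.cast_one]

/-- `K0` of the group algebra is generated by the classes of the irreducible modules. -/
theorem K0_groupAlgebra_eq_closure (hε : Function.Injective ε) (ξ : K0 (MonoidAlgebra ℂ Γ)) :
    ξ ∈ AddSubgroup.closure (Set.range (irrClass hε)) := by
  let A := MonoidAlgebra ℂ Γ
  refine K0.mem_of_forall _ (fun P => ?_) ξ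
  let V := P.carrier
  let _ : Module ℂ V := Module.compHom V (algebraMap ℂ Aᵐᵒᵖ)
  have : Module.Finite ℂ Aᵐᵒᵖ := Module.Finite.equiv (MulOpposite.opLinearEquiv ℂ (M := A))
  have : IsScalarTower ℂ Aᵐᵒᵖ V := IsScalarTower.of_algebraMap_smul fun _ _ => rfl
  have : Module.Finite ℂ V := Module.Finite.trans Aᵐᵒᵖ V
  -- Isotypic vectors span `V`; a complex basis chosen among them splits `V` into one-dimensional
  -- pieces, each a copy of some `e_j ℂΓ`.
  let S : Set V := {v | ∃ i, MulOpposite.op (charIdem ε i) • v = v}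
  have hS : Submodule.span ℂ S = ⊤ := by
    refine top_le_iff.1 fun v _ => ?_
    have hv : v = ∑ i, MulOpposite.op (charIdem ε i) • v := by
      rw [← Finset.sum_smul, ← Finset.op_sum, sum_charIdem hε, MulOpposite.op_one, one_smul]
    rw [hv]
    exact Submodule.sum_mem _ fun i _ => Submodule.subset_span ⟨i, by
      rw [smul_smul, ← MulOpposite.op_mul, (isIdempotentElem_charIdem hε i).eq]⟩
  obtain ⟨b, hbS, hb, hli⟩ := exists_linearIndependent ℂ S
  have hfin : Finite b := hli.finite
  let N := Nat.card b
  let w : Fin N → V := fun t => ((Finite.equivFin b).symm t : V)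
  have hw : LinearIndependent ℂ w := hli.comp _ (Finite.equivFin b).symm.injective
  have hspan : Submodule.span ℂ (Set.range w) = ⊤ := by
    have : Set.range w = b := by
      change Set.range (Subtype.val ∘ (Finite.equivFin b).symm) = b
      rw [EquivLike.range_comp, Subtype.range_coe]
    rw [this, hb, hS]
  choose j hj using fun t => hbS ((Finite.equivFin b).symm t).2
  have hsmul : ∀ t a, charIdem ε (j t) * a = a →
      MulOpposite.op a • w t = chiAlg ε (j t) a • w t := fun t a ha => by
    conv_lhs => rw [eq_smul_of_mem_cut ha, MulOpposite.op_smul, smul_assoc, hj t]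
  have : ∀ i, Module.Finite Aᵐᵒᵖ (cut A A (charIdem ε i)) := fun i =>
    cut_finite (isIdempotentElem_charIdem hε i)
  have : ∀ i, Module.Projective Aᵐᵒᵖ (cut A A (charIdem ε i)) := fun i =>
    cut_projective (isIdempotentElem_charIdem hε i)
  let F : (∀ t, cut A A (charIdem ε (j t))) →ₗ[Aᵐᵒᵖ] V :=
    { toFun := fun f => ∑ t, MulOpposite.op (f t).1 • w t
      map_add' := fun f g => (Finset.sum_congr rfl fun t _ =>
        add_smul (MulOpposite.op (f t).1) (MulOpposite.op (g t).1) (w t)).trans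
          Finset.sum_add_distrib
      map_smul' := fun a f => (Finset.sum_congr rfl fun t _ =>
        mul_smul a (MulOpposite.op (f t).1) (w t)).trans Finset.smul_sum.symm }
  have hF : Function.Bijective F := by
    refine ⟨(injective_iff_map_eq_zero F).2 fun f hf => ?_, fun v => ?_⟩
    · have h0 : ∑ t, chiAlg ε (j t) (f t).1 • w t = 0 :=
        (Finset.sum_congr rfl fun t _ => (hsmul t _ (f t).2).symm).trans hf
      funext t
      refine Subtype.ext ?_
      rw [eq_smul_of_mem_cut (f t).2, Fintype.linearIndependent_iff.1 hw _ h0 t, zero_smul]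
      rfl
    · obtain ⟨c, hc⟩ := (Submodule.mem_span_range_iff_exists_fun ℂ).1 (hspan ▸ Submodule.mem_top :
        v ∈ Submodule.span ℂ (Set.range w))
      refine ⟨fun t => ⟨c t • charIdem ε (j t), ?_⟩, ?_⟩
      · change _ * _ = _
        rw [mul_smul_comm, (isIdempotentElem_charIdem hε (j t)).eq]
      · rw [← hc]
        change ∑ t, MulOpposite.op (c t • charIdem ε (j t)) • w t = _
        refine Finset.sum_congr rfl fun t _ => ?_
        rw [MulOpposite.op_smul, smul_assoc]
        exact congrArg _ (hj t)
  rw [K0.of_congr (LinearEquiv.ofBijective F hF).symm, K0.of_pi]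
  exact AddSubgroup.sum_mem _ fun t _ => AddSubgroup.subset_closure ⟨j t, rfl⟩

end GroupAlgebra

/-! ### The bimodule `B^τ e` -/

section Corner

variable {Γ : Type u} [CommGroup Γ] {ε : Γ →* ℂˣ} {τ : MonoidAlgebra ℂ Γ}

lemma mem_Be_of_mul {b : B ε τ} (h : b * symIdem ε τ = b) : b ∈ Be ε τ :=
  Submodule.mem_span_singleton.2 ⟨b, h⟩

variable [Finite Γ]

lemma O.mul_symIdem (o : O ε τ) : o.1 * symIdem ε τ = o.1 :=
  ((Subsemigroup.mem_corner_iff (symIdem_isIdempotent ε τ)).1 o.2).2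

lemma O.symIdem_mul (o : O ε τ) : symIdem ε τ * o.1 = o.1 :=
  ((Subsemigroup.mem_corner_iff (symIdem_isIdempotent ε τ)).1 o.2).1

variable (ε τ) in
/-- The inclusion of `O^τ` into `B^τ`. -/
def O.val : O ε τ →+ B ε τ where
  toFun o := o.1
  map_zero' := rfl
  map_add' _ _ := rfl

lemma O.val_mul (o p : O ε τ) : O.val ε τ (o * p) = O.val ε τ o * O.val ε τ p := rfl

lemma O.mem_of_mul {b : B ε τ} (h : symIdem ε τ * b = b) (h' : b * symIdem ε τ = b) :
    b ∈ Subsemigroup.corner (symIdem ε τ) :=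
  (Subsemigroup.mem_corner_iff (symIdem_isIdempotent ε τ)).2 ⟨h, h'⟩

/-- Left multiplication by an element of `e B^τ`, from `B^τ e` to `O^τ`. -/
def BeToO (r : B ε τ) (hr : symIdem ε τ * r = r) : Be ε τ →ₗ[(O ε τ)ᵐᵒᵖ] O ε τ where
  toFun b := ⟨r * b.1, O.mem_of_mul (by rw [← mul_assoc, hr]) (by rw [mul_assoc, Be_mul_symIdem])⟩
  map_add' b c := Subtype.ext (mul_add r b.1 c.1)
  map_smul' o b := Subtype.ext (mul_assoc r b.1 o.unop.1).symm

/-- Left multiplication by an element of `B^τ e`, from `O^τ` to `B^τ e`. -/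
def OToBe (b : Be ε τ) : O ε τ →ₗ[(O ε τ)ᵐᵒᵖ] Be ε τ where
  toFun o := ⟨b.1 * o.1, mul_mem_Be ε τ b.1 o⟩
  map_add' o p := Subtype.ext (mul_add b.1 o.1 p.1)
  map_smul' o p := Subtype.ext (mul_assoc b.1 p.1 o.unop.1).symm

variable {n : ℕ} {a b : Fin n → B ε τ}

variable (a) in
/-- Generators of `c B^τ e`. -/
def cutGen {c : B ε τ} (hc : IsIdempotentElem c) (k : Fin n) : cut (O ε τ) (Be ε τ) c :=
  ⟨⟨c * a k * symIdem ε τ, mem_Be_of_mul (by rw [mul_assoc, (symIdem_isIdempotent ε τ).eq])⟩,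
    Subtype.ext (by
      change c * (c * a k * symIdem ε τ) = c * a k * symIdem ε τ
      rw [← mul_assoc, ← mul_assoc, hc.eq])⟩

variable (b) in
/-- Coordinates on `c B^τ e`. -/
def cutCoord (c : B ε τ) (k : Fin n) : cut (O ε τ) (Be ε τ) c →ₗ[(O ε τ)ᵐᵒᵖ] O ε τ :=
  (BeToO (symIdem ε τ * b k) (by rw [← mul_assoc, (symIdem_isIdempotent ε τ).eq])) ∘ₗ
    Submodule.subtype _

/-- Insert `1 = ∑ a_k e b_k` between `c` and `z` in `z = c z`, and split `e` as `e · e`. -/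
lemma isDualBasis_cut_Be (h : ∑ k, a k * symIdem ε τ * b k = 1) {c : B ε τ}
    (hc : IsIdempotentElem c) : IsDualBasis (cutGen a hc) (cutCoord b c) := fun z => by
  refine Subtype.ext (Subtype.ext ?_)
  have hz : c * z.1.1 = z.1.1 := congrArg Subtype.val z.2
  rw [AddSubmonoidClass.coe_finsetSum, AddSubmonoidClass.coe_finsetSum]
  have : ∀ k, c * a k * symIdem ε τ * (symIdem ε τ * b k * z.1.1) =
      c * (a k * symIdem ε τ * b k) * z.1.1 := fun k => by
    have he := (symIdem_isIdempotent ε τ).eq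
    simp only [mul_assoc]
    rw [← mul_assoc (symIdem ε τ) (symIdem ε τ), he]
  refine (Finset.sum_congr rfl fun k _ => this k).trans ?_
  rw [← Finset.sum_mul, ← Finset.mul_sum, h, mul_one, hz]

lemma isDualBasis_Be (h : ∑ k, a k * symIdem ε τ * b k = 1) :
    IsDualBasis (P := Be ε τ) (fun k => (cutGen a IsIdempotentElem.one k).1)
      (fun k => BeToO (symIdem ε τ * b k)
        (by rw [← mul_assoc, (symIdem_isIdempotent ε τ).eq])) := fun z => by
  have hz := isDualBasis_cut_Be h IsIdempotentElem.one ⟨z, one_smul _ z⟩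
  have := congrArg Subtype.val hz
  rwa [AddSubmonoidClass.coe_finsetSum] at this

/-- The Hattori–Stallings trace of `c B^τ e` over `O^τ` is the trace of `c`. -/
lemma trace_ofCut_Be {T : Type*} [AddCommGroup T] (t : B ε τ →+ T)
    (ht : ∀ r s, t (r * s) = t (s * r)) (t' : O ε τ →+ T) (ht' : ∀ o p, t' (o * p) = t' (p * o))
    (htt' : ∀ o, t' o = t o.1) (h : ∑ k, a k * symIdem ε τ * b k = 1) {c : B ε τ}
    (hc : IsIdempotentElem c) [Module.Finite (O ε τ)ᵐᵒᵖ (Be ε τ)]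
    [Module.Projective (O ε τ)ᵐᵒᵖ (Be ε τ)] :
    K0.trace t' ht' (K0.ofCut (O ε τ) (Be ε τ) hc) = t c := by
  have := cut_finite (C := O ε τ) (N := Be ε τ) hc
  have := cut_projective (C := O ε τ) (N := Be ε τ) hc
  refine (K0.trace_of ht' (isDualBasis_cut_Be h hc)).trans ?_
  have key : ∀ k, t' (cutCoord b c k (cutGen a hc k)) = t (c * (a k * symIdem ε τ * b k)) := by
    intro k
    rw [htt']
    change t (symIdem ε τ * b k * (c * a k * symIdem ε τ)) = _
    rw [ht]
    congr 1
    have he := (symIdem_isIdempotent ε τ).eq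
    simp only [mul_assoc]
    rw [← mul_assoc (symIdem ε τ) (symIdem ε τ), he]
  rw [Finset.sum_congr rfl fun k _ => key k, ← map_sum, ← Finset.mul_sum, h, mul_one]

/-! ### Surjectivity of restriction to the corner -/

section Lift

variable {N : Type u} [AddCommGroup N] [Module (O ε τ)ᵐᵒᵖ N] {p : Fin n → N}
  {f : Fin n → N →ₗ[(O ε τ)ᵐᵒᵖ] O ε τ}

/-- The matrix over `B^τ` of a dual basis over `O^τ`. -/
def liftMatrix (p : Fin n → N) (f : Fin n → N →ₗ[(O ε τ)ᵐᵒᵖ] O ε τ) (i k : Fin n) : B ε τ :=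
  (f i (p k)).1

lemma liftMatrix_mul (h : IsDualBasis p f) (i l : Fin n) :
    ∑ k, liftMatrix p f i k * liftMatrix p f k l = liftMatrix p f i l := by
  have := congrArg (O.val ε τ) (h.sum_mul i (p l))
  rwa [map_sum] at this

/-- The dual basis of the module of vectors fixed by an idempotent matrix. -/
lemma isDualBasis_fixedBy {A : Type u} [Ring A] {ι : Type*} [Fintype ι] {E : ι → ι → A}
    (hE : ∀ i l, ∑ k, E i k * E k l = E i l) :
    IsDualBasis (P := fixedBy A A E) (fun l => ⟨fun i => E i l, fun i => hE i l⟩)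
      (fun l => LinearMap.proj l ∘ₗ Submodule.subtype _) := fun v => by
  refine Subtype.ext (funext fun i => ?_)
  rw [AddSubmonoidClass.coe_finsetSum, Finset.sum_apply]
  exact v.2 i

/-- A finitely generated projective `O^τ`-module, as the module of fixed vectors in `(B^τ e)^n`. -/
def fixedByLift (h : IsDualBasis p f) :
    N →ₗ[(O ε τ)ᵐᵒᵖ] fixedBy (O ε τ) (Be ε τ) (liftMatrix p f) where
  toFun m := ⟨fun i => ⟨(f i m).1, mem_Be_of_mul (O.mul_symIdem _)⟩, fun i => Subtype.ext <| by
    have := congrArg (O.val ε τ) (h.sum_mul i m)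
    rw [map_sum] at this
    rw [AddSubmonoidClass.coe_finsetSum]
    exact this⟩
  map_add' m m' := by
    refine Subtype.ext (funext fun i => Subtype.ext ?_)
    change (f i (m + m')).1 = (f i m).1 + (f i m').1
    rw [map_add]; rfl
  map_smul' o m := by
    refine Subtype.ext (funext fun i => Subtype.ext ?_)
    change (f i (o • m)).1 = (f i m).1 * o.unop.1
    rw [map_smul]; rfl

lemma fixedByLift_bijective (h : IsDualBasis p f) : Function.Bijective (fixedByLift h) := by
  refine ⟨(injective_iff_map_eq_zero _).2 fun m hm => ?_, fun v => ?_⟩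
  · rw [← h m]
    refine Finset.sum_eq_zero fun i _ => ?_
    have h0 : (fixedByLift h m).1 i = 0 := congrFun (congrArg Subtype.val hm) i
    have : f i m = 0 := Subtype.ext (congrArg (fun z : Be ε τ => z.1) h0)
    rw [this]
    exact zero_smul (O ε τ)ᵐᵒᵖ (p i)
  · have hv : ∀ i, ∑ k, liftMatrix p f i k * (v.1 k).1 = (v.1 i).1 := fun i => by
      have := congrArg Subtype.val (v.2 i)
      rwa [AddSubmonoidClass.coe_finsetSum] at this
    -- A fixed vector of `(B^τ e)^n` has entries in `e B^τ e`, since the entries of the matrix are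
    -- fixed by `e` on the left.
    let o : Fin n → O ε τ := fun i => ⟨(v.1 i).1, O.mem_of_mul
      (by
        rw [← hv i, Finset.mul_sum]
        refine Finset.sum_congr rfl fun k _ => ?_
        rw [← mul_assoc, liftMatrix, O.symIdem_mul]) (Be_mul_symIdem ε τ _)⟩
    refine ⟨∑ i, MulOpposite.op (o i) • p i, Subtype.ext (funext fun i => Subtype.ext ?_)⟩
    change O.val ε τ (f i (∑ k, MulOpposite.op (o k) • p k)) = _
    rw [map_sum, map_sum, ← hv i]
    refine Finset.sum_congr rfl fun k _ => ?_
    rw [map_smul]; rfl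

end Lift

/-- The idempotent matrix of a projective `O^τ`-module, read over `B^τ`, defines a projective
`B^τ`-module. Tensoring it with `B^τ e` gives the fixed vectors in `(B^τ e)^n`, which recover the
original module. -/
lemma K0.tensor_Be_surjective [Module.Finite (O ε τ)ᵐᵒᵖ (Be ε τ)]
    [Module.Projective (O ε τ)ᵐᵒᵖ (Be ε τ)] :
    Function.Surjective (K0.tensor (B ε τ) (O ε τ) (Be ε τ)) := by
  intro ξ
  refine AddMonoidHom.mem_range.1 (K0.mem_of_forall _ (fun P => ?_) ξ)
  obtain ⟨n, p, f, h⟩ := exists_isDualBasis (O ε τ) P.carrier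
  have hd := isDualBasis_fixedBy (liftMatrix_mul h)
  have := hd.finite
  have := hd.projective
  refine ⟨K0.of (fixedBy (B ε τ) (B ε τ) (liftMatrix p f)), ?_⟩
  rw [K0.tensor_of]
  exact K0.of_congr ((tensorEquivFixedBy (O ε τ) (Be ε τ) hd).trans
    (LinearEquiv.ofBijective _ (fixedByLift_bijective h)).symm)

end Corner

/-! ### Rank of projective modules over the corner -/

/-- A ring as a right module over itself. -/
def opSelfEquiv (A : Type u) [Ring A] : A ≃ₗ[Aᵐᵒᵖ] Aᵐᵒᵖ where
  toFun := MulOpposite.op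
  invFun := MulOpposite.unop
  map_add' _ _ := rfl
  map_smul' _ _ := rfl
  left_inv _ := rfl
  right_inv _ := rfl

section RankHom

variable (A : Type u) [Ring A] [StrongRankCondition Aᵐᵒᵖ]

lemma rank_opSelf : Module.rank Aᵐᵒᵖ A = 1 := by
  rw [(opSelfEquiv A).rank_eq, Module.rank_self]

lemma exists_hasRank (P : Type u) [AddCommGroup P] [Module Aᵐᵒᵖ P] [Module.Finite Aᵐᵒᵖ P]
    [Module.Projective Aᵐᵒᵖ P] : ∃ r : ℕ, HasRank A P r := by
  obtain ⟨n, p, f, h⟩ := exists_isDualBasis A P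
  let F : P →ₗ[Aᵐᵒᵖ] (Fin n → Aᵐᵒᵖ) := LinearMap.pi fun i => (opSelfEquiv A).toLinearMap ∘ₗ f i
  have hF : Function.Injective F := fun v w hvw => by
    rw [← h v, ← h w]
    refine Finset.sum_congr rfl fun i _ => ?_
    rw [show f i v = f i w from MulOpposite.op_injective (congrFun hvw i)]
  have h1 := LinearMap.rank_le_of_injective F hF
  rw [rank_fun'] at h1
  obtain ⟨r, hr⟩ := Cardinal.lt_aleph0.1 (h1.trans_lt (Cardinal.natCast_lt_aleph0))
  exact ⟨r, hr⟩

variable [IsDomain A]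

/-- The rank of finitely generated projective modules, as a homomorphism on `K0`. -/
def K0.rank : K0 A →+ ℤ :=
  K0.lift (fun P => ((exists_hasRank A P.carrier).choose : ℤ)) fun P Q R ⟨f⟩ => by
    have hP := (exists_hasRank A P.carrier).choose_spec
    have hQR := rank_prod_of_isDomain (exists_hasRank A Q.carrier).choose_spec
      (exists_hasRank A R.carrier).choose_spec
    rw [← f.rank_eq, hP] at hQR
    exact_mod_cast hQR

lemma K0.rank_of {P : Type u} [AddCommGroup P] [Module Aᵐᵒᵖ P] [Module.Finite Aᵐᵒᵖ P]
    [Module.Projective Aᵐᵒᵖ P] {r : ℕ} (h : HasRank A P r) : K0.rank A (K0.of P) = r := by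
  refine (K0.lift_of _ _ P).trans ?_
  have h1 := (exists_hasRank A P).choose_spec.symm.trans h
  exact_mod_cast h1

end RankHom

/-! ### `O^τ` is a right Noetherian domain over which each `e_i B^τ e` has rank one -/

section CornerDomain

variable {Γ : Type u} [CommGroup Γ] [Fintype Γ] {ε : Γ →* ℂˣ} (τ : MonoidAlgebra ℂ Γ)

namespace CyclicWeyl

variable {m : ℕ} [NeZero m] {lam : ZMod m → ℂ} {B : Type u} [Ring B] [Algebra ℂ B]
  [D : CyclicWeyl B m lam]

lemma e_mul_x_pow_ne_zero (j : ZMod m) (a : ℕ) : (e j * x ^ a : B) ≠ 0 := fun h => by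
  have h1 := nf_monomial (B := B) j 0 a
  rw [pow_zero, mul_one, h, map_zero] at h1
  have h2 := congrFun (congrFun h1 a) j
  simp [ypow] at h2

lemma x_pow_mul_e (a : ℕ) (j : ZMod m) : (x ^ a * e j : B) = e (j + (a : ZMod m)) * x ^ a := by
  induction a with
  | zero => simp
  | succ a ih => rw [pow_succ', mul_assoc, ih, ← mul_assoc, x_mul_e, mul_assoc, Nat.cast_succ,
      add_assoc]

lemma exists_ne_zero_corner (i j : ZMod m) : ∃ b : B, b ≠ 0 ∧ e i * b = b ∧ b * e j = b := by
  refine ⟨e i * x ^ (i - j).val, e_mul_x_pow_ne_zero i _, ?_, ?_⟩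
  · rw [← mul_assoc, e_mul_self]
  · rw [mul_assoc, x_pow_mul_e, ZMod.natCast_zmod_val, add_sub_cancel, ← mul_assoc, e_mul_self]

end CyclicWeyl

lemma B.mul_ne_zero (hε : Function.Injective ε) {i : ZMod (Nat.card Γ)} {b c : B ε τ} (hb : b * B.e ε τ i = b)
    (hc : B.e ε τ i * c = c) (hb0 : b ≠ 0) (hc0 : c ≠ 0) : b * c ≠ 0 :=
  let _ := B.cyclicWeyl τ hε
  CyclicWeyl.mul_ne_zero_of_e (i := i) hb hc hb0 hc0

lemma B.exists_ne_zero_corner (hε : Function.Injective ε) (i j : ZMod (Nat.card Γ)) :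
    ∃ b : B ε τ, b ≠ 0 ∧ B.e ε τ i * b = b ∧ b * B.e ε τ j = b :=
  (B.cyclicWeyl τ hε).exists_ne_zero_corner i j

lemma isDomain_O (hε : Function.Injective ε) : IsDomain (O ε τ) := by
  have : Nontrivial (O ε τ) := by
    obtain ⟨b, hb0, hb, hb'⟩ := B.exists_ne_zero_corner τ hε 0 0
    rw [B.e_zero] at hb hb'
    exact ⟨⟨b, O.mem_of_mul hb hb'⟩, 0, fun h => hb0 (congrArg Subtype.val h)⟩
  have : NoZeroDivisors (O ε τ) := ⟨fun {o p} h => by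
    by_contra! h0
    refine B.mul_ne_zero τ hε (i := 0) (b := o.1) (c := p.1) ?_ ?_ (fun h => h0.1 (Subtype.ext h))
      (fun h => h0.2 (Subtype.ext h)) (congrArg Subtype.val h)
    · rw [B.e_zero, O.mul_symIdem]
    · rw [B.e_zero, O.symIdem_mul]⟩
  exact NoZeroDivisors.to_isDomain _

/-- Extending a right ideal `I` to `I B^τ` loses nothing, because `I B^τ e = I (e B^τ e) = I`.
Ascending chains in `O^τ` thus stabilize as they do in `B^τ`. -/
lemma isNoetherianRing_O (hε : Function.Injective ε) : IsNoetherianRing (O ε τ)ᵐᵒᵖ := by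
  have h := (B.cyclicWeyl τ hε).isNoetherian_self
  rw [isNoetherian_iff'] at h
  suffices IsNoetherian (O ε τ)ᵐᵒᵖ (O ε τ) from isNoetherian_of_linearEquiv (opSelfEquiv (O ε τ))
  let J : Submodule (O ε τ)ᵐᵒᵖ (O ε τ) → Submodule (B ε τ)ᵐᵒᵖ (B ε τ) := fun I =>
    Submodule.span _ (O.val ε τ '' I)
  have hJ : Monotone J := fun I I' h => Submodule.span_mono (Set.image_mono h)
  have key : ∀ I, ∀ o : O ε τ, O.val ε τ o ∈ J I → o ∈ I := by
    intro I o ho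
    have : ∀ b ∈ J I, ∀ r, ∃ o' ∈ I, b * r * symIdem ε τ = O.val ε τ o' := by
      intro b hb
      induction hb using Submodule.span_induction with
      | mem b hb =>
        intro r
        obtain ⟨o', ho', rfl⟩ := hb
        have he := (symIdem_isIdempotent ε τ).eq
        let q : O ε τ := ⟨symIdem ε τ * r * symIdem ε τ,
          O.mem_of_mul (by rw [← mul_assoc, ← mul_assoc, he]) (by rw [mul_assoc, he])⟩
        refine ⟨MulOpposite.op q • o', I.smul_mem _ ho', ?_⟩
        change o'.1 * r * symIdem ε τ = o'.1 * (symIdem ε τ * r * symIdem ε τ)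
        rw [← mul_assoc, ← mul_assoc, O.mul_symIdem]
      | zero => exact fun r => ⟨0, I.zero_mem, by rw [zero_mul, zero_mul, map_zero]⟩
      | add b c _ _ hb hc =>
        intro r
        obtain ⟨o', ho', h'⟩ := hb r
        obtain ⟨p', hp', h''⟩ := hc r
        exact ⟨o' + p', I.add_mem ho' hp', by rw [add_mul, add_mul, map_add, h', h'']⟩
      | smul s b _ hb =>
        intro r
        obtain ⟨o', ho', h'⟩ := hb (s.unop * r)
        exact ⟨o', ho', by rw [← h', ← mul_assoc]; rfl⟩
    obtain ⟨o', ho', h'⟩ := this _ ho 1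
    have : o = o' := Subtype.ext ((O.mul_symIdem o).symm.trans (by rwa [mul_one] at h'))
    rwa [this]
  have hinj : Function.Injective J := fun I I' h => le_antisymm
    (fun o ho => key I' o (h ▸ Submodule.subset_span ⟨o, ho, rfl⟩))
    (fun o ho => key I o (h ▸ Submodule.subset_span ⟨o, ho, rfl⟩))
  exact isNoetherian_iff'.2 (hJ.strictMono_of_injective hinj).wellFoundedGT

/-- Left multiplication by nonzero elements of `e_0 B e_i` and of `e_i B e_0` embeds this module
into `O^τ` and `O^τ` into it. -/
lemma hasRank_cut_Be (hε : Function.Injective ε) (i : ZMod (Nat.card Γ))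
    [StrongRankCondition (O ε τ)ᵐᵒᵖ] : HasRank (O ε τ) (cut (O ε τ) (Be ε τ) (B.e ε τ i)) 1 := by
  obtain ⟨b, hb0, hib, hb⟩ := B.exists_ne_zero_corner τ hε i 0
  obtain ⟨c, hc0, hc, hci⟩ := B.exists_ne_zero_corner τ hε 0 i
  rw [B.e_zero] at hb hc
  have hO := rank_opSelf (O ε τ)
  rw [HasRank, Nat.cast_one]
  refine le_antisymm ?_ ?_
  · let F : cut (O ε τ) (Be ε τ) (B.e ε τ i) →ₗ[(O ε τ)ᵐᵒᵖ] O ε τ :=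
      BeToO c hc ∘ₗ Submodule.subtype _
    have hF : Function.Injective F := fun z w hzw => by
      by_contra h0
      have hzw' : c * z.1.1 = c * w.1.1 := congrArg (O.val ε τ) hzw
      refine B.mul_ne_zero τ hε (b := c) (c := (z - w).1.1) hci (congrArg Subtype.val (z - w).2) hc0
        (fun h => h0 (Subtype.ext (Subtype.ext (sub_eq_zero.1 h)))) ?_
      exact (mul_sub _ _ _).trans (sub_eq_zero.2 hzw')
    exact (LinearMap.rank_le_of_injective F hF).trans hO.le
  · let F : O ε τ →ₗ[(O ε τ)ᵐᵒᵖ] cut (O ε τ) (Be ε τ) (B.e ε τ i) :=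
      (OToBe ⟨b, mem_Be_of_mul hb⟩).codRestrict _ fun o => Subtype.ext (by
        change B.e ε τ i * (b * o.1) = b * o.1
        rw [← mul_assoc, hib])
    have hF : Function.Injective F := fun z w hzw => by
      by_contra h0
      have hzw' : b * z.1 = b * w.1 :=
        congrArg (fun w : cut (O ε τ) (Be ε τ) (B.e ε τ i) => w.1.1) hzw
      refine B.mul_ne_zero τ hε (i := 0) (b := b) (c := (z - w).1) ?_ ?_ hb0
        (fun h => h0 (Subtype.ext (sub_eq_zero.1 h))) ?_
      · rw [B.e_zero, hb]
      · rw [B.e_zero, O.symIdem_mul]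
      · exact (mul_sub _ _ _).trans (sub_eq_zero.2 hzw')
    exact hO.ge.trans (LinearMap.rank_le_of_injective F hF)

end CornerDomain

/-! ### The two maps on `K_0`, and rank against dimension -/

section Main

variable {Γ : Type u} [CommGroup Γ] [Fintype Γ] {ε : Γ →* ℂˣ} (τ : MonoidAlgebra ℂ Γ)

lemma B.isIdempotentElem_e (hε : Function.Injective ε) (i : ZMod (Nat.card Γ)) :
    IsIdempotentElem (B.e ε τ i) := (isIdempotentElem_charIdem hε i).map (B.ofGroupAlgebra ε τ)

lemma tensor_irrClass (hε : Function.Injective ε) (i : ZMod (Nat.card Γ)) :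
    K0.tensor (MonoidAlgebra ℂ Γ) (B ε τ) (B ε τ) (irrClass hε i) =
      K0.ofCut (B ε τ) (B ε τ) (B.isIdempotentElem_e τ hε i) :=
  K0.tensor_ofCut _

lemma tensor_surjective (hε : Function.Injective ε) :
    Function.Surjective (K0.tensor (MonoidAlgebra ℂ Γ) (B ε τ) (B ε τ)) := fun ξ => by
  let _ := B.cyclicWeyl τ hε
  refine AddMonoidHom.mem_range.1 ((AddSubgroup.closure_le _).2 ?_ (CyclicWeyl.K0_eq_closure ξ))
  rintro _ ⟨i, rfl⟩
  exact ⟨irrClass hε i, tensor_irrClass τ hε i⟩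

variable {τ}

lemma exists_sum_symIdem_eq_one (hε : Function.Injective ε) (hτ : IsGeneric ε τ) :
    ∃ (n : ℕ) (a b : Fin n → B ε τ), ∑ k, a k * symIdem ε τ * b k = 1 := by
  let _ := B.cyclicWeyl τ hε
  rw [← B.e_zero]
  exact CyclicWeyl.exists_sum_eq_one hτ.sum_Icc_ne_zero

lemma Be_finite (hε : Function.Injective ε) (hτ : IsGeneric ε τ) :
    Module.Finite (O ε τ)ᵐᵒᵖ (Be ε τ) := by
  obtain ⟨n, a, b, h⟩ := exists_sum_symIdem_eq_one hε hτ
  exact (isDualBasis_Be h).finite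

lemma Be_projective (hε : Function.Injective ε) (hτ : IsGeneric ε τ) :
    Module.Projective (O ε τ)ᵐᵒᵖ (Be ε τ) := by
  obtain ⟨n, a, b, h⟩ := exists_sum_symIdem_eq_one hε hτ
  exact (isDualBasis_Be h).projective

lemma exists_sum_irrClass (hε : Function.Injective ε) (ξ : K0 (MonoidAlgebra ℂ Γ)) :
    ∃ n : ZMod (Nat.card Γ) → ℤ, ξ = ∑ i, n i • irrClass hε i := by
  induction K0_groupAlgebra_eq_closure hε ξ using AddSubgroup.closure_induction with
  | mem ξ h =>
    obtain ⟨i, rfl⟩ := h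
    refine ⟨Pi.single i 1, ?_⟩
    rw [Finset.sum_eq_single i (fun j _ hj => by rw [Pi.single_eq_of_ne hj, zero_smul]) (by simp),
      Pi.single_eq_same, one_smul]
  | zero => exact ⟨0, by simp⟩
  | add ξ η _ _ h h' =>
    obtain ⟨n, rfl⟩ := h
    obtain ⟨n', rfl⟩ := h'
    exact ⟨n + n', by simp [add_smul, Finset.sum_add_distrib]⟩
  | neg ξ _ h =>
    obtain ⟨n, rfl⟩ := h
    exact ⟨-n, by simp⟩

section Functors

variable [Module.Finite (O ε τ)ᵐᵒᵖ (Be ε τ)] [Module.Projective (O ε τ)ᵐᵒᵖ (Be ε τ)]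

variable (τ) in
lemma tensor_tensor_irrClass (hε : Function.Injective ε) (i : ZMod (Nat.card Γ)) :
    K0.tensor (B ε τ) (O ε τ) (Be ε τ)
      (K0.tensor (MonoidAlgebra ℂ Γ) (B ε τ) (B ε τ) (irrClass hε i)) =
      K0.ofCut (O ε τ) (Be ε τ) (B.isIdempotentElem_e τ hε i) := by
  rw [tensor_irrClass]
  exact K0.tensor_ofCut _

variable (τ) in
-- Both homomorphisms take the value one on every irreducible class, and these classes generate.
lemma rank_tensor_tensor [IsDomain (O ε τ)] [StrongRankCondition (O ε τ)ᵐᵒᵖ]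
    (hε : Function.Injective ε) (ξ : K0 (MonoidAlgebra ℂ Γ)) :
    K0.rank (O ε τ) (K0.tensor (B ε τ) (O ε τ) (Be ε τ)
      (K0.tensor (MonoidAlgebra ℂ Γ) (B ε τ) (B ε τ) ξ)) = dimHom (MonoidAlgebra ℂ Γ) ξ := by
  obtain ⟨n, rfl⟩ := exists_sum_irrClass hε ξ
  simp only [map_sum, map_zsmul]
  refine Finset.sum_congr rfl fun i _ => ?_
  rw [tensor_tensor_irrClass, dimHom_irrClass]
  have := cut_finite (C := O ε τ) (N := Be ε τ) (B.isIdempotentElem_e τ hε i)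
  have := cut_projective (C := O ε τ) (N := Be ε τ) (B.isIdempotentElem_e τ hε i)
  exact congrArg _ (K0.rank_of (O ε τ) (hasRank_cut_Be τ hε i))

/-- Rank alone gives `∑ n_i = 0`, and the Hattori–Stallings trace alone gives only that `n` is
proportional to `λ`; together they force `n = 0`. -/
lemma tensor_tensor_injective (hε : Function.Injective ε) (hτ : IsGeneric ε τ) :
    Function.Injective fun ξ => K0.tensor (B ε τ) (O ε τ) (Be ε τ)
      (K0.tensor (MonoidAlgebra ℂ Γ) (B ε τ) (B ε τ) ξ) := by
  have := isDomain_O τ hε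
  have := isNoetherianRing_O τ hε
  let F := (K0.tensor (B ε τ) (O ε τ) (Be ε τ)).comp
    (K0.tensor (MonoidAlgebra ℂ Γ) (B ε τ) (B ε τ))
  refine (injective_iff_map_eq_zero F).2 fun ξ hξ => ?_
  have hdim := rank_tensor_tensor τ hε ξ
  obtain ⟨n, rfl⟩ := exists_sum_irrClass hε ξ
  change K0.rank (O ε τ) (F _) = _ at hdim
  rw [hξ, map_zero] at hdim
  simp only [map_sum, map_zsmul, dimHom_irrClass, smul_eq_mul, mul_one] at hdim
  let _ := B.cyclicWeyl τ hε
  obtain ⟨l, a, b, hab⟩ := exists_sum_symIdem_eq_one hε hτ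
  let t : B ε τ →+ CyclicWeyl.TraceSpace (traceOn ε τ) := (CyclicWeyl.trace (B := B ε τ)).toAddMonoidHom
  have ht : ∀ r s, t (r * s) = t (s * r) := CyclicWeyl.trace_mul_comm
  -- The trace of `B^τ`, restricted to the corner, sends the class of `e_i B^τ e` to the trace of
  -- `e_i`.
  have htr := congrArg (K0.trace (t.comp (O.val ε τ)) fun o p => by
    rw [AddMonoidHom.comp_apply, O.val_mul, ht]; rfl) hξ
  rw [map_zero] at htr
  simp only [map_sum, map_zsmul] at htr
  have key : ∀ i, K0.trace (t.comp (O.val ε τ)) (fun o p => by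
      rw [AddMonoidHom.comp_apply, O.val_mul, ht]; rfl) (F (irrClass hε i)) = t (B.e ε τ i) :=
    fun i => (congrArg _ (tensor_tensor_irrClass τ hε i)).trans
      (trace_ofCut_Be t ht _ _ (fun _ => rfl) hab _)
  simp only [key] at htr
  have hn := CyclicWeyl.eq_zero_of_trace_eq_zero (B := B ε τ) hτ.sum_ne_zero hdim.symm htr
  simp [hn]

end Functors

end Main

end KleinianQuant

end

open KleinianQuant in
theorem proposition1 {Γ : Type u} [CommGroup Γ] [Finite Γ]
    (ε : Γ →* ℂˣ) (hε : Function.Injective ε)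
    (τ : MonoidAlgebra ℂ Γ) (hτ : IsGeneric ε τ) :
    ∃ (φ : K0 (MonoidAlgebra ℂ Γ) ≃+ K0 (B ε τ)) (ψ : K0 (B ε τ) ≃+ K0 (O ε τ))
      (rk : K0 (O ε τ) →+ ℤ),
      (∀ (P : Type u) [AddCommGroup P] [Module (MonoidAlgebra ℂ Γ)ᵐᵒᵖ P]
        [Module.Finite (MonoidAlgebra ℂ Γ)ᵐᵒᵖ P] [Module.Projective (MonoidAlgebra ℂ Γ)ᵐᵒᵖ P],
        HasClass (BalancedTensor (MonoidAlgebra ℂ Γ) (B ε τ) P (B ε τ)) (φ (K0.of P))) ∧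
      (∀ (M : Type u) [AddCommGroup M] [Module (B ε τ)ᵐᵒᵖ M]
        [Module.Finite (B ε τ)ᵐᵒᵖ M] [Module.Projective (B ε τ)ᵐᵒᵖ M],
        HasClass (BalancedTensor (B ε τ) (O ε τ) M (Be ε τ)) (ψ (K0.of M))) ∧
      (∀ (N : Type u) [AddCommGroup N] [Module (O ε τ)ᵐᵒᵖ N]
        [Module.Finite (O ε τ)ᵐᵒᵖ N] [Module.Projective (O ε τ)ᵐᵒᵖ N],
        ∃ r : ℕ, HasRank (O ε τ) N r ∧ rk (K0.of N) = r) ∧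
      ∀ ξ : K0 (O ε τ), rk ξ = dimHom (MonoidAlgebra ℂ Γ) (φ.symm (ψ.symm ξ)) := by
  let _ := Fintype.ofFinite Γ
  have := Be_finite hε hτ
  have := Be_projective hε hτ
  have := isDomain_O τ hε
  have := isNoetherianRing_O τ hε
  have hinj := tensor_tensor_injective hε hτ
  have hsurj := tensor_surjective τ hε
  let φ : K0 (MonoidAlgebra ℂ Γ) ≃+ K0 (B ε τ) :=
    AddEquiv.ofBijective (K0.tensor (MonoidAlgebra ℂ Γ) (B ε τ) (B ε τ))
      ⟨hinj.of_comp, hsurj⟩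
  let ψ : K0 (B ε τ) ≃+ K0 (O ε τ) :=
    AddEquiv.ofBijective (K0.tensor (B ε τ) (O ε τ) (Be ε τ))
      -- The composite is injective and the first map is onto, so the second map is injective.
      ⟨hinj.of_comp_right hsurj, K0.tensor_Be_surjective⟩
  refine ⟨φ, ψ, K0.rank (O ε τ), fun P => K0.hasClass_tensor _ _ _ P,
    fun M => K0.hasClass_tensor _ _ _ M, fun N _ _ _ _ => ?_, fun ξ => ?_⟩
  · obtain ⟨r, hr⟩ := exists_hasRank (O ε τ) N
    exact ⟨r, hr, K0.rank_of _ hr⟩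
  · obtain ⟨η, rfl⟩ := (φ.trans ψ).surjective ξ
    rw [AddEquiv.trans_apply, AddEquiv.symm_apply_apply, AddEquiv.symm_apply_apply]
    exact rank_tensor_tensor τ hε η
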